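/- Let $d\in\{1,2,3\}$, let $\Omega\subset\mathbb R^d$ be a bounded Lipschitz domain, $T>0$, $I=(0,T)$, $Q=I\times\Omega$. Write $\operatorname{div}_{t,x}(v,\boldsymbol\tau)=\partial_t v+\operatorname{div}_x\boldsymbol\tau$ (in the sense of distributions on $Q$) and let $$U=\{(v,\boldsymbol\tau)\in L^2(I;H^1_0(\Omega))\times L^2(Q)^d:\ \operatorname{div}_{t,x}(v,\boldsymbol\tau)\in L^2(Q)\},$$ $$\|(v,\boldsymbol\tau)\|_U^2=\|\nabla_x v\|_{L^2(Q)}^2+\|\boldsymbol\tau\|_{L^2(Q)}^2+\|\operatorname{div}_{t,x}(v,\boldsymbol\tau)\|_{L^2(Q)}^2 .$$ For $(v,\boldsymbol\tau)\in U$, the function $v$ has a unique representative in $C^0([0,T];L^2(\Omega))$, and $v(t)$ denotes its value at $t\in[0,T]$. Let $\mathcal T_t$ be a finite partition of $I$ into open intervals and $\mathcal T_x$ a finite partition of $\Omega$ into open simplices. Assume that, for a constant $c_{\rm qu}>0$, every interval $K_t$ of $\mathcal T_t$ satisfies $\max_{K'\in\mathcal T_t}|K'|\le c_{\rm qu}|K_t|$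 and every $K_x\in\mathcal T_x$ satisfies $\max_{K'\in\mathcal T_x}\operatorname{diam}(K')\le c_{\rm qu}\operatorname{diam}(K_x)$, and that, for a constant $c_{\rm sr}>0$, $\operatorname{diam}(K_x)^d\le c_{\rm sr}|K_x|$ for all $K_x\in\mathcal T_x$. For integers $k,\ell\ge1$ let $$U_h=\big(S_k(\mathcal T_t)\otimes S_{\ell,0}(\mathcal T_x)\big)\times\big(P_{k-1}(\mathcal T_t)\otimes \boldsymbol{RT}_\ell(\mathcal T_x)\big)\subset U,$$ where $P_{k-1}(\mathcal T_t)$ denotes the piecewise polynomials of degree at most $k-1$ on $\mathcal T_t$, $S_k(\mathcal T_t)$ the continuous piecewise polynomials of degree at most $k$, $S_{\ell,0}(\mathcal T_x)$ the continuous piecewise polynomials of degree at most $\ell$ on $\mathcal T_x$ with vanishing trace on $\partial\Omega$ (that is, belonging to $H^1_0(\Omega)$), and $\boldsymbol{RT}_\ell(\mathcal T_x)$ the $H(\operatorname{div}_x;\Omega)$-conforming Raviart--Thomas space of order $\ell$, i.e. the fields in $H(\operatorname{div}_x;\Omega)$ that on each simplex have the form $\boldsymbol q(x)+r(x)x$ with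 polynomials $\boldsymbol q$ (vector-valued) and $r$ of degree at most $\ell$. Let $f\in L^2(Q)$, $u_0\in L^2(\Omega)$, and let $\boldsymbol u=(u,\boldsymbol\sigma)\in U$ and $\boldsymbol u_h=(u_h,\boldsymbol\sigma_h)\in U_h$ minimize the functional $$(v,\boldsymbol\tau)\mapsto\|\operatorname{div}_{t,x}(v,\boldsymbol\tau)-f\|_{L^2(Q)}^2+\|\nabla_x v+\boldsymbol\tau\|_{L^2(Q)}^2+\|v(0)-u_0\|_{L^2(\Omega)}^2$$ over $U$ and over $U_h$, respectively. Then there is a constant $C>0$ depending only on $\Omega$, $T$, $c_{\rm qu}$ and $c_{\rm sr}$ (and thus not on $k,\ell$, the meshes, $f$, $u_0$) such that, with $$A=\|f-\operatorname{div}_{t,x}\boldsymbol u_h\|_{L^2(Q)}\|u-u_h\|_{L^2(Q)}+\|u-u_h\|_{L^2(Q)}^2+\|\nabla_x(u-u_h)\|_{L^2(Q)}\|\boldsymbol\sigma-\boldsymbol\sigma_h\|_{L^2(Q)},$$ one has $$\max_{\tau\in[0,T]}\|u(\tau)-u_h(\tau)\|_{L^2(\Omega)}^2\le C\,A\qquad\text{and}\qquad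 A\le C\,\|\boldsymbol u-\boldsymbol u_h\|_U\big(\|u-u_h\|_{L^2(Q)}+\|\boldsymbol\sigma-\boldsymbol\sigma_h\|_{L^2(Q)}\big).$$ -/

import Mathlib

open MeasureTheory Set Filter
open scoped Topology ContDiff RealInnerProductSpace NNReal

noncomputable section

namespace FOSLS

/-! ### Domains, space-time cylinder, Lebesgue spaces -/

/-- The Euclidean space `ℝᵈ`. -/
abbrev Sp (d : ℕ) : Type := EuclideanSpace ℝ (Fin d)

/-- Bounded Lipschitz domain: a bounded, connected, nonempty open set which, near each of its
boundary points and in a suitable direction `e`, is the strict subgraph of a Lipschitz function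
of the component orthogonal to `e`. -/
structure IsLipschitzDomain {d : ℕ} (Ω : Set (Sp d)) : Prop where
  isOpen : IsOpen Ω
  isConnected : IsConnected Ω
  isBounded : Bornology.IsBounded Ω
  boundary : ∀ x ∈ frontier Ω, ∃ r : ℝ, 0 < r ∧ ∃ e : Sp d, ‖e‖ = 1 ∧
    ∃ (L : ℝ≥0) (γ : Sp d → ℝ), LipschitzWith L γ ∧
      Ω ∩ Metric.ball x r = {y ∈ Metric.ball x r | ⟪y, e⟫ < γ (y - ⟪y, e⟫ • e)}

/-- The space-time cylinder `Q = (0,T) × Ω`. -/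
def cyl {d : ℕ} (T : ℝ) (Ω : Set (Sp d)) : Set (ℝ × Sp d) := Ioo 0 T ×ˢ Ω

/-- `L²(Ω)`. -/
abbrev L2Om {d : ℕ} (Ω : Set (Sp d)) : Type := Lp ℝ 2 (volume.restrict Ω)

/-- `L²(Q)`. -/
abbrev L2Q {d : ℕ} (T : ℝ) (Ω : Set (Sp d)) : Type := Lp ℝ 2 (volume.restrict (cyl T Ω))

/-- `L²(Q)ᵈ`. -/
abbrev L2Qd {d : ℕ} (T : ℝ) (Ω : Set (Sp d)) : Type := Lp (Sp d) 2 (volume.restrict (cyl T Ω))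

/-- `φ ∈ C_c^∞(S)`, extended by zero to the whole space. -/
def IsTest {V : Type*} [NormedAddCommGroup V] [NormedSpace ℝ V] (S : Set V) (φ : V → ℝ) : Prop :=
  ContDiff ℝ ∞ φ ∧ HasCompactSupport φ ∧ tsupport φ ⊆ S

/-! ### Sobolev spaces -/

/-- `w ∈ H₀¹(Ω)` with gradient `g`. Here `H₀¹(Ω)` is the closure of `C_c^∞(Ω)` in `H¹(Ω)`: there
are test functions converging to `w` in `L²(Ω)` whose gradients converge to `g` in `L²(Ω)ᵈ`. -/
def HasH10Grad {d : ℕ} (Ω : Set (Sp d)) (w : Sp d → ℝ) (g : Sp d → Sp d) : Prop :=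
  MemLp w 2 (volume.restrict Ω) ∧ MemLp g 2 (volume.restrict Ω) ∧
    ∃ φ : ℕ → Sp d → ℝ, (∀ n, IsTest Ω (φ n)) ∧
      Tendsto (fun n => eLpNorm (fun x => φ n x - w x) 2 (volume.restrict Ω)) atTop (𝓝 0) ∧
      Tendsto (fun n => eLpNorm (fun x => gradient (φ n) x - g x) 2 (volume.restrict Ω))
        atTop (𝓝 0)

/-- `w ∈ H₀¹(Ω)`. -/
def MemH10 {d : ℕ} (Ω : Set (Sp d)) (w : Sp d → ℝ) : Prop :=
  ∃ g : Sp d → Sp d, HasH10Grad Ω w g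

/-- `τ ∈ H(div_x; Ω)`: both `τ` and its distributional divergence are square integrable. -/
def MemHdiv {d : ℕ} (Ω : Set (Sp d)) (τ : Sp d → Sp d) : Prop :=
  MemLp τ 2 (volume.restrict Ω) ∧
    ∃ g : Sp d → ℝ, MemLp g 2 (volume.restrict Ω) ∧
      ∀ φ : Sp d → ℝ, IsTest Ω φ →
        ∫ x in Ω, fderiv ℝ φ x (τ x) = -∫ x in Ω, g x * φ x

section Cylinder

variable {d : ℕ} {T : ℝ} {Ω : Set (Sp d)}

/-- `v ∈ L²(I; H₀¹(Ω))` with `∇_x v = G`, where `L²(I; L²(Ω))` is identified with `L²(Q)`. -/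
def HasGradX (v : L2Q T Ω) (G : L2Qd T Ω) : Prop :=
  ∀ᵐ t ∂(volume.restrict (Ioo 0 T)), HasH10Grad Ω (fun x => v (t, x)) (fun x => G (t, x))

/-- `div_{t,x} (v, τ) = F` in the sense of distributions on `Q`; note that
`fderiv ℝ φ z (v z, τ z) = v ∂ₜφ + τ · ∇ₓφ` at the point `z`. -/
def HasDivTX (v : L2Q T Ω × L2Qd T Ω) (F : L2Q T Ω) : Prop :=
  ∀ φ : ℝ × Sp d → ℝ, IsTest (cyl T Ω) φ →
    ∫ z in cyl T Ω, fderiv ℝ φ z (v.1 z, v.2 z) = -∫ z in cyl T Ω, F z * φ z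

open Classical in
/-- `∇_x v ∈ L²(Q)ᵈ` for `v ∈ L²(I; H₀¹(Ω))` (and `0` otherwise). -/
def gradX (v : L2Q T Ω) : L2Qd T Ω :=
  if h : ∃ G : L2Qd T Ω, HasGradX v G then h.choose else 0

open Classical in
/-- `div_{t,x} v ∈ L²(Q)` for `v ∈ H(div_{t,x}; Q)` (and `0` otherwise). -/
def divTX (v : L2Q T Ω × L2Qd T Ω) : L2Q T Ω :=
  if h : ∃ F : L2Q T Ω, HasDivTX v F then h.choose else 0

/-- `w ∈ C⁰([0,T]; L²(Ω))` is the time-continuous representative of `v ∈ L²(Q)`. -/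
def IsTimeRep (v : L2Q T Ω) (w : ℝ → L2Om Ω) : Prop :=
  ContinuousOn w (Icc 0 T) ∧
    ∀ᵐ t ∂(volume.restrict (Ioo 0 T)), w t =ᵐ[volume.restrict Ω] fun x => v (t, x)

open Classical in
/-- The value `v(t) ∈ L²(Ω)`, `t ∈ [0,T]`, of the time-continuous representative of `v`, if `v` has
one (and `0` otherwise). -/
def timeRep (v : L2Q T Ω) : ℝ → L2Om Ω :=
  if h : ∃ w : ℝ → L2Om Ω, IsTimeRep v w then h.choose else 0

/-- `U = H(div_{t,x}; Q) ∩ (L²(I; H₀¹(Ω)) × L²(Q)ᵈ)`. -/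
def spaceU (T : ℝ) (Ω : Set (Sp d)) : Set (L2Q T Ω × L2Qd T Ω) :=
  {v | (∃ F : L2Q T Ω, HasDivTX v F) ∧ ∃ G : L2Qd T Ω, HasGradX v.1 G}

/-- The norm of `U`. -/
def normU (v : L2Q T Ω × L2Qd T Ω) : ℝ :=
  Real.sqrt (‖gradX v.1‖ ^ 2 + ‖v.2‖ ^ 2 + ‖divTX v‖ ^ 2)

/-- The least-squares functional with data `f` and `u₀`. -/
def lsq (f : L2Q T Ω) (u₀ : L2Om Ω) (v : L2Q T Ω × L2Qd T Ω) : ℝ :=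
  ‖divTX v - f‖ ^ 2 + ‖gradX v.1 + v.2‖ ^ 2 + ‖timeRep v.1 0 - u₀‖ ^ 2

/-- `v` minimizes the least-squares functional over `S`. -/
def IsLsqMin (f : L2Q T Ω) (u₀ : L2Om Ω) (S : Set (L2Q T Ω × L2Qd T Ω))
    (v : L2Q T Ω × L2Qd T Ω) : Prop :=
  v ∈ S ∧ IsMinOn (lsq f u₀) S v

end Cylinder

/-! ### Meshes -/

/-- A partition of `(0,T)` into finitely many open intervals `(t_i, t_{i+1})`. -/
structure TimeMesh (T : ℝ) where
  N : ℕ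
  node : Fin (N + 1) → ℝ
  strictMono : StrictMono node
  node_zero : node 0 = 0
  node_last : node (Fin.last N) = T

/-- The `i`-th open time interval. -/
def TimeMesh.elem {T : ℝ} (M : TimeMesh T) (i : Fin M.N) : Set ℝ :=
  Ioo (M.node i.castSucc) (M.node i.succ)

/-- The open simplex spanned by the vertices of `S`. -/
def openSimplex {d : ℕ} (S : Affine.Simplex ℝ (Sp d) d) : Set (Sp d) :=
  interior (convexHull ℝ (range S.points))

/-- A partition of `Ω` into finitely many (nondegenerate) open simplices. -/
structure SpaceMesh {d : ℕ} (Ω : Set (Sp d)) where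
  N : ℕ
  simplex : Fin N → Affine.Simplex ℝ (Sp d) d
  subset : ∀ i, openSimplex (simplex i) ⊆ Ω
  disjoint : ∀ i j, i ≠ j → Disjoint (openSimplex (simplex i)) (openSimplex (simplex j))
  cover : ⋃ i, convexHull ℝ (range (simplex i).points) = closure Ω

/-- The `i`-th open simplex. -/
def SpaceMesh.elem {d : ℕ} {Ω : Set (Sp d)} (M : SpaceMesh Ω) (i : Fin M.N) : Set (Sp d) :=
  openSimplex (M.simplex i)

/-- Quasi-uniformity in time with constant `c`: the largest interval length is at most
`c` times the length of any interval. -/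
def TimeMesh.QuasiUniform {T : ℝ} (M : TimeMesh T) (c : ℝ) : Prop :=
  ∀ i j, volume.real (M.elem j) ≤ c * volume.real (M.elem i)

/-- Quasi-uniformity in space with constant `c`: the largest diameter is at most `c` times the
diameter of any simplex. -/
def SpaceMesh.QuasiUniform {d : ℕ} {Ω : Set (Sp d)} (M : SpaceMesh Ω) (c : ℝ) : Prop :=
  ∀ i j, Metric.diam (M.elem j) ≤ c * Metric.diam (M.elem i)

/-- Shape regularity with constant `c`. -/
def SpaceMesh.ShapeRegular {d : ℕ} {Ω : Set (Sp d)} (M : SpaceMesh Ω) (c : ℝ) : Prop :=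
  ∀ i, Metric.diam (M.elem i) ^ d ≤ c * volume.real (M.elem i)

/-! ### Finite element spaces -/

/-- `P_k` in time: piecewise polynomials of degree at most `k`. -/
def PTime {T : ℝ} (M : TimeMesh T) (k : ℕ) : Set (ℝ → ℝ) :=
  {p | ∀ i, ∃ q : Polynomial ℝ, q.natDegree ≤ k ∧ ∀ t ∈ M.elem i, p t = q.eval t}

/-- `S_k` in time: continuous piecewise polynomials of degree at most `k`. -/
def STime {T : ℝ} (M : TimeMesh T) (k : ℕ) : Set (ℝ → ℝ) :=
  {p | p ∈ PTime M k ∧ ContinuousOn p (Icc 0 T)}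

/-- `P_ℓ` in space: piecewise polynomials of total degree at most `ℓ`. -/
def PSpace {d : ℕ} {Ω : Set (Sp d)} (M : SpaceMesh Ω) (ℓ : ℕ) : Set (Sp d → ℝ) :=
  {w | ∀ i, ∃ q : MvPolynomial (Fin d) ℝ, q.totalDegree ≤ ℓ ∧
    ∀ x ∈ M.elem i, w x = MvPolynomial.eval (fun j => x j) q}

/-- `S_{ℓ,0}` in space: continuous piecewise polynomials of degree at most `ℓ` with vanishing trace
on the boundary, i.e. which belong to `H₀¹(Ω)`. -/
def SSpace0 {d : ℕ} {Ω : Set (Sp d)} (M : SpaceMesh Ω) (ℓ : ℕ) : Set (Sp d → ℝ) :=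
  {w | w ∈ PSpace M ℓ ∧ ContinuousOn w (closure Ω) ∧ MemH10 Ω w}

/-- The Raviart--Thomas space of order `ℓ`: the fields in `H(div_x; Ω)` whose restriction to each
simplex is of the form `q(x) + r(x) x` with `q ∈ (P_ℓ)ᵈ` and `r ∈ P_ℓ`. -/
def RTSpace {d : ℕ} {Ω : Set (Sp d)} (M : SpaceMesh Ω) (ℓ : ℕ) : Set (Sp d → Sp d) :=
  {τ | MemHdiv Ω τ ∧
    ∀ i, ∃ (q : Fin d → MvPolynomial (Fin d) ℝ) (r : MvPolynomial (Fin d) ℝ),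
      (∀ j, (q j).totalDegree ≤ ℓ) ∧ r.totalDegree ≤ ℓ ∧
      ∀ x ∈ M.elem i, ∀ j, τ x j =
        MvPolynomial.eval (fun m => x m) (q j) + MvPolynomial.eval (fun m => x m) r * x j}

/-- The discrete space `U_h = (S_k ⊗ S_{ℓ,0}) × (P_{k-1} ⊗ RT_ℓ)`; the elements of an algebraic
tensor product are the finite sums of products. -/
def discU {d : ℕ} {T : ℝ} {Ω : Set (Sp d)} (Mt : TimeMesh T) (Mx : SpaceMesh Ω) (k ℓ : ℕ) :
    Set (L2Q T Ω × L2Qd T Ω) :=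
  {v | (∃ (n : ℕ) (p : Fin n → ℝ → ℝ) (w : Fin n → Sp d → ℝ),
          (∀ i, p i ∈ STime Mt k) ∧ (∀ i, w i ∈ SSpace0 Mx ℓ) ∧
          v.1 =ᵐ[volume.restrict (cyl T Ω)] fun z => ∑ i, p i z.1 * w i z.2) ∧
       (∃ (n : ℕ) (p : Fin n → ℝ → ℝ) (τ : Fin n → Sp d → Sp d),
          (∀ i, p i ∈ PTime Mt (k - 1)) ∧ (∀ i, τ i ∈ RTSpace Mx ℓ) ∧
          v.2 =ᵐ[volume.restrict (cyl T Ω)] fun z => ∑ i, p i z.1 • τ i z.2)}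

end FOSLS

end

/-!
The error `e = u - u_h` in the first component is estimated by the energy identity of the space
`U`: for `(v, τ) ∈ U` with `F = div_{t,x} (v, τ)`, formally

`d/dt ‖v(t)‖² = 2 ∫_Ω (F v + τ · ∇ₓv)`.

Since `v` is only known to be in `L²(I; H₀¹(Ω))` with `∂ₜv` in the dual of this space, this identity
and the continuity of `t ↦ v(t)` require the Lions–Magenes lemma. It is shown in an abstract Hilbert
space setting (`exists_energyRep`): mollification with kernels that only look at future times is
admissible away from the final time, a time reversal covers the rest, and energy identities pass
to `L²` limits. Averaging the identity over its starting time bounds `‖v(t)‖²` at every `t ∈ [0,T]`,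
including `t = 0`, by `T⁻¹ ‖v‖² + 2 (‖F‖ ‖v‖ + ‖τ‖ ‖∇ₓv‖)` (`IsInU.norm_sq_le`). No discrete
orthogonality, and hence no property of the mesh, enters; it is only used that the discrete space is
contained in `U` (`discU_subset_spaceU`).

For the error, `F = div_{t,x} u - div_{t,x} u_h`, and it remains to see that `div_{t,x} u = f`, i.e.
that the continuous minimum is attained at the exact solution of the heat equation
(`IsLsqMin.divTX_eq`). This is derived without an existence theory for the heat equation: the
normal equations say that the residuals `r = div_{t,x} u - f` and `ρ = ∇ₓu + σ` satisfy `ρ = ∇ₓr`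
with `r ∈ L²(I; H₀¹(Ω))`, and `∂ₜr + div_x ρ = 0` with `r(T) = 0`. So `r` solves a homogeneous
backward heat equation, and the energy identity `-‖r(0)‖² = 2 ‖ρ‖²` gives `ρ = 0` and then `r = 0`.

With `div_{t,x} u = f`, the second estimate follows from the definition of the norm of `U` and the
Poincaré–Friedrichs inequality `‖e‖ ≤ C ‖∇ₓe‖`.
-/

noncomputable section

open scoped ENNReal

namespace FOSLS

/-! ### Mollification in time -/

section Mollification

variable {K : Type*} [NormedAddCommGroup K] [NormedSpace ℝ K]

/-- Translations act continuously on `L²(ℝ; K)`. -/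
theorem tendsto_eLpNorm_translate_sub {E : Type*} [NormedAddCommGroup E] {k : ℝ → E}
    (hk : MemLp k 2 volume) :
    Tendsto (fun s : ℝ => eLpNorm (fun t => k (t - s) - k t) 2 volume) (𝓝 0) (𝓝 0) := by
  have hmp : ∀ s : ℝ, MeasurePreserving (fun t : ℝ => t - s) volume volume := fun s =>
    measurePreserving_sub_right volume s
  let g : ℝ → C(ℝ, ℝ) := fun s => ⟨fun t => t - s, by fun_prop⟩
  have hg : Tendsto g (𝓝 0) (𝓝 (g 0)) := by
    have : Continuous g := ContinuousMap.continuous_of_continuous_uncurry _ (by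
      change Continuous fun p : ℝ × ℝ => p.2 - p.1
      fun_prop)
    exact this.tendsto 0
  have key := Tendsto.compMeasurePreservingLp (p := 2) (μ := (volume : Measure ℝ))
    (ν := (volume : Measure ℝ)) (l := 𝓝 (0 : ℝ)) (tendsto_const_nhds (x := hk.toLp k)) hg
    (fun s => hmp s) (hmp 0) (by simp)
  rw [tendsto_iff_edist_tendsto_0] at key
  refine key.congr fun s => ?_
  rw [Lp.edist_def]
  refine eLpNorm_congr_ae ?_
  have h1 := (Lp.coeFn_compMeasurePreserving (hk.toLp k) (hmp s)).trans
    ((hmp s).quasiMeasurePreserving.ae_eq_comp hk.coeFn_toLp)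
  have h2 := (Lp.coeFn_compMeasurePreserving (hk.toLp k) (hmp 0)).trans
    ((hmp 0).quasiMeasurePreserving.ae_eq_comp hk.coeFn_toLp)
  filter_upwards [h1, h2] with t ht1 ht2
  simp only [Pi.sub_apply]
  change (Lp.compMeasurePreserving _ (hmp s) _ : ℝ → E) t -
    (Lp.compMeasurePreserving _ (hmp 0) _ : ℝ → E) t = _
  rw [ht1, ht2]
  simp

/-- The convolution `ρ ⋆ k` on the real line. -/
def mollify (ρ : ℝ → ℝ) (k : ℝ → K) : ℝ → K :=
  convolution ρ k (ContinuousLinearMap.lsmul ℝ ℝ) volume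

theorem mollify_apply (ρ : ℝ → ℝ) (k : ℝ → K) (t : ℝ) :
    mollify ρ k t = ∫ s, ρ s • k (t - s) := rfl

theorem mollify_apply_swap (ρ : ℝ → ℝ) (k : ℝ → K) (t : ℝ) :
    mollify ρ k t = ∫ s, ρ (t - s) • k s := by
  rw [mollify_apply, ← integral_sub_left_eq_self (fun s => ρ (t - s) • k s) volume t]
  simp

/-- By Jensen's inequality, `ρ ⋆ k - k` is bounded in `L²` by the largest `L²` distance of `k` to
its translates by elements of the support of `ρ`. -/
theorem eLpNorm_mollify_sub_le [CompleteSpace K]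
    {ρ : ℝ → ℝ} (hρc : Continuous ρ) (hρs : HasCompactSupport ρ)
    (hρ0 : ∀ s, 0 ≤ ρ s) (hρ1 : ∫ s, ρ s = 1) {k : ℝ → K} (hkm : StronglyMeasurable k)
    (hk : MemLp k 2 volume) {ε : ℝ≥0∞}
    (hε : ∀ s, ρ s ≠ 0 → eLpNorm (fun t => k (t - s) - k t) 2 volume ≤ ε) :
    eLpNorm (fun t => mollify ρ k t - k t) 2 volume ≤ ε := by
  have hρi : Integrable ρ := hρc.integrable_of_hasCompactSupport hρs
  have hloc : LocallyIntegrable k volume := hk.locallyIntegrable (by norm_num)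
  have hsq : ∀ g : ℝ → K, eLpNorm g 2 volume ^ 2 = ∫⁻ t, ‖g t‖ₑ ^ 2 := fun g => by
    have := eLpNorm_nnreal_pow_eq_lintegral (f := g) (p := 2) (μ := volume) (by norm_num)
    simpa using this
  have hmeas : Measurable (fun p : ℝ × ℝ => ‖k (p.1 - p.2) - k p.1‖ₑ) :=
    ((hkm.comp_measurable (measurable_fst.sub measurable_snd)).sub
      (hkm.comp_measurable measurable_fst)).enorm
  have hρm : Measurable fun s => ENNReal.ofReal (ρ s) := hρc.measurable.ennreal_ofReal
  set ν : Measure ℝ := volume.withDensity fun s => ENNReal.ofReal (ρ s) with hν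
  have hνp : IsProbabilityMeasure ν := ⟨by
    rw [hν, withDensity_apply _ MeasurableSet.univ, Measure.restrict_univ,
      ← ofReal_integral_eq_lintegral_ofReal hρi (Eventually.of_forall hρ0), hρ1]
    simp⟩
  have hpt : ∀ t, ‖mollify ρ k t - k t‖ₑ ^ 2 ≤ ∫⁻ s, ‖k (t - s) - k t‖ₑ ^ 2 ∂ν := fun t => by
    have hi : Integrable (fun s => ρ s • k (t - s)) :=
      (hρs.convolutionExists_left (ContinuousLinearMap.lsmul ℝ ℝ) hρc hloc t)
    have h1 : mollify ρ k t - k t = ∫ s, ρ s • (k (t - s) - k t) := by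
      simp only [smul_sub]
      rw [integral_sub hi (hρi.smul_const _), integral_smul_const, hρ1, one_smul, mollify_apply]
    have h2 : ‖mollify ρ k t - k t‖ₑ ≤ ∫⁻ s, ‖k (t - s) - k t‖ₑ ∂ν := by
      rw [h1, hν, lintegral_withDensity_eq_lintegral_mul _ hρm
        (show Measurable fun s => ‖k (t - s) - k t‖ₑ from
          hmeas.comp (measurable_const.prodMk measurable_id))]
      refine (enorm_integral_le_lintegral_enorm _).trans (lintegral_mono fun s => ?_)
      rw [enorm_smul, Real.enorm_eq_ofReal (hρ0 s)]
      rfl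
    have h3 := eLpNorm_le_eLpNorm_of_exponent_le (μ := ν) (p := 1) (q := 2)
      (f := fun s => k (t - s) - k t) (by norm_num)
      ((hkm.comp_measurable (measurable_const.sub measurable_id)).sub
        stronglyMeasurable_const).aestronglyMeasurable
    rw [eLpNorm_one_eq_lintegral_enorm] at h3
    have h4 := eLpNorm_nnreal_pow_eq_lintegral (f := fun s => k (t - s) - k t) (p := 2) (μ := ν)
      (by norm_num)
    calc ‖mollify ρ k t - k t‖ₑ ^ 2 ≤ eLpNorm (fun s => k (t - s) - k t) 2 ν ^ 2 := by
          gcongr; exact h2.trans h3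
      _ = _ := by simpa using h4
  have : eLpNorm (fun t => mollify ρ k t - k t) 2 volume ^ 2 ≤ ε ^ 2 := by
    rw [hsq]
    calc ∫⁻ t, ‖mollify ρ k t - k t‖ₑ ^ 2 ≤ ∫⁻ t, ∫⁻ s, ‖k (t - s) - k t‖ₑ ^ 2 ∂ν :=
          lintegral_mono hpt
      _ = ∫⁻ s, ∫⁻ t, ‖k (t - s) - k t‖ₑ ^ 2 ∂volume ∂ν :=
          lintegral_lintegral_swap (hmeas.pow_const 2).aemeasurable
      _ ≤ ∫⁻ s, ε ^ 2 ∂ν := by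
          refine lintegral_mono_ae ?_
          rw [hν, ae_withDensity_iff hρm]
          refine Eventually.of_forall fun s hs => ?_
          rw [← hsq]
          gcongr
          refine hε s fun h => hs (by simp [h])
      _ = ε ^ 2 := by simp
  exact (ENNReal.pow_le_pow_left_iff two_ne_zero).1 this

/-- A smooth bump of integral one supported in `(-δ, 0)`, the support shrinking to `0` as `n`
grows. Convolution with it only looks at future times. -/
def futureBump (δ : ℝ) (hδ : 0 < δ) (n : ℕ) : ContDiffBump (-(δ / (n + 2)) : ℝ) where
  rIn := δ / (n + 2) / 4
  rOut := δ / (n + 2) / 2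
  rIn_pos := by positivity
  rIn_lt_rOut := by
    have : 0 < δ / (n + 2) := by positivity
    linarith

/-- The mollifier given by `futureBump`. -/
def futureKernel (δ : ℝ) (hδ : 0 < δ) (n : ℕ) : ℝ → ℝ := (futureBump δ hδ n).normed volume

theorem futureKernel_contDiff {δ : ℝ} (hδ : 0 < δ) (n : ℕ) :
    ContDiff ℝ ∞ (futureKernel δ hδ n) := (futureBump δ hδ n).contDiff_normed

theorem futureKernel_hasCompactSupport {δ : ℝ} (hδ : 0 < δ) (n : ℕ) :
    HasCompactSupport (futureKernel δ hδ n) := (futureBump δ hδ n).hasCompactSupport_normed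

theorem futureKernel_tsupport {δ : ℝ} (hδ : 0 < δ) (n : ℕ) :
    tsupport (futureKernel δ hδ n) ⊆ Ioo (-(2 * (δ / (n + 2)))) 0 := by
  have h : 0 < δ / (n + 2) := by positivity
  rw [futureKernel, ContDiffBump.tsupport_normed_eq, Real.closedBall_eq_Icc]
  intro s hs
  simp only [futureBump, mem_Icc] at hs
  constructor <;> linarith [hs.1, hs.2]

theorem tendsto_mollify_futureKernel [CompleteSpace K] {δ : ℝ} (hδ : 0 < δ) {k : ℝ → K}
    (hkm : StronglyMeasurable k) (hk : MemLp k 2 volume) :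
    Tendsto (fun n => eLpNorm (fun t => mollify (futureKernel δ hδ n) k t - k t) 2 volume)
      atTop (𝓝 0) := by
  rw [ENNReal.tendsto_nhds_zero]
  intro ε hε
  have h1 := (ENNReal.tendsto_nhds_zero.1 (tendsto_eLpNorm_translate_sub hk)) ε hε
  rw [Metric.eventually_nhds_iff] at h1
  obtain ⟨r, hr, h1⟩ := h1
  have h2 : Tendsto (fun n : ℕ => 2 * (δ / ((n : ℝ) + 2))) atTop (𝓝 0) := by
    have : Tendsto (fun n : ℕ => (n : ℝ) + 2) atTop atTop :=
      tendsto_atTop_add_const_right _ _ tendsto_natCast_atTop_atTop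
    simpa using (this.const_div_atTop δ).const_mul 2
  filter_upwards [h2.eventually_lt_const hr] with n hn
  refine eLpNorm_mollify_sub_le (futureKernel_contDiff hδ n).continuous
    (futureKernel_hasCompactSupport hδ n) (fun s => (futureBump δ hδ n).nonneg_normed s)
    (futureBump δ hδ n).integral_normed hkm hk fun s hs => ?_
  have hs' := futureKernel_tsupport hδ n (subset_tsupport _ hs)
  refine h1 ?_
  rw [Real.dist_eq, sub_zero, abs_lt]
  constructor <;> linarith [hs'.1, hs'.2]

end Mollification

/-! ### Energy identities in a Hilbert space and their stability -/

section HilbertTriple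

/-- Cauchy–Schwarz in `L²`. -/
theorem integral_norm_mul_norm_le {α E F : Type*} [MeasurableSpace α] {μ : Measure α}
    [NormedAddCommGroup E] [NormedAddCommGroup F] {f : α → E} {g : α → F}
    (hf : MemLp f 2 μ) (hg : MemLp g 2 μ) :
    ∫ x, ‖f x‖ * ‖g x‖ ∂μ ≤ (eLpNorm f 2 μ).toReal * (eLpNorm g 2 μ).toReal := by
  have h := real_inner_le_norm hf.norm.toLp hg.norm.toLp
  rw [L2.inner_def, Lp.norm_toLp, Lp.norm_toLp, eLpNorm_norm, eLpNorm_norm] at h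
  refine le_trans (le_of_eq (integral_congr_ae ?_)) h
  filter_upwards [hf.norm.coeFn_toLp, hg.norm.coeFn_toLp] with x h1 h2
  rw [h1, h2]
  simp [mul_comm]

theorem integrable_norm_mul_norm {α E F : Type*} [MeasurableSpace α] {μ : Measure α}
    [NormedAddCommGroup E] [NormedAddCommGroup F] {f : α → E} {g : α → F}
    (hf : MemLp f 2 μ) (hg : MemLp g 2 μ) : Integrable (fun x => ‖f x‖ * ‖g x‖) μ :=
  hf.norm.integrable_mul hg.norm

theorem integrable_inner_of_memLp {α E : Type*} [MeasurableSpace α] {μ : Measure α}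
    [NormedAddCommGroup E] [InnerProductSpace ℝ E] {f g : α → E}
    (hf : MemLp f 2 μ) (hg : MemLp g 2 μ) : Integrable (fun x => ⟪f x, g x⟫) μ :=
  (integrable_norm_mul_norm hf hg).mono' (hf.1.inner hg.1)
    (Eventually.of_forall fun _ => norm_inner_le_norm _ _)

/-- A function whose increments on `[a, b]` are at most `B` exceeds its mean by at most `B`. -/
theorem mul_le_integral_add_of_sub_le {y : ℝ → ℝ} {a b B : ℝ} (hab : a ≤ b)
    (hy : ContinuousOn y (Icc a b)) (hB : ∀ s ∈ Icc a b, ∀ t ∈ Icc a b, y t - y s ≤ B)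
    {t : ℝ} (ht : t ∈ Icc a b) : (b - a) * y t ≤ (∫ s in a..b, y s) + (b - a) * B := by
  have h := intervalIntegral.integral_mono_on (f := fun _ => y t - B) (g := y) (μ := volume) hab
    (by simp) (by rw [← uIcc_of_le hab] at hy; exact hy.intervalIntegrable)
    (fun s hs => by linarith [hB s hs t ht])
  rw [intervalIntegral.integral_const, smul_eq_mul] at h
  linarith

variable {K H : Type*} [NormedAddCommGroup K] [InnerProductSpace ℝ K]
  [NormedAddCommGroup H] [InnerProductSpace ℝ H]

/-- On `[a, b]`, `w` is a continuous representative of `π ∘ k` which satisfies the energy identity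
`‖w(t)‖² - ‖w(s)‖² = 2 ∫ₛᵗ ⟪f, k⟫`. -/
structure IsEnergyRep (π : K →L[ℝ] H) (k f : ℝ → K) (a b : ℝ) (w : ℝ → H) : Prop where
  continuousOn : ContinuousOn w (Icc a b)
  ae_eq : ∀ᵐ t ∂(volume.restrict (Icc a b)), w t = π (k t)
  energy : ∀ s ∈ Icc a b, ∀ t ∈ Icc a b, ‖w t‖ ^ 2 - ‖w s‖ ^ 2 = 2 * ∫ r in s..t, ⟪f r, k r⟫

/-- If `π†π k` is differentiable at `t` with derivative `f` and `k` is merely continuous there, then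
`‖π k‖²` is differentiable. -/
theorem hasDerivAt_norm_sq_of_adjoint [CompleteSpace K] [CompleteSpace H]
    (π : K →L[ℝ] H) {k : ℝ → K} {f : K} {t : ℝ}
    (hk : ContinuousAt k t) (hf : HasDerivAt (fun r => (π.adjoint) (π (k r))) f t) :
    HasDerivAt (fun r => ‖π (k r)‖ ^ 2) (2 * ⟪f, k t⟫) t := by
  rw [hasDerivAt_iff_tendsto_slope] at hf ⊢
  have h := hf.inner (𝕜 := ℝ) ((hk.tendsto.mono_left nhdsWithin_le_nhds).add_const (k t))
  have h2 : 2 * ⟪f, k t⟫ = ⟪f, k t + k t⟫ := by rw [inner_add_right]; ring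
  rw [h2]
  refine h.congr fun r => ?_
  simp only [slope, vsub_eq_sub, inner_smul_left, smul_eq_mul, inner_add_right, inner_sub_left,
    ContinuousLinearMap.adjoint_inner_left, real_inner_self_eq_norm_sq]
  rw [real_inner_comm (π (k t)) (π (k r))]
  simp only [conj_trivial]
  ring

/-- The classical energy identity: only `π†π k`, and not `k` itself, has to be differentiable. -/
theorem energy_of_continuous [CompleteSpace K] [CompleteSpace H]
    (π : K →L[ℝ] H) {k f : ℝ → K} {a b : ℝ} (hk : Continuous k)
    (hf : Continuous f)
    (hd : ∀ t ∈ Icc a b, HasDerivAt (fun r => (π.adjoint) (π (k r))) (f t) t) :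
    IsEnergyRep π k f a b (fun t => π (k t)) where
  continuousOn := (π.continuous.comp hk).continuousOn
  ae_eq := by simp
  energy s hs t ht := by
    rw [← intervalIntegral.integral_const_mul, eq_comm]
    refine intervalIntegral.integral_eq_sub_of_hasDerivAt (f := fun r => ‖π (k r)‖ ^ 2)
      (fun r hr => ?_)
      (Continuous.intervalIntegrable (u := fun r => 2 * ⟪f r, k r⟫) (by fun_prop) _ _)
    exact hasDerivAt_norm_sq_of_adjoint π hk.continuousAt
      (hd r ((ordConnected_Icc.uIcc_subset hs ht) hr))

theorem abs_intervalIntegral_inner_le {k f : ℝ → K} {a b s t : ℝ}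
    (hk : MemLp k 2 (volume.restrict (Icc a b))) (hf : MemLp f 2 (volume.restrict (Icc a b)))
    (hs : s ∈ Icc a b) (ht : t ∈ Icc a b) :
    |∫ r in s..t, ⟪f r, k r⟫| ≤ (eLpNorm f 2 (volume.restrict (Icc a b))).toReal *
      (eLpNorm k 2 (volume.restrict (Icc a b))).toReal := by
  refine le_trans ?_ (integral_norm_mul_norm_le hf hk)
  have hsub : uIoc s t ⊆ Icc a b :=
    uIoc_subset_uIcc.trans (ordConnected_Icc.uIcc_subset hs ht)
  rw [← Real.norm_eq_abs]
  refine intervalIntegral.norm_integral_le_integral_norm_uIoc.trans ?_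
  have hi := integrable_norm_mul_norm hf hk
  calc ∫ r in uIoc s t, ‖⟪f r, k r⟫‖ ≤ ∫ r in uIoc s t, ‖f r‖ * ‖k r‖ :=
        integral_mono_of_nonneg (Eventually.of_forall fun _ => norm_nonneg _)
          (IntegrableOn.mono_set hi hsub) (Eventually.of_forall fun _ => norm_inner_le_norm _ _)
    _ ≤ ∫ r in Icc a b, ‖f r‖ * ‖k r‖ :=
        setIntegral_mono_set hi (Eventually.of_forall fun _ => by positivity)
          hsub.eventuallyLE

/-- The maximum over time of `‖w‖` is controlled by `L²` norms in time. -/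
theorem IsEnergyRep.norm_sq_le {π : K →L[ℝ] H} {k f : ℝ → K} {a b : ℝ} {w : ℝ → H}
    (h : IsEnergyRep π k f a b w) (hk : MemLp k 2 (volume.restrict (Icc a b)))
    (hf : MemLp f 2 (volume.restrict (Icc a b))) {t : ℝ} (ht : t ∈ Icc a b) :
    (b - a) * ‖w t‖ ^ 2 ≤ ‖π‖ ^ 2 * (eLpNorm k 2 (volume.restrict (Icc a b))).toReal ^ 2 +
      (b - a) * (2 * ((eLpNorm f 2 (volume.restrict (Icc a b))).toReal *
        (eLpNorm k 2 (volume.restrict (Icc a b))).toReal)) := by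
  have hab : a ≤ b := ht.1.trans ht.2
  refine (mul_le_integral_add_of_sub_le hab (y := fun s => ‖w s‖ ^ 2)
    (h.continuousOn.norm.pow 2) (fun s hs t ht => ?_)
    ht).trans (add_le_add ?_ le_rfl)
  · rw [h.energy s hs t ht]
    have := (le_abs_self _).trans (abs_intervalIntegral_inner_le hk hf hs ht)
    linarith
  · rw [intervalIntegral.integral_of_le hab, ← integral_Icc_eq_integral_Ioc]
    calc ∫ s in Icc a b, ‖w s‖ ^ 2 ≤ ∫ s in Icc a b, ‖π‖ ^ 2 * (‖k s‖ * ‖k s‖) := by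
          refine integral_mono_of_nonneg (Eventually.of_forall fun _ => by positivity)
            ((integrable_norm_mul_norm hk hk).const_mul _) ?_
          filter_upwards [h.ae_eq] with s hs
          rw [hs, ← sq, ← mul_pow]
          exact pow_le_pow_left₀ (norm_nonneg _) (π.le_opNorm _) 2
      _ ≤ _ := by
          rw [integral_const_mul, sq (eLpNorm k 2 _).toReal]
          exact mul_le_mul_of_nonneg_left (integral_norm_mul_norm_le hk hk) (by positivity)

theorem tendsto_integral_inner {α : Type*} [MeasurableSpace α] {μ : Measure α}
    {kn fn : ℕ → α → K} {k f : α → K} (hkn : ∀ n, MemLp (kn n) 2 μ) (hfn : ∀ n, MemLp (fn n) 2 μ)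
    (hk : MemLp k 2 μ) (hf : MemLp f 2 μ)
    (hkt : Tendsto (fun n => eLpNorm (kn n - k) 2 μ) atTop (𝓝 0))
    (hft : Tendsto (fun n => eLpNorm (fn n - f) 2 μ) atTop (𝓝 0)) :
    Tendsto (fun n => ∫ x, ⟪fn n x, kn n x⟫ ∂μ) atTop (𝓝 (∫ x, ⟪f x, k x⟫ ∂μ)) := by
  rw [← Lp.tendsto_Lp_iff_tendsto_eLpNorm'' kn hkn k hk] at hkt
  rw [← Lp.tendsto_Lp_iff_tendsto_eLpNorm'' fn hfn f hf] at hft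
  have h := hft.inner (𝕜 := ℝ) hkt
  have hi : ∀ {u v : α → K} (hu : MemLp u 2 μ) (hv : MemLp v 2 μ),
      ⟪hu.toLp u, hv.toLp v⟫ = ∫ x, ⟪u x, v x⟫ ∂μ := fun hu hv => by
    rw [L2.inner_def]
    refine integral_congr_ae ?_
    filter_upwards [hu.coeFn_toLp, hv.coeFn_toLp] with x h1 h2
    rw [h1, h2]
  simpa only [hi] using h

/-- Energy representatives are stable under `L²` limits of continuous data, because `norm_sq_le`
applied to differences makes the representatives converge uniformly. -/
theorem exists_energyRep_of_tendsto [CompleteSpace K] [CompleteSpace H]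
    (π : K →L[ℝ] H) {a b : ℝ} (hab : a < b)
    {kn fn : ℕ → ℝ → K} {k f : ℝ → K} (hkc : ∀ n, Continuous (kn n))
    (hfc : ∀ n, Continuous (fn n))
    (hd : ∀ n, ∀ t ∈ Icc a b, HasDerivAt (fun r => (π.adjoint) (π (kn n r))) (fn n t) t)
    (hk : MemLp k 2 (volume.restrict (Icc a b))) (hf : MemLp f 2 (volume.restrict (Icc a b)))
    (hkt : Tendsto (fun n => eLpNorm (kn n - k) 2 (volume.restrict (Icc a b))) atTop (𝓝 0))
    (hft : Tendsto (fun n => eLpNorm (fn n - f) 2 (volume.restrict (Icc a b))) atTop (𝓝 0)) :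
    ∃ w, IsEnergyRep π k f a b w := by
  set μ : Measure ℝ := volume.restrict (Icc a b) with hμ
  have hmem : ∀ {g : ℝ → K}, Continuous g → MemLp g 2 μ := fun {g} hg => by
    obtain ⟨C, hC⟩ := isCompact_Icc.exists_bound_of_continuousOn (hg.continuousOn (s := Icc a b))
    exact MemLp.of_bound hg.aestronglyMeasurable C
      ((ae_restrict_mem measurableSet_Icc).mono fun x hx => hC x hx)
  have hkn := fun n => hmem (hkc n)
  have hfn := fun n => hmem (hfc n)
  have hcauchy : ∀ {gn : ℕ → ℝ → K} {g : ℝ → K}, (∀ n, MemLp (gn n) 2 μ) → MemLp g 2 μ →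
      Tendsto (fun n => eLpNorm (gn n - g) 2 μ) atTop (𝓝 0) → ∀ ε > 0, ∃ N, ∀ m ≥ N, ∀ n ≥ N,
        (eLpNorm (gn m - gn n) 2 μ).toReal < ε := fun {gn g} hgn hg hgt ε hε => by
    rw [← Lp.tendsto_Lp_iff_tendsto_eLpNorm'' gn hgn g hg] at hgt
    obtain ⟨N, hN⟩ := Metric.cauchySeq_iff.1 hgt.cauchySeq ε hε
    refine ⟨N, fun m hm n hn => ?_⟩
    have := hN m hm n hn
    rwa [dist_eq_norm, ← MemLp.toLp_sub, Lp.norm_toLp] at this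
  have hba : 0 < b - a := sub_pos.2 hab
  have huc : UniformCauchySeqOn (fun n t => π (kn n t)) atTop (Icc a b) := by
    rw [Metric.uniformCauchySeqOn_iff]
    intro ε hε
    set c : ℝ := ‖π‖ ^ 2 + (b - a) * 2 + 1 with hc
    have hc0 : 0 < c := by positivity
    set η : ℝ := Real.sqrt ((b - a) * ε ^ 2 / c) with hη
    have hη0 : 0 < η := Real.sqrt_pos.2 (by positivity)
    have hη2 : c * η ^ 2 = (b - a) * ε ^ 2 := by
      rw [hη, Real.sq_sqrt (by positivity)]
      field_simp
    obtain ⟨N, hN⟩ := hcauchy hkn hk hkt η hη0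
    obtain ⟨N', hN'⟩ := hcauchy hfn hf hft η hη0
    refine ⟨max N N', fun m hm n hn t ht => ?_⟩
    have hrep : IsEnergyRep π (kn m - kn n) (fn m - fn n) a b
        (fun t => π ((kn m - kn n) t)) := by
      refine energy_of_continuous π ((hkc m).sub (hkc n)) ((hfc m).sub (hfc n)) fun t ht => ?_
      have := (hd m t ht).sub (hd n t ht)
      simpa [Pi.sub_def] using this
    have h1 := hrep.norm_sq_le ((hkn m).sub (hkn n)) ((hfn m).sub (hfn n)) ht
    have h2 := hN m (le_of_max_le_left hm) n (le_of_max_le_left hn)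
    have h3 := hN' m (le_of_max_le_right hm) n (le_of_max_le_right hn)
    rw [← hμ] at h1
    set α := (eLpNorm (kn m - kn n) 2 μ).toReal
    set β := (eLpNorm (fn m - fn n) 2 μ).toReal
    have hα : 0 ≤ α := ENNReal.toReal_nonneg
    have hβ : 0 ≤ β := ENNReal.toReal_nonneg
    have h4 : α ^ 2 ≤ η ^ 2 := pow_le_pow_left₀ hα h2.le 2
    have h5 : β * α ≤ η ^ 2 := by
      rw [sq]
      exact mul_le_mul h3.le h2.le hα hη0.le
    have h6 : (b - a) * ‖π ((kn m - kn n) t)‖ ^ 2 < (b - a) * ε ^ 2 := by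
      rw [← hη2, hc]
      have h7 : ‖π‖ ^ 2 * α ^ 2 ≤ ‖π‖ ^ 2 * η ^ 2 := by gcongr
      have h8 : (b - a) * (2 * (β * α)) ≤ (b - a) * (2 * η ^ 2) := by gcongr
      have h9 : 0 < η ^ 2 := by positivity
      linarith
    rw [dist_eq_norm, ← map_sub]
    exact lt_of_pow_lt_pow_left₀ 2 hε.le (lt_of_mul_lt_mul_left h6 hba.le)
  set w : ℝ → H := fun t => limUnder atTop fun n => π (kn n t) with hw
  have hlim : ∀ t ∈ Icc a b, Tendsto (fun n => π (kn n t)) atTop (𝓝 (w t)) := fun t ht =>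
    (huc.cauchySeq ht).tendsto_limUnder
  have hunif := huc.tendstoUniformlyOn_of_tendsto hlim
  refine ⟨w, hunif.continuousOn (Frequently.of_forall fun n => by fun_prop), ?_, ?_⟩
  · obtain ⟨ns, hns, hae⟩ := (tendstoInMeasure_of_tendsto_eLpNorm two_ne_zero
      (fun n => (hkn n).1) hk.1 hkt).exists_seq_tendsto_ae
    filter_upwards [hae, ae_restrict_mem measurableSet_Icc] with t ht htI
    exact tendsto_nhds_unique ((hlim t htI).comp hns.tendsto_atTop)
      ((π.continuous.tendsto _).comp ht)
  · intro s hs t ht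
    have h1 : Tendsto (fun n => ‖π (kn n t)‖ ^ 2 - ‖π (kn n s)‖ ^ 2) atTop
        (𝓝 (‖w t‖ ^ 2 - ‖w s‖ ^ 2)) := ((hlim t ht).norm.pow 2).sub ((hlim s hs).norm.pow 2)
    have h2 : ∀ u ∈ Icc a b, ∀ v ∈ Icc a b, Tendsto (fun n => ∫ r in Ioc u v, ⟪fn n r, kn n r⟫)
        atTop (𝓝 (∫ r in Ioc u v, ⟪f r, k r⟫)) := fun u hu v hv => by
      have hle : volume.restrict (Ioc u v) ≤ μ := Measure.restrict_mono
        (Ioc_subset_Icc_self.trans (Icc_subset_Icc hu.1 hv.2)) le_rfl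
      have hto : ∀ {gn : ℕ → ℝ → K} {g : ℝ → K},
          Tendsto (fun n => eLpNorm (gn n - g) 2 μ) atTop (𝓝 0) →
          Tendsto (fun n => eLpNorm (gn n - g) 2 (volume.restrict (Ioc u v))) atTop (𝓝 0) :=
        fun h => tendsto_of_tendsto_of_tendsto_of_le_of_le tendsto_const_nhds h
          (fun _ => zero_le) fun n => eLpNorm_mono_measure _ hle
      exact tendsto_integral_inner (fun n => (hkn n).mono_measure hle)
        (fun n => (hfn n).mono_measure hle) (hk.mono_measure hle) (hf.mono_measure hle)
        (hto hkt) (hto hft)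
    have h3 : Tendsto (fun n => ∫ r in s..t, ⟪fn n r, kn n r⟫) atTop
        (𝓝 (∫ r in s..t, ⟪f r, k r⟫)) := (h2 s hs t ht).sub (h2 t ht s hs)
    refine tendsto_nhds_unique h1 ((h3.const_mul 2).congr fun n => ?_)
    exact ((energy_of_continuous π (hkc n) (hfc n) (hd n)).energy s hs t ht).symm

end HilbertTriple

/-! ### The Lions–Magenes lemma -/

section HilbertTriple

variable {K H : Type*} [NormedAddCommGroup K] [InnerProductSpace ℝ K]
  [NormedAddCommGroup H] [InnerProductSpace ℝ H]

theorem IsEnergyRep.congr {π : K →L[ℝ] H} {k f k' f' : ℝ → K} {a b : ℝ} {w : ℝ → H}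
    (h : IsEnergyRep π k f a b w) (hk : k =ᵐ[volume.restrict (Icc a b)] k')
    (hf : f =ᵐ[volume.restrict (Icc a b)] f') : IsEnergyRep π k' f' a b w where
  continuousOn := h.continuousOn
  ae_eq := by
    filter_upwards [h.ae_eq, hk] with t h1 h2
    rw [h1, h2]
  energy s hs t ht := by
    rw [h.energy s hs t ht]
    congr 1
    refine intervalIntegral.integral_congr_ae ?_
    have hsub : uIoc s t ⊆ Icc a b :=
      uIoc_subset_uIcc.trans (ordConnected_Icc.uIcc_subset hs ht)
    filter_upwards [(ae_restrict_iff' measurableSet_Icc).1 hk,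
      (ae_restrict_iff' measurableSet_Icc).1 hf] with r h1 h2 hr
    rw [h1 (hsub hr), h2 (hsub hr)]

/-- `(π†π k)' = f` in the sense of `K`-valued distributions on `(0, T)`. -/
def HasWeakTimeDeriv [CompleteSpace K] [CompleteSpace H]
    (π : K →L[ℝ] H) (T : ℝ) (k f : ℝ → K) : Prop :=
  ∀ a : ℝ → ℝ, IsTest (Ioo 0 T) a →
    ∫ t in Ioo 0 T, (deriv a t • (π.adjoint) (π (k t)) + a t • f t) = 0

theorem IsTest.integrable_deriv_smul {E : Type*} [NormedAddCommGroup E] [NormedSpace ℝ E]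
    {S : Set ℝ} {a : ℝ → ℝ} (ha : IsTest S a) {g : ℝ → E} {μ : Measure ℝ} (hg : Integrable g μ) :
    Integrable (fun t => deriv a t • g t) μ := by
  have h : Continuous (deriv a) := ha.1.continuous_deriv (by simp)
  obtain ⟨C, hC⟩ := h.bounded_above_of_compact_support ha.2.1.deriv
  exact hg.bdd_smul C h.aestronglyMeasurable (Eventually.of_forall hC)

theorem IsTest.integrable_smul {V E : Type*} [NormedAddCommGroup V] [NormedSpace ℝ V]
    [MeasurableSpace V] [BorelSpace V] [SecondCountableTopology V]
    [NormedAddCommGroup E] [NormedSpace ℝ E]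
    {S : Set V} {a : V → ℝ} (ha : IsTest S a) {g : V → E} {μ : Measure V} (hg : Integrable g μ) :
    Integrable (fun t => a t • g t) μ := by
  obtain ⟨C, hC⟩ := ha.1.continuous.bounded_above_of_compact_support ha.2.1
  exact hg.bdd_smul C ha.1.continuous.aestronglyMeasurable (Eventually.of_forall hC)

/-- Away from the final time, mollification with `futureBump` never leaves `(0, T)`, so that it
turns a weak derivative into a classical one. -/
theorem hasDerivAt_mollify_of_hasWeakTimeDeriv [CompleteSpace K] [CompleteSpace H]
    (π : K →L[ℝ] H) {T : ℝ} {k f : ℝ → K}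
    (hk : MemLp k 2 volume) (hf : MemLp f 2 volume)
    (hk0 : ∀ t ∉ Ioo 0 T, k t = 0) (hf0 : ∀ t ∉ Ioo 0 T, f t = 0)
    (hw : HasWeakTimeDeriv π T k f) {δ : ℝ} (hδ : 0 < δ) (n : ℕ) {t : ℝ}
    (ht : t ∈ Icc 0 (T - δ)) :
    HasDerivAt (fun r => (π.adjoint) (π (mollify (futureKernel δ hδ n) k r)))
      (mollify (futureKernel δ hδ n) f t) t := by
  set ρ := futureKernel δ hδ n with hρ
  have hρd : ContDiff ℝ ∞ ρ := futureKernel_contDiff hδ n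
  have hρs : HasCompactSupport ρ := futureKernel_hasCompactSupport hδ n
  have hkl : LocallyIntegrable k volume := hk.locallyIntegrable (by norm_num)
  have hfl : LocallyIntegrable f volume := hf.locallyIntegrable (by norm_num)
  have hki : IntegrableOn k (Ioo 0 T) :=
    (hkl.integrableOn_isCompact isCompact_Icc).mono_set Ioo_subset_Icc_self
  have hfi : IntegrableOn f (Ioo 0 T) :=
    (hfl.integrableOn_isCompact isCompact_Icc).mono_set Ioo_subset_Icc_self
  have h1 : HasDerivAt (mollify ρ k) (mollify (deriv ρ) k t) t :=
    hρs.hasDerivAt_convolution_left _ (hρd.of_le (by simp)) hkl t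
  have h2 := ((π.adjoint).hasFDerivAt.comp_hasDerivAt t (π.hasFDerivAt.comp_hasDerivAt t h1))
  have hsupp : tsupport ρ ⊆ Ioo (-δ) 0 := by
    refine (futureKernel_tsupport hδ n).trans (Ioo_subset_Ioo ?_ le_rfl)
    have : 2 * (δ / ((n : ℝ) + 2)) ≤ δ := by
      rw [← mul_div_assoc, div_le_iff₀ (by positivity)]
      nlinarith [Nat.cast_nonneg (α := ℝ) n]
    linarith
  have ha : IsTest (Ioo 0 T) fun s => ρ (t - s) := by
    refine ⟨hρd.comp (contDiff_const.sub contDiff_id), hρs.comp_homeomorph (Homeomorph.subLeft t),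
      ?_⟩
    intro s hs
    have hs' : t - s ∈ tsupport ρ :=
      tsupport_comp_subset_preimage ρ (f := fun s : ℝ => t - s) (by fun_prop) hs
    have := hsupp hs'
    constructor <;> linarith [this.1, this.2, ht.1, ht.2]
  have hda : ∀ s, deriv (fun s => ρ (t - s)) s = -deriv ρ (t - s) := fun s =>
    deriv_comp_const_sub (f := ρ) t s
  have h3 := hw _ ha
  have hRk : IntegrableOn (fun s => (π.adjoint) (π (k s))) (Ioo 0 T) :=
    (π.adjoint ∘L π).integrable_comp hki
  rw [integral_add (ha.integrable_deriv_smul hRk) (ha.integrable_smul hfi)] at h3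
  simp only [hda, neg_smul, integral_neg] at h3
  have hk1 : ∫ s in Ioo 0 T, deriv ρ (t - s) • (π.adjoint) (π (k s)) =
      (π.adjoint) (π (mollify (deriv ρ) k t)) := by
    rw [setIntegral_eq_integral_of_forall_compl_eq_zero fun s hs => by rw [hk0 s hs]; simp,
      mollify_apply_swap]
    have hi : Integrable fun s => deriv ρ (t - s) • k s := by
      have := (hρs.deriv.convolutionExists_left (ContinuousLinearMap.lsmul ℝ ℝ)
        (hρd.continuous_deriv (by simp)) hkl t).comp_sub_left t
      simpa using this
    have := (π.adjoint ∘L π).integral_comp_comm hi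
    simpa using this
  have hf1 : ∫ s in Ioo 0 T, ρ (t - s) • f s = mollify ρ f t := by
    rw [setIntegral_eq_integral_of_forall_compl_eq_zero fun s hs => by rw [hf0 s hs]; simp,
      mollify_apply_swap]
  rw [hk1, hf1] at h3
  rw [neg_add_eq_zero] at h3
  rw [← h3]
  exact h2

/-- The Lions–Magenes lemma on `[0, T - δ]`, where mollification over future times approximates
`k` and `f`. -/
theorem exists_energyRep_before [CompleteSpace K] [CompleteSpace H]
    (π : K →L[ℝ] H) {T : ℝ} {k f : ℝ → K}
    (hk : MemLp k 2 (volume.restrict (Ioo 0 T))) (hf : MemLp f 2 (volume.restrict (Ioo 0 T)))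
    (hw : HasWeakTimeDeriv π T k f) {δ : ℝ} (hδ : 0 < δ) (hδT : δ < T) :
    ∃ w, IsEnergyRep π k f 0 (T - δ) w := by
  -- strongly measurable representatives which vanish outside `(0, T)`
  have hrep : ∀ {g : ℝ → K}, MemLp g 2 (volume.restrict (Ioo 0 T)) → ∃ g' : ℝ → K,
      StronglyMeasurable g' ∧ MemLp g' 2 volume ∧ (∀ t ∉ Ioo 0 T, g' t = 0) ∧
      g' =ᵐ[volume.restrict (Ioo 0 T)] g := fun {g} hg => by
    have hae : (Ioo 0 T).indicator (hg.1.mk g) =ᵐ[volume.restrict (Ioo 0 T)] g :=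
      (indicator_ae_eq_restrict measurableSet_Ioo).trans hg.1.ae_eq_mk.symm
    refine ⟨(Ioo 0 T).indicator (hg.1.mk g), hg.1.stronglyMeasurable_mk.indicator
      measurableSet_Ioo, ?_, fun t ht => indicator_of_notMem ht _, hae⟩
    rw [memLp_indicator_iff_restrict measurableSet_Ioo]
    exact hg.ae_eq hg.1.ae_eq_mk
  obtain ⟨k', hk'm, hk', hk'0, hkk'⟩ := hrep hk
  obtain ⟨f', hf'm, hf', hf'0, hff'⟩ := hrep hf
  have hw' : HasWeakTimeDeriv π T k' f' := fun a ha => by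
    rw [← hw a ha]
    refine integral_congr_ae ?_
    filter_upwards [hkk', hff'] with t h1 h2
    rw [h1, h2]
  have hto : ∀ {g' : ℝ → K}, StronglyMeasurable g' → MemLp g' 2 volume →
      Tendsto (fun n => eLpNorm (mollify (futureKernel δ hδ n) g' - g') 2
        (volume.restrict (Icc 0 (T - δ)))) atTop (𝓝 0) := fun hm h =>
    tendsto_of_tendsto_of_tendsto_of_le_of_le tendsto_const_nhds
      (tendsto_mollify_futureKernel hδ hm h) (fun _ => zero_le)
      fun n => eLpNorm_mono_measure _ Measure.restrict_le_self
  have hcont : ∀ {g' : ℝ → K}, MemLp g' 2 volume → ∀ n,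
      Continuous (mollify (futureKernel δ hδ n) g') := fun h n =>
    (futureKernel_hasCompactSupport hδ n).continuous_convolution_left _
      (futureKernel_contDiff hδ n).continuous (h.locallyIntegrable (by norm_num))
  obtain ⟨w, h⟩ := exists_energyRep_of_tendsto π (sub_pos.2 hδT) (hcont hk') (hcont hf')
    (fun n t ht => hasDerivAt_mollify_of_hasWeakTimeDeriv π hk' hf' hk'0 hf'0 hw' hδ n ht)
    (hk'.restrict _) (hf'.restrict _) (hto hk'm hk') (hto hf'm hf')
  have hae : ∀ {g g' : ℝ → K}, g' =ᵐ[volume.restrict (Ioo 0 T)] g →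
      g' =ᵐ[volume.restrict (Icc 0 (T - δ))] g := fun {g g'} h => by
    have : volume.restrict (Icc 0 (T - δ)) = (volume.restrict (Ioc 0 (T - δ)) : Measure ℝ) :=
      Measure.restrict_congr_set Ioc_ae_eq_Icc.symm
    unfold Filter.EventuallyEq
    rw [this]
    have hsub : Ioc 0 (T - δ) ⊆ Ioo 0 T := fun t ht => ⟨ht.1, ht.2.trans_lt (by linarith)⟩
    exact ae_restrict_of_ae_restrict_of_subset hsub h
  exact ⟨w, h.congr (hae hkk') (hae hff')⟩

theorem setIntegral_Ioo_comp_sub_left {E : Type*} [NormedAddCommGroup E] [NormedSpace ℝ E]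
    {T : ℝ} (hT : 0 ≤ T) (g : ℝ → E) : ∫ t in Ioo 0 T, g (T - t) = ∫ t in Ioo 0 T, g t := by
  rw [← integral_Ioc_eq_integral_Ioo, ← integral_Ioc_eq_integral_Ioo,
    ← intervalIntegral.integral_of_le hT, ← intervalIntegral.integral_of_le hT,
    intervalIntegral.integral_comp_sub_left]
  simp

/-- Time reversal of a weak time derivative. -/
theorem HasWeakTimeDeriv.reverse [CompleteSpace K] [CompleteSpace H]
    {π : K →L[ℝ] H} {T : ℝ} (hT : 0 ≤ T) {k f : ℝ → K}
    (hw : HasWeakTimeDeriv π T k f) :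
    HasWeakTimeDeriv π T (fun t => k (T - t)) (fun t => -f (T - t)) := by
  intro a ha
  have ha' : IsTest (Ioo 0 T) fun s => a (T - s) := by
    refine ⟨ha.1.comp (contDiff_const.sub contDiff_id),
      ha.2.1.comp_homeomorph (Homeomorph.subLeft T), fun s hs => ?_⟩
    have := ha.2.2 (tsupport_comp_subset_preimage a (f := fun s : ℝ => T - s) (by fun_prop) hs)
    constructor <;> linarith [this.1, this.2]
  have h := hw _ ha'
  rw [← setIntegral_Ioo_comp_sub_left hT, ← neg_eq_zero, ← integral_neg] at h
  rw [← h]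
  refine integral_congr_ae (Eventually.of_forall fun t => ?_)
  have : deriv (fun s => a (T - s)) (T - t) = -deriv a t := by
    rw [deriv_comp_const_sub (f := a) T (T - t), sub_sub_cancel]
  simp only [this, sub_sub_cancel]
  module

theorem MemLp.comp_sub_left_Ioo {E : Type*} [NormedAddCommGroup E] {T : ℝ} {g : ℝ → E}
    (hg : MemLp g 2 (volume.restrict (Ioo 0 T))) :
    MemLp (fun t => g (T - t)) 2 (volume.restrict (Ioo 0 T)) := by
  have h := (Measure.measurePreserving_sub_left volume T).restrict_preimage
    (measurableSet_Ioo (a := (0 : ℝ)) (b := T))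
  simp only [preimage_const_sub_Ioo, sub_self, sub_zero] at h
  exact hg.comp_measurePreserving h

theorem IsEnergyRep.reverse {π : K →L[ℝ] H} {k f : ℝ → K} {T b : ℝ} {w : ℝ → H}
    (h : IsEnergyRep π (fun t => k (T - t)) (fun t => -f (T - t)) 0 b w) :
    IsEnergyRep π k f (T - b) T (fun t => w (T - t)) where
  continuousOn := h.continuousOn.comp (by fun_prop) fun t ht => by
    constructor <;> linarith [ht.1, ht.2]
  ae_eq := by
    have hm := (Measure.measurePreserving_sub_left volume T).restrict_preimage
      (measurableSet_Icc (a := (0 : ℝ)) (b := b))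
    simp only [preimage_const_sub_Icc, sub_zero] at hm
    filter_upwards [hm.quasiMeasurePreserving.ae h.ae_eq] with t ht
    rw [ht, sub_sub_cancel]
  energy s hs t ht := by
    have := h.energy (T - s) ⟨by linarith [hs.2], by linarith [hs.1]⟩ (T - t)
      ⟨by linarith [ht.2], by linarith [ht.1]⟩
    rw [this]
    simp only [inner_neg_left]
    rw [intervalIntegral.integral_neg, intervalIntegral.integral_comp_sub_left
      (fun r => ⟪f r, k r⟫), intervalIntegral.integral_symm]
    simp

/-- Two energy representatives on overlapping intervals coincide on the overlap and glue. -/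
theorem IsEnergyRep.glue {π : K →L[ℝ] H} {k f : ℝ → K} {a b c e : ℝ} {w₁ w₂ : ℝ → H}
    (hac : a ≤ c) (hcb : c < b) (hbe : b ≤ e) (h₁ : IsEnergyRep π k f a b w₁)
    (h₂ : IsEnergyRep π k f c e w₂) (hi : IntegrableOn (fun r => ⟪f r, k r⟫) (Icc a e)) :
    ∃ w, IsEnergyRep π k f a e w := by
  have heq : EqOn w₁ w₂ (Icc c b) := by
    refine Measure.eqOn_Icc_of_ae_eq volume hcb.ne ?_
      (h₁.continuousOn.mono (Icc_subset_Icc hac le_rfl))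
      (h₂.continuousOn.mono (Icc_subset_Icc le_rfl hbe))
    filter_upwards [ae_restrict_of_ae_restrict_of_subset (Icc_subset_Icc hac le_rfl) h₁.ae_eq,
      ae_restrict_of_ae_restrict_of_subset (Icc_subset_Icc le_rfl hbe) h₂.ae_eq] with t ht1 ht2
    rw [ht1, ht2]
  set w : ℝ → H := fun t => if t ≤ b then w₁ t else w₂ t with hw
  have hw1 : EqOn w w₁ (Icc a b) := fun t ht => if_pos ht.2
  have hw2 : EqOn w w₂ (Icc c e) := fun t ht => by
    by_cases h : t ≤ b
    · exact (if_pos h).trans (heq ⟨ht.1, h⟩)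
    · exact if_neg h
  have hU : Icc a e = Icc a b ∪ Icc c e :=
    (Icc_union_Icc' hcb.le (hac.trans (hcb.le.trans hbe))).symm ▸ by
      rw [min_eq_left hac, max_eq_right hbe]
  refine ⟨w, ?_, ?_, ?_⟩
  · rw [hU]
    exact (h₁.continuousOn.congr hw1).union_of_isClosed (h₂.continuousOn.congr hw2)
      isClosed_Icc isClosed_Icc
  · rw [hU]
    refine ae_restrict_union_iff _ _ _ |>.2 ⟨?_, ?_⟩
    · filter_upwards [h₁.ae_eq, ae_restrict_mem measurableSet_Icc] with t ht htI
      rw [hw1 htI, ht]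
    · filter_upwards [h₂.ae_eq, ae_restrict_mem measurableSet_Icc] with t ht htI
      rw [hw2 htI, ht]
  · have hmid : ∀ t ∈ Icc a e, ‖w t‖ ^ 2 - ‖w c‖ ^ 2 = 2 * ∫ r in c..t, ⟪f r, k r⟫ :=
      fun t ht => by
        rw [hU] at ht
        rcases ht with ht | ht
        · rw [hw1 ht, hw1 ⟨hac, hcb.le⟩]
          exact h₁.energy c ⟨hac, hcb.le⟩ t ht
        · rw [hw2 ht, hw2 ⟨le_rfl, hcb.le.trans hbe⟩]
          exact h₂.energy c ⟨le_rfl, hcb.le.trans hbe⟩ t ht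
    have hc : c ∈ Icc a e := ⟨hac, hcb.le.trans hbe⟩
    have hint : ∀ t ∈ Icc a e, IntervalIntegrable (fun r => ⟪f r, k r⟫) volume c t :=
      fun t ht => (hi.mono_set (ordConnected_Icc.uIcc_subset hc ht)).intervalIntegrable
    intro s hs t ht
    rw [← intervalIntegral.integral_interval_sub_left (hint t ht) (hint s hs), mul_sub,
      ← hmid t ht, ← hmid s hs]
    ring

/-- The Lions–Magenes lemma: if `k, f ∈ L²(0,T;K)` and `(π†π k)' = f` weakly, then `π k` has a
representative in `C([0,T];H)`, and this representative satisfies the energy identity. -/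
theorem exists_energyRep [CompleteSpace K] [CompleteSpace H]
    (π : K →L[ℝ] H) {T : ℝ} (hT : 0 < T) {k f : ℝ → K}
    (hk : MemLp k 2 (volume.restrict (Ioo 0 T))) (hf : MemLp f 2 (volume.restrict (Ioo 0 T)))
    (hw : HasWeakTimeDeriv π T k f) : ∃ w, IsEnergyRep π k f 0 T w := by
  -- the final time is reached by time reversal; the intervals `[0, 2T/3]` and `[T/3, T]` overlap
  obtain ⟨w₁, h₁⟩ := exists_energyRep_before π hk hf hw (δ := T / 3) (by linarith) (by linarith)
  obtain ⟨w₂, h₂⟩ := exists_energyRep_before π (MemLp.comp_sub_left_Ioo hk)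
    (MemLp.comp_sub_left_Ioo hf).neg (hw.reverse hT.le) (δ := T / 3) (by linarith) (by linarith)
  have h₂' := IsEnergyRep.reverse (f := f) h₂
  refine h₁.glue (by linarith) (by linarith) (by linarith) h₂' ?_
  rw [integrableOn_Icc_iff_integrableOn_Ioo]
  exact integrable_inner_of_memLp hf hk

end HilbertTriple

/-! ### Test functions, `H₀¹(Ω)` and the Poincaré–Friedrichs inequality -/

section TestFunctions

variable {V : Type*} [NormedAddCommGroup V] [NormedSpace ℝ V] {S : Set V} {φ ψ : V → ℝ}

theorem IsTest.zero : IsTest S (fun _ => 0) :=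
  ⟨contDiff_const, HasCompactSupport.zero, by simp [tsupport]⟩

theorem IsTest.add (hφ : IsTest S φ) (hψ : IsTest S ψ) : IsTest S (fun x => φ x + ψ x) :=
  ⟨hφ.1.add hψ.1, hφ.2.1.add hψ.2.1,
    (tsupport_add φ ψ).trans (union_subset hφ.2.2 hψ.2.2)⟩

theorem IsTest.const_mul (hφ : IsTest S φ) (c : ℝ) : IsTest S (fun x => c * φ x) :=
  ⟨contDiff_const.mul hφ.1, hφ.2.1.mul_left, (tsupport_mul_subset_right).trans hφ.2.2⟩

theorem IsTest.differentiable (hφ : IsTest S φ) : Differentiable ℝ φ :=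
  hφ.1.differentiable (by simp)

theorem IsTest.continuous_fderiv (hφ : IsTest S φ) : Continuous (fderiv ℝ φ) :=
  hφ.1.continuous_fderiv (by simp)

theorem IsTest.eq_zero (hφ : IsTest S φ) {x : V} (hx : x ∉ S) : φ x = 0 :=
  image_eq_zero_of_notMem_tsupport fun h => hx (hφ.2.2 h)

theorem IsTest.setIntegral_eq {E : Type*} [NormedAddCommGroup E] [NormedSpace ℝ E]
    [MeasurableSpace V] {μ : Measure V} (hφ : IsTest S φ) (g : V → E) :
    ∫ x in S, φ x • g x ∂μ = ∫ x, φ x • g x ∂μ :=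
  setIntegral_eq_integral_of_forall_compl_eq_zero fun x hx => by rw [hφ.eq_zero hx, zero_smul]

theorem IsTest.memLp [MeasurableSpace V] [BorelSpace V] [SecondCountableTopology V]
    (hφ : IsTest S φ) {p : ℝ≥0∞} (μ : Measure V) [IsFiniteMeasureOnCompacts μ] : MemLp φ p μ :=
  hφ.1.continuous.memLp_of_hasCompactSupport hφ.2.1

end TestFunctions

section Gradient

variable {d : ℕ} {Ω : Set (Sp d)} {φ ψ : Sp d → ℝ}

theorem inner_gradient_eq (φ : Sp d → ℝ) (x v : Sp d) :
    ⟪gradient φ x, v⟫ = fderiv ℝ φ x v := by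
  simp [gradient]

theorem IsTest.continuous_gradient (hφ : IsTest Ω φ) : Continuous (gradient φ) :=
  (InnerProductSpace.toDual ℝ (Sp d)).symm.continuous.comp hφ.continuous_fderiv

theorem IsTest.hasCompactSupport_gradient (hφ : IsTest Ω φ) : HasCompactSupport (gradient φ) :=
  (hφ.2.1.fderiv (𝕜 := ℝ)).comp_left (g := (InnerProductSpace.toDual ℝ (Sp d)).symm) (map_zero _)

theorem IsTest.memLp_gradient (hφ : IsTest Ω φ) {p : ℝ≥0∞} (μ : Measure (Sp d))
    [IsFiniteMeasureOnCompacts μ] : MemLp (gradient φ) p μ :=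
  hφ.continuous_gradient.memLp_of_hasCompactSupport hφ.hasCompactSupport_gradient

theorem IsTest.gradient_add (hφ : IsTest Ω φ) (hψ : IsTest Ω ψ) (x : Sp d) :
    gradient (fun x => φ x + ψ x) x = gradient φ x + gradient ψ x := by
  simp [gradient, fderiv_fun_add (hφ.differentiable x) (hψ.differentiable x)]

theorem IsTest.gradient_const_mul (hφ : IsTest Ω φ) (c : ℝ) (x : Sp d) :
    gradient (fun x => c * φ x) x = c • gradient φ x := by
  simp [gradient, fderiv_const_mul (hφ.differentiable x)]

/-- `L²(Ω)ᵈ`. -/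
abbrev L2Omd (Ω : Set (Sp d)) : Type := Lp (Sp d) 2 (volume.restrict Ω)

/-- The Hilbert space `L²(Ω) × L²(Ω)ᵈ`. -/
abbrev L2Pair (Ω : Set (Sp d)) : Type := WithLp 2 (L2Om Ω × L2Omd Ω)

/-- The pairs `(φ, ∇φ)` with `φ ∈ C_c^∞(Ω)`. -/
def testGraph (Ω : Set (Sp d)) : Submodule ℝ (L2Pair Ω) where
  carrier := {p | ∃ φ, IsTest Ω φ ∧ p.fst =ᵐ[volume.restrict Ω] φ ∧
    p.snd =ᵐ[volume.restrict Ω] gradient φ}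
  zero_mem' := ⟨fun _ => 0, IsTest.zero, Lp.coeFn_zero _ _ _, by
    refine (Lp.coeFn_zero _ _ _).trans (Eventually.of_forall fun x => ?_)
    simp [gradient]⟩
  add_mem' := by
    rintro p q ⟨φ, hφ, h1, h2⟩ ⟨ψ, hψ, h3, h4⟩
    refine ⟨_, hφ.add hψ, ?_, ?_⟩
    · filter_upwards [Lp.coeFn_add p.fst q.fst, h1, h3] with x hx h1 h3
      rw [WithLp.add_fst, hx, Pi.add_apply, h1, h3]
    · filter_upwards [Lp.coeFn_add p.snd q.snd, h2, h4] with x hx h1 h3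
      rw [WithLp.add_snd, hx, Pi.add_apply, h1, h3, hφ.gradient_add hψ]
  smul_mem' := by
    rintro c p ⟨φ, hφ, h1, h2⟩
    refine ⟨_, hφ.const_mul c, ?_, ?_⟩
    · filter_upwards [Lp.coeFn_smul c p.fst, h1] with x hx h1
      rw [WithLp.smul_fst, hx, Pi.smul_apply, h1, smul_eq_mul]
    · filter_upwards [Lp.coeFn_smul c p.snd, h2] with x hx h1
      rw [WithLp.smul_snd, hx, Pi.smul_apply, h1, hφ.gradient_const_mul]

/-- The space `H₀¹(Ω)`, encoded as the closed subspace of all pairs `(w, ∇w)` in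
`L²(Ω) × L²(Ω)ᵈ`. -/
def h10 (Ω : Set (Sp d)) : Submodule ℝ (L2Pair Ω) := (testGraph Ω).topologicalClosure

instance : CompleteSpace (h10 Ω) :=
  (testGraph Ω).isClosed_topologicalClosure.completeSpace_coe

/-- The element of `L²(Ω) × L²(Ω)ᵈ` given by two square integrable functions. -/
def pairOf {w : Sp d → ℝ} {g : Sp d → Sp d} (hw : MemLp w 2 (volume.restrict Ω))
    (hg : MemLp g 2 (volume.restrict Ω)) : L2Pair Ω :=
  WithLp.toLp 2 (hw.toLp w, hg.toLp g)

theorem pairOf_fst {w : Sp d → ℝ} {g : Sp d → Sp d} (hw : MemLp w 2 (volume.restrict Ω))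
    (hg : MemLp g 2 (volume.restrict Ω)) : (pairOf hw hg).fst =ᵐ[volume.restrict Ω] w :=
  hw.coeFn_toLp

theorem pairOf_snd {w : Sp d → ℝ} {g : Sp d → Sp d} (hw : MemLp w 2 (volume.restrict Ω))
    (hg : MemLp g 2 (volume.restrict Ω)) : (pairOf hw hg).snd =ᵐ[volume.restrict Ω] g :=
  hg.coeFn_toLp

/-- The element `(φ, ∇φ)` of `L²(Ω) × L²(Ω)ᵈ`. -/
def IsTest.toPair (hφ : IsTest Ω φ) : L2Pair Ω := pairOf (hφ.memLp _) (hφ.memLp_gradient _)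

theorem IsTest.toPair_fst (hφ : IsTest Ω φ) : hφ.toPair.fst =ᵐ[volume.restrict Ω] φ :=
  pairOf_fst _ _

theorem IsTest.toPair_snd (hφ : IsTest Ω φ) : hφ.toPair.snd =ᵐ[volume.restrict Ω] gradient φ :=
  pairOf_snd _ _

theorem IsTest.toPair_mem (hφ : IsTest Ω φ) : hφ.toPair ∈ testGraph Ω :=
  ⟨φ, hφ, hφ.toPair_fst, hφ.toPair_snd⟩

theorem testGraph_le_h10 : testGraph Ω ≤ h10 Ω := Submodule.le_topologicalClosure _

theorem HasH10Grad.congr {w w' : Sp d → ℝ} {g g' : Sp d → Sp d} (h : HasH10Grad Ω w g)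
    (hw : w =ᵐ[volume.restrict Ω] w') (hg : g =ᵐ[volume.restrict Ω] g') :
    HasH10Grad Ω w' g' := by
  obtain ⟨h1, h2, φ, hφ, h3, h4⟩ := h
  refine ⟨h1.ae_eq hw, h2.ae_eq hg, φ, hφ, h3.congr fun n => eLpNorm_congr_ae ?_,
    h4.congr fun n => eLpNorm_congr_ae ?_⟩
  · filter_upwards [hw] with x hx
    rw [hx]
  · filter_upwards [hg] with x hx
    rw [hx]

/-- The closure in `L²(Ω) × L²(Ω)ᵈ` is the sequential one of `HasH10Grad`. -/
theorem mem_h10_iff (p : L2Pair Ω) : p ∈ h10 Ω ↔ HasH10Grad Ω p.fst p.snd := by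
  change p ∈ closure (testGraph Ω : Set (L2Pair Ω)) ↔ _
  rw [mem_closure_iff_seq_limit]
  constructor
  · rintro ⟨x, hx, hlim⟩
    choose φ hφ h1 h2 using hx
    refine ⟨Lp.memLp _, Lp.memLp _, φ, hφ, ?_, ?_⟩
    · have := ((continuous_fst.comp
        (WithLp.prod_continuous_ofLp 2 (L2Om Ω) (L2Omd Ω))).tendsto p).comp hlim
      rw [tendsto_iff_edist_tendsto_0] at this
      refine this.congr fun n => ?_
      rw [Lp.edist_def]
      refine eLpNorm_congr_ae ?_
      filter_upwards [h1 n] with y hy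
      simp [hy]
    · have := ((continuous_snd.comp
        (WithLp.prod_continuous_ofLp 2 (L2Om Ω) (L2Omd Ω))).tendsto p).comp hlim
      rw [tendsto_iff_edist_tendsto_0] at this
      refine this.congr fun n => ?_
      rw [Lp.edist_def]
      refine eLpNorm_congr_ae ?_
      filter_upwards [h2 n] with y hy
      simp [hy]
  · rintro ⟨-, -, φ, hφ, h1, h2⟩
    refine ⟨fun n => (hφ n).toPair, fun n => (hφ n).toPair_mem, ?_⟩
    have h3 : Tendsto (fun n => (hφ n).toPair.fst) atTop (𝓝 p.fst) := by
      rw [tendsto_iff_edist_tendsto_0]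
      refine h1.congr fun n => ?_
      rw [Lp.edist_def]
      refine eLpNorm_congr_ae ?_
      filter_upwards [(hφ n).toPair_fst] with y hy
      simp [hy]
    have h4 : Tendsto (fun n => (hφ n).toPair.snd) atTop (𝓝 p.snd) := by
      rw [tendsto_iff_edist_tendsto_0]
      refine h2.congr fun n => ?_
      rw [Lp.edist_def]
      refine eLpNorm_congr_ae ?_
      filter_upwards [(hφ n).toPair_snd] with y hy
      simp [hy]
    exact ((WithLp.prod_continuous_toLp 2 (L2Om Ω) (L2Omd Ω)).tendsto _).comp
      (h3.prodMk_nhds h4)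

/-- Inner products in `L²` may be computed with arbitrary representatives. -/
theorem L2_inner_eq_integral {α E : Type*} [MeasurableSpace α] {μ : Measure α}
    [NormedAddCommGroup E] [InnerProductSpace ℝ E] {F G : Lp E 2 μ} {f g : α → E}
    (hf : F =ᵐ[μ] f) (hg : G =ᵐ[μ] g) : ⟪F, G⟫ = ∫ x, ⟪f x, g x⟫ ∂μ := by
  rw [L2.inner_def]
  refine integral_congr_ae ?_
  filter_upwards [hf, hg] with x h1 h2
  rw [h1, h2]

theorem L2Pair_inner (p q : L2Pair Ω) : ⟪p, q⟫ = ⟪p.fst, q.fst⟫ + ⟪p.snd, q.snd⟫ :=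
  WithLp.prod_inner_apply p q

theorem mem_h10_orthogonal_iff (n : L2Pair Ω) :
    n ∈ (h10 Ω)ᗮ ↔ ∀ φ (hφ : IsTest Ω φ), ⟪hφ.toPair, n⟫ = 0 := by
  rw [h10, Submodule.orthogonal_closure, Submodule.mem_orthogonal]
  refine ⟨fun h φ hφ => h _ hφ.toPair_mem, ?_⟩
  rintro h p ⟨φ, hφ, h1, h2⟩
  convert h φ hφ using 2
  refine WithLp.ofLp_injective 2 (Prod.ext ?_ ?_)
  · exact Lp.ext (h1.trans hφ.toPair_fst.symm)
  · exact Lp.ext (h2.trans hφ.toPair_snd.symm)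

theorem integral_mul_fderiv_test (hφ : IsTest Ω φ) (hψ : IsTest Ω ψ) (e : Sp d) :
    ∫ x in Ω, φ x * fderiv ℝ ψ x e = -∫ x in Ω, ψ x * fderiv ℝ φ x e := by
  have h1 := hφ.setIntegral_eq (μ := volume) (fun x => fderiv ℝ ψ x e)
  have h2 := hψ.setIntegral_eq (μ := volume) (fun x => fderiv ℝ φ x e)
  simp only [smul_eq_mul] at h1 h2
  rw [h1, h2]
  have hi : ∀ {u v : Sp d → ℝ}, IsTest Ω u → IsTest Ω v →
      Integrable fun x => u x * fderiv ℝ v x e := fun hu hv =>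
    (hu.1.continuous.mul (hv.continuous_fderiv.clm_apply continuous_const)
      ).integrable_of_hasCompactSupport hu.2.1.mul_right
  rw [integral_mul_fderiv_eq_neg_fderiv_mul_of_integrable]
  · simp only [mul_comm]
  · simpa only [mul_comm] using hi hψ hφ
  · exact hi hφ hψ
  · exact (hφ.1.continuous.mul hψ.1.continuous).integrable_of_hasCompactSupport hφ.2.1.mul_right
  · exact fun x _ => hφ.differentiable x
  · exact fun x _ => hψ.differentiable x

/-- A function in `H₀¹(Ω)` has only one gradient. -/
theorem h10_snd_eq_zero (hΩ : IsOpen Ω) {p : L2Pair Ω} (hp : p ∈ h10 Ω) (h0 : p.fst = 0) :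
    p.snd = 0 := by
  have hpi : LocallyIntegrable (p.snd : Sp d → Sp d) (volume.restrict Ω) :=
    (Lp.memLp p.snd).locallyIntegrable (by norm_num)
  have hae : ∀ᵐ x ∂(volume : Measure (Sp d)), x ∈ Ω → (p.snd : Sp d → Sp d) x = 0 := by
    refine hΩ.ae_eq_zero_of_integral_contDiff_smul_eq_zero
      (locallyIntegrableOn_of_locallyIntegrable_restrict hpi) fun ψ hψ1 hψ2 hψ3 => ?_
    have hψ : IsTest Ω ψ := ⟨hψ1, hψ2, hψ3⟩
    have hi : Integrable (fun x => ψ x • (p.snd : Sp d → Sp d) x) (volume.restrict Ω) :=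
      hpi.integrable_smul_left_of_hasCompactSupport hψ1.continuous hψ2
    rw [← hψ.setIntegral_eq]
    refine ext_inner_left ℝ fun e => ?_
    rw [inner_zero_right, ← integral_inner hi e]
    -- the field `ψ e` has divergence `∂ₑψ`, so that the pair `(∂ₑψ, ψ e)` is orthogonal to `H₀¹`
    have hm1 : MemLp (fun x => fderiv ℝ ψ x e) 2 (volume.restrict Ω) :=
      (hψ.continuous_fderiv.clm_apply continuous_const).memLp_of_hasCompactSupport
        (hψ2.fderiv_apply ℝ e)
    have hm2 : MemLp (fun x => ψ x • e) 2 (volume.restrict Ω) :=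
      (hψ1.continuous.smul continuous_const).memLp_of_hasCompactSupport hψ2.smul_right
    have hn : pairOf hm1 hm2 ∈ (h10 Ω)ᗮ := by
      rw [mem_h10_orthogonal_iff]
      intro φ hφ
      rw [L2Pair_inner, L2_inner_eq_integral hφ.toPair_fst (pairOf_fst hm1 hm2),
        L2_inner_eq_integral hφ.toPair_snd (pairOf_snd hm1 hm2)]
      simp only [inner_smul_right, inner_gradient_eq]
      have := integral_mul_fderiv_test hφ hψ e
      simp only [RCLike.inner_apply, conj_trivial, mul_comm (fderiv ℝ ψ _ e)]
      rw [this]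
      ring
    have h := (Submodule.mem_orthogonal _ _).1 hn p hp
    rw [L2Pair_inner, h0, inner_zero_left, zero_add,
      L2_inner_eq_integral (EventuallyEq.refl _ _) (pairOf_snd hm1 hm2)] at h
    rw [← h]
    refine integral_congr_ae (Eventually.of_forall fun x => ?_)
    simp only [inner_smul_right, real_inner_comm]
  refine Lp.ext ?_
  filter_upwards [(ae_restrict_iff' hΩ.measurableSet).2 hae, Lp.coeFn_zero (Sp d) 2
    (volume.restrict Ω)] with x hx h
  rw [hx, h, Pi.zero_apply]

theorem HasH10Grad.exists_pair {w : Sp d → ℝ} {g : Sp d → Sp d} (h : HasH10Grad Ω w g) :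
    ∃ p ∈ h10 Ω, p.fst =ᵐ[volume.restrict Ω] w ∧ p.snd =ᵐ[volume.restrict Ω] g := by
  refine ⟨pairOf h.1 h.2.1, ?_, pairOf_fst _ _, pairOf_snd _ _⟩
  rw [mem_h10_iff]
  exact h.congr (pairOf_fst _ _).symm (pairOf_snd _ _).symm

/-- The Poincaré–Friedrichs inequality for test functions, from
`∫ φ² = -∫ 2 x₁ φ ∂₁φ`. -/
theorem IsTest.poincare (hΩ : IsOpen Ω) (hd : 0 < d) {R : ℝ} (hR0 : 0 < R)
    (hR : ∀ x ∈ Ω, ‖x‖ ≤ R) (hφ : IsTest Ω φ) :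
    ‖hφ.toPair.fst‖ ≤ 2 * R * ‖hφ.toPair.snd‖ := by
  set e : Sp d := EuclideanSpace.single ⟨0, hd⟩ 1 with he
  have hne : ‖e‖ = 1 := by simp [he]
  have hsq : ∀ x, fderiv ℝ (fun y => φ y * φ y) x e = 2 * (φ x * fderiv ℝ φ x e) := fun x => by
    rw [fderiv_fun_mul (hφ.differentiable x) (hφ.differentiable x)]
    simp
    ring
  have hlin : ∀ x, fderiv ℝ (fun y : Sp d => ⟪e, y⟫) x e = 1 := fun x => by
    have : HasFDerivAt (fun y : Sp d => ⟪e, y⟫) (innerSL ℝ e) x := (innerSL ℝ e).hasFDerivAt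
    rw [this.fderiv, innerSL_apply_apply, real_inner_self_eq_norm_sq, hne, one_pow]
  have hdc : Continuous fun x => fderiv ℝ φ x e := hφ.continuous_fderiv.clm_apply continuous_const
  have hibp := integral_mul_fderiv_eq_neg_fderiv_mul_of_integrable (μ := (volume : Measure (Sp d)))
    (f := fun y => φ y * φ y) (g := fun y : Sp d => ⟪e, y⟫) (v := e)
    (by
      simp only [hsq]
      exact (by have := hφ.1.continuous; fun_prop : Continuous fun x =>
        2 * (φ x * fderiv ℝ φ x e) * ⟪e, x⟫).integrable_of_hasCompactSupport
          (hφ.2.1.mul_right.mul_left.mul_right))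
    (by
      simp only [hlin]
      exact (by have := hφ.1.continuous; fun_prop : Continuous fun x =>
        φ x * φ x * 1).integrable_of_hasCompactSupport hφ.2.1.mul_right.mul_right)
    ((by have := hφ.1.continuous; fun_prop : Continuous fun x =>
        φ x * φ x * ⟪e, x⟫).integrable_of_hasCompactSupport hφ.2.1.mul_right.mul_right)
    (fun x _ => (hφ.differentiable x).mul (hφ.differentiable x))
    (fun x _ => (innerSL ℝ e).differentiableAt)
  simp only [hsq, hlin, mul_one] at hibp
  have h1 : ‖hφ.toPair.fst‖ ^ 2 = ∫ x, φ x * φ x := by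
    rw [← real_inner_self_eq_norm_sq, L2_inner_eq_integral hφ.toPair_fst hφ.toPair_fst]
    simpa [sq] using hφ.setIntegral_eq (μ := volume) φ
  have h2 : -∫ x, 2 * (φ x * fderiv ℝ φ x e) * ⟪e, x⟫ ≤
      ∫ x in Ω, 2 * R * (‖φ x‖ * ‖gradient φ x‖) := by
    have h3 := hφ.setIntegral_eq (μ := volume) (fun x => -(2 * fderiv ℝ φ x e * ⟪e, x⟫))
    have h4 : -∫ x, 2 * (φ x * fderiv ℝ φ x e) * ⟪e, x⟫ =
        ∫ x in Ω, φ x • -(2 * fderiv ℝ φ x e * ⟪e, x⟫) := by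
      rw [h3, ← integral_neg]
      congr 1
      ext x
      simp only [smul_eq_mul]
      ring
    rw [h4]
    have hm := integrable_norm_mul_norm (hφ.memLp (p := 2) (volume.restrict Ω))
      (hφ.memLp_gradient (p := 2) (volume.restrict Ω))
    have hle : ∀ x ∈ Ω, ‖φ x • -(2 * fderiv ℝ φ x e * ⟪e, x⟫)‖ ≤
        2 * R * (‖φ x‖ * ‖gradient φ x‖) := fun x hx => by
      have h5 : ‖fderiv ℝ φ x e‖ ≤ ‖gradient φ x‖ := by
        rw [← inner_gradient_eq]
        simpa [hne] using norm_inner_le_norm (𝕜 := ℝ) (gradient φ x) e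
      have h6 : ‖⟪e, x⟫‖ ≤ R := by
        refine (norm_inner_le_norm (𝕜 := ℝ) e x).trans ?_
        rw [hne, one_mul]
        exact hR x hx
      calc ‖φ x • -(2 * fderiv ℝ φ x e * ⟪e, x⟫)‖
          = 2 * (‖φ x‖ * (‖fderiv ℝ φ x e‖ * ‖⟪e, x⟫‖)) := by
            simp only [norm_smul, norm_neg, norm_mul, Real.norm_ofNat]
            ring
        _ ≤ 2 * (‖φ x‖ * (‖gradient φ x‖ * R)) := by gcongr
        _ = _ := by ring
    exact (le_abs_self _).trans (norm_integral_le_of_norm_le (hm.const_mul _)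
      ((ae_restrict_mem hΩ.measurableSet).mono hle))
  have h7 := integral_norm_mul_norm_le (hφ.memLp (p := 2) (volume.restrict Ω))
    (hφ.memLp_gradient (p := 2) (volume.restrict Ω))
  have h8 : (eLpNorm φ 2 (volume.restrict Ω)).toReal = ‖hφ.toPair.fst‖ :=
    (Lp.norm_toLp φ (hφ.memLp _)).symm
  have h9 : (eLpNorm (gradient φ) 2 (volume.restrict Ω)).toReal = ‖hφ.toPair.snd‖ :=
    (Lp.norm_toLp (gradient φ) (hφ.memLp_gradient _)).symm
  rw [h8, h9] at h7
  rw [integral_const_mul] at h2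
  have h10 : 0 ≤ ‖hφ.toPair.fst‖ := norm_nonneg _
  by_cases h0 : ‖hφ.toPair.fst‖ = 0
  · rw [h0]
    positivity
  have h11 : ‖hφ.toPair.fst‖ * ‖hφ.toPair.fst‖ ≤
      ‖hφ.toPair.fst‖ * (2 * R * ‖hφ.toPair.snd‖) := by
    have h12 := mul_le_mul_of_nonneg_left h7 (by positivity : 0 ≤ 2 * R)
    nlinarith
  exact le_of_mul_le_mul_left h11 (lt_of_le_of_ne h10 (Ne.symm h0))

/-- The Poincaré–Friedrichs inequality in `H₀¹(Ω)`. -/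
theorem h10_poincare (hΩ : IsOpen Ω) (hd : 0 < d) (hb : Bornology.IsBounded Ω) :
    ∃ C : ℝ, 0 < C ∧ ∀ p ∈ h10 Ω, ‖p.fst‖ ≤ C * ‖p.snd‖ := by
  obtain ⟨R, hR0, hR⟩ := hb.exists_pos_norm_le
  refine ⟨2 * R, by positivity, fun p hp => ?_⟩
  have hcl : IsClosed {p : L2Pair Ω | ‖p.fst‖ ≤ 2 * R * ‖p.snd‖} :=
    isClosed_le (by fun_prop) (by fun_prop)
  refine closure_minimal ?_ hcl hp
  rintro q ⟨φ, hφ, h1, h2⟩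
  have h3 := hφ.poincare hΩ hd hR0 hR
  rwa [← Lp.ext (h1.trans hφ.toPair_fst.symm), ← Lp.ext (h2.trans hφ.toPair_snd.symm)] at h3

end Gradient

/-! ### Currying square integrable functions -/

section Curry

/-- A map into a separable metric space is measurable if its distances to all points are. -/
theorem measurable_of_measurable_edist {α Y : Type*} [MeasurableSpace α] [PseudoEMetricSpace Y]
    [SecondCountableTopology Y] [MeasurableSpace Y] [BorelSpace Y] {f : α → Y}
    (h : ∀ c, Measurable fun t => edist (f t) c) : Measurable f := by
  refine measurable_of_isOpen fun O hO => ?_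
  obtain ⟨D, hDc, hD⟩ := TopologicalSpace.exists_countable_dense Y
  have : f ⁻¹' O = ⋃ c ∈ D, ⋃ q ∈ {q : ℚ | Metric.eball c (ENNReal.ofReal q) ⊆ O},
      {t | edist (f t) c < ENNReal.ofReal q} := by
    ext t
    simp only [mem_preimage, mem_iUnion, mem_ofPred_eq, exists_prop]
    constructor
    · intro ht
      obtain ⟨ε, hε, hball⟩ := EMetric.isOpen_iff.1 hO _ ht
      obtain ⟨q, hq0, hq1, hq2⟩ := ENNReal.lt_iff_exists_rat_btwn.1 (ENNReal.half_pos hε.ne')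
      have hq1' : 0 < ENNReal.ofReal q := hq1
      have hqε : ENNReal.ofReal q < ε / 2 := hq2
      obtain ⟨c, hc, hcD⟩ := (EMetric.mem_closure_iff.1 (hD (f t)) _ hq1')
      refine ⟨c, hc, q, fun y hy => hball ?_, hcD⟩
      rw [Metric.mem_eball] at hy ⊢
      calc edist y (f t) ≤ edist y c + edist c (f t) := edist_triangle _ _ _
        _ < ε / 2 + ε / 2 := ENNReal.add_lt_add (hy.trans hqε) (by
            rw [edist_comm]; exact hcD.trans hqε)
        _ = ε := ENNReal.add_halves ε
    · rintro ⟨c, -, q, hq, ht⟩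
      exact hq (Metric.mem_eball.2 ht)
  rw [this]
  exact MeasurableSet.biUnion hDc fun c _ => MeasurableSet.biUnion (Set.to_countable _)
    fun q _ => measurableSet_lt (h c) measurable_const

/-- Currying `L²(α × X; E) → L²(α; L²(X; E))`. -/
theorem exists_curry {α X E : Type*} [MeasurableSpace α] [MeasurableSpace X]
    [NormedAddCommGroup E] {μ : Measure α} {ν : Measure X} [SFinite ν] [SFinite μ]
    [SecondCountableTopology (Lp E 2 ν)] {f : α × X → E} (hf : MemLp f 2 (μ.prod ν)) :
    ∃ V : α → Lp E 2 ν, MemLp V 2 μ ∧ ∀ᵐ t ∂μ, V t =ᵐ[ν] fun x => f (t, x) := by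
  classical
  set g := hf.1.mk f with hg
  have hgm : StronglyMeasurable g := hf.1.stronglyMeasurable_mk
  have hfg : ∀ᵐ t ∂μ, ∀ᵐ x ∂ν, f (t, x) = g (t, x) := Measure.ae_ae_of_ae_prod hf.1.ae_eq_mk
  have hgt : ∀ t, StronglyMeasurable fun x => g (t, x) := fun t =>
    hgm.comp_measurable measurable_prodMk_left
  have hnorm : ∀ (c : X → E), StronglyMeasurable c →
      Measurable fun t => eLpNorm (fun x => g (t, x) - c x) 2 ν := fun c hc => by
    simp only [eLpNorm_eq_lintegral_rpow_enorm_toReal two_ne_zero ENNReal.ofNat_ne_top]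
    refine Measurable.pow_const (Measurable.lintegral_prod_right' (f := fun z : α × X =>
      ‖g z - c z.2‖ₑ ^ (2 : ℝ≥0∞).toReal) ?_) _
    exact ((hgm.sub (hc.comp_measurable measurable_snd)).enorm).pow_const _
  have hnorm0 : Measurable fun t => eLpNorm (fun x => g (t, x)) 2 ν := by
    simpa using hnorm 0 stronglyMeasurable_zero
  have hset : MeasurableSet {t | eLpNorm (fun x => g (t, x)) 2 ν < ⊤} :=
    measurableSet_lt hnorm0 measurable_const
  set V : α → Lp E 2 ν := fun t => if h : eLpNorm (fun x => g (t, x)) 2 ν < ⊤ then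
    MemLp.toLp (fun x => g (t, x)) ⟨(hgt t).aestronglyMeasurable, h⟩ else 0 with hV
  have hVm : StronglyMeasurable V := by
    borelize ↥(Lp E 2 ν)
    refine (measurable_of_measurable_edist fun c => ?_).stronglyMeasurable
    have : (fun t => edist (V t) c) = fun t => if eLpNorm (fun x => g (t, x)) 2 ν < ⊤ then
        eLpNorm (fun x => g (t, x) - c x) 2 ν else edist 0 c := by
      ext t
      by_cases h : eLpNorm (fun x => g (t, x)) 2 ν < ⊤
      · simp only [hV, h, if_true, dif_pos]
        rw [Lp.edist_def]
        refine eLpNorm_congr_ae ?_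
        filter_upwards [MemLp.coeFn_toLp ⟨(hgt t).aestronglyMeasurable, h⟩] with x hx
        rw [Pi.sub_apply, hx]
      · simp only [hV, h, if_false, dif_neg, not_false_iff]
    rw [this]
    exact Measurable.ite hset (hnorm _ (Lp.stronglyMeasurable c)) measurable_const
  have hVn : ∀ t, ‖V t‖ₑ ≤ eLpNorm (fun x => g (t, x)) 2 ν := fun t => by
    by_cases h : eLpNorm (fun x => g (t, x)) 2 ν < ⊤
    · simp only [hV, h, dif_pos]
      exact (Lp.enorm_toLp _).le
    · simp [hV, h]
  have hfin : ∫⁻ t, eLpNorm (fun x => g (t, x)) 2 ν ^ 2 ∂μ < ⊤ := by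
    have hg2 : eLpNorm g 2 (μ.prod ν) ^ 2 < ⊤ := ENNReal.pow_lt_top (hf.ae_eq hf.1.ae_eq_mk).2
    have h1 := eLpNorm_nnreal_pow_eq_lintegral (f := g) (p := 2) (μ := μ.prod ν) (by norm_num)
    have h2 : eLpNorm g 2 (μ.prod ν) ^ 2 = ∫⁻ z, ‖g z‖ₑ ^ 2 ∂(μ.prod ν) := by simpa using h1
    rw [h2, lintegral_prod _ (hgm.enorm.pow_const 2).aemeasurable] at hg2
    refine lt_of_le_of_lt (lintegral_mono fun t => ?_) hg2
    have h3 := eLpNorm_nnreal_pow_eq_lintegral (f := fun x => g (t, x)) (p := 2) (μ := ν)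
      (by norm_num)
    exact le_of_eq (by simpa using h3)
  refine ⟨V, ⟨hVm.aestronglyMeasurable, ?_⟩, ?_⟩
  · have h1 := eLpNorm_nnreal_pow_eq_lintegral (f := V) (p := 2) (μ := μ) (by norm_num)
    have h2 : eLpNorm V 2 μ ^ 2 = ∫⁻ t, ‖V t‖ₑ ^ 2 ∂μ := by simpa using h1
    have h3 : eLpNorm V 2 μ ^ 2 < ⊤ := by
      rw [h2]
      exact (lintegral_mono fun t => pow_le_pow_left' (hVn t) 2).trans_lt hfin
    exact (ENNReal.pow_lt_top_iff.1 h3).resolve_right two_ne_zero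
  · have h1 := ae_lt_top (hnorm0.pow_const 2) hfin.ne
    filter_upwards [h1, hfg] with t ht htf
    have ht' : eLpNorm (fun x => g (t, x)) 2 ν < ⊤ :=
      (ENNReal.pow_lt_top_iff.1 ht).resolve_right two_ne_zero
    have hVt : V t =ᵐ[ν] fun x => g (t, x) := by
      simp only [hV, ht', dif_pos]
      exact MemLp.coeFn_toLp _
    filter_upwards [hVt, htf] with x h1 h2
    rw [h1, h2]

end Curry

/-! ### Time-continuous representatives and their energy identity -/

section SpaceTime

variable {d : ℕ} {T : ℝ} {Ω : Set (Sp d)}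

theorem restrict_cyl (T : ℝ) (Ω : Set (Sp d)) :
    (volume.restrict (cyl T Ω) : Measure (ℝ × Sp d)) =
      (volume.restrict (Ioo 0 T)).prod (volume.restrict Ω) := by
  rw [Measure.prod_restrict]
  rfl

theorem ae_ae_of_ae_cyl {p : ℝ × Sp d → Prop} (h : ∀ᵐ z ∂(volume.restrict (cyl T Ω)), p z) :
    ∀ᵐ t ∂(volume.restrict (Ioo 0 T)), ∀ᵐ x ∂(volume.restrict Ω), p (t, x) := by
  rw [restrict_cyl] at h
  exact Measure.ae_ae_of_ae_prod h

theorem setIntegral_cyl {E : Type*} [NormedAddCommGroup E] [NormedSpace ℝ E]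
    {g : ℝ × Sp d → E} (hg : IntegrableOn g (cyl T Ω)) :
    ∫ z in cyl T Ω, g z = ∫ t in Ioo 0 T, ∫ x in Ω, g (t, x) := by
  rw [IntegrableOn, restrict_cyl] at hg
  rw [restrict_cyl, integral_prod _ hg]

/-- The time slices of a square integrable pair on `Q` form an element of `L²(I; L²(Ω)^{1+d})`. -/
theorem exists_curry_pair {v : ℝ × Sp d → ℝ} {G : ℝ × Sp d → Sp d}
    (hv : MemLp v 2 (volume.restrict (cyl T Ω))) (hG : MemLp G 2 (volume.restrict (cyl T Ω))) :
    ∃ k : ℝ → L2Pair Ω, MemLp k 2 (volume.restrict (Ioo 0 T)) ∧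
      ∀ᵐ t ∂(volume.restrict (Ioo 0 T)), (k t).fst =ᵐ[volume.restrict Ω] (fun x => v (t, x)) ∧
        (k t).snd =ᵐ[volume.restrict Ω] (fun x => G (t, x)) := by
  rw [restrict_cyl] at hv hG
  have : Fact ((2 : ℝ≥0∞) ≠ ⊤) := ⟨by simp⟩
  obtain ⟨V, hV, hV'⟩ := exists_curry hv
  obtain ⟨W, hW, hW'⟩ := exists_curry hG
  refine ⟨fun t => WithLp.toLp 2 (V t, W t), memLp_prodLp_iff.2 ⟨hV, hW⟩, ?_⟩
  filter_upwards [hV', hW'] with t h1 h2 using ⟨h1, h2⟩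

theorem ae_memLp_slice {v : ℝ × Sp d → ℝ} {G : ℝ × Sp d → Sp d}
    (hv : MemLp v 2 (volume.restrict (cyl T Ω))) (hG : MemLp G 2 (volume.restrict (cyl T Ω))) :
    ∀ᵐ t ∂(volume.restrict (Ioo 0 T)), MemLp (fun x => v (t, x)) 2 (volume.restrict Ω) ∧
      MemLp (fun x => G (t, x)) 2 (volume.restrict Ω) := by
  obtain ⟨k, -, hk⟩ := exists_curry_pair hv hG
  filter_upwards [hk] with t ht
  exact ⟨(Lp.memLp _).ae_eq ht.1, (Lp.memLp _).ae_eq ht.2⟩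

theorem L2Pair_inner_eq_integral {p q : L2Pair Ω} {a b : Sp d → ℝ} {g h : Sp d → Sp d}
    (h1 : p.fst =ᵐ[volume.restrict Ω] a) (h2 : p.snd =ᵐ[volume.restrict Ω] g)
    (h3 : q.fst =ᵐ[volume.restrict Ω] b) (h4 : q.snd =ᵐ[volume.restrict Ω] h) :
    ⟪p, q⟫ = ∫ x in Ω, (a x * b x + ⟪g x, h x⟫) := by
  rw [L2Pair_inner, L2_inner_eq_integral h1 h3, L2_inner_eq_integral h2 h4, ← integral_add]
  · simp [mul_comm]
  · exact integrable_inner_of_memLp ((Lp.memLp p.fst).ae_eq h1) ((Lp.memLp q.fst).ae_eq h3)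
  · exact integrable_inner_of_memLp ((Lp.memLp p.snd).ae_eq h2) ((Lp.memLp q.snd).ae_eq h4)

theorem IsTest.tensor {a : ℝ → ℝ} {φ : Sp d → ℝ} (ha : IsTest (Ioo 0 T) a) (hφ : IsTest Ω φ) :
    IsTest (cyl T Ω) fun z => a z.1 * φ z.2 := by
  have hsub : tsupport (fun z : ℝ × Sp d => a z.1 * φ z.2) ⊆ tsupport a ×ˢ tsupport φ := by
    refine closure_minimal (fun z hz => ?_) ((isClosed_tsupport a).prod (isClosed_tsupport φ))
    exact ⟨subset_tsupport _ (left_ne_zero_of_mul hz), subset_tsupport _ (right_ne_zero_of_mul hz)⟩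
  refine ⟨(ha.1.comp contDiff_fst).mul (hφ.1.comp contDiff_snd), ?_,
    hsub.trans (prod_mono ha.2.2 hφ.2.2)⟩
  exact IsCompact.of_isClosed_subset (ha.2.1.isCompact.prod hφ.2.1.isCompact)
    (isClosed_tsupport _) hsub

theorem fderiv_tensor {a : ℝ → ℝ} {φ : Sp d → ℝ} {z : ℝ × Sp d} (ha : DifferentiableAt ℝ a z.1)
    (hφ : DifferentiableAt ℝ φ z.2) (α : ℝ) (β : Sp d) :
    fderiv ℝ (fun z : ℝ × Sp d => a z.1 * φ z.2) z (α, β) =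
      deriv a z.1 * (φ z.2 * α) + a z.1 * ⟪gradient φ z.2, β⟫ := by
  have h1 : HasFDerivAt (fun z : ℝ × Sp d => a z.1)
      ((fderiv ℝ a z.1).comp (ContinuousLinearMap.fst ℝ ℝ (Sp d))) z :=
    ha.hasFDerivAt.comp z hasFDerivAt_fst
  have h2 : HasFDerivAt (fun z : ℝ × Sp d => φ z.2)
      ((fderiv ℝ φ z.2).comp (ContinuousLinearMap.snd ℝ ℝ (Sp d))) z :=
    hφ.hasFDerivAt.comp z hasFDerivAt_snd
  rw [(h1.fun_mul h2).fderiv, inner_gradient_eq]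
  simp only [add_apply, smul_apply, ContinuousLinearMap.comp_apply, ContinuousLinearMap.coe_fst',
    ContinuousLinearMap.coe_snd', smul_eq_mul, fderiv_eq_smul_deriv]
  ring

theorem integrableOn_cyl_mul_test {Φ : ℝ × Sp d → ℝ} (hΦ : Continuous Φ)
    (hs : HasCompactSupport Φ) (v : L2Q T Ω) :
    IntegrableOn (fun z => Φ z * v z) (cyl T Ω) :=
  (hΦ.memLp_of_hasCompactSupport (p := 2) hs).integrable_mul (Lp.memLp v)

/-- The weak form of `∂ₜ v = F - div_x τ`, tested with `a(t) φ(x)` and sliced in time. -/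
theorem HasDivTX.integral_tensor {v F : L2Q T Ω} {τ : L2Qd T Ω} (h : HasDivTX (v, τ) F)
    {a : ℝ → ℝ} {φ : Sp d → ℝ} (ha : IsTest (Ioo 0 T) a) (hφ : IsTest Ω φ) :
    ∫ t in Ioo 0 T, (deriv a t * ∫ x in Ω, φ x * v (t, x)) +
      a t * ∫ x in Ω, (φ x * F (t, x) + ⟪gradient φ x, τ (t, x)⟫) = 0 := by
  have h1 := h _ (ha.tensor hφ)
  have hda : Continuous (deriv a) := ha.1.continuous_deriv (by simp)
  have hcs : ∀ {b : ℝ → ℝ} {E : Type} [NormedAddCommGroup E] [NormedSpace ℝ E] {g : Sp d → E},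
      HasCompactSupport b → HasCompactSupport g →
      HasCompactSupport fun z : ℝ × Sp d => b z.1 • g z.2 := fun {b E _ _ g} hb hg => by
    refine HasCompactSupport.intro (hb.isCompact.prod hg.isCompact) fun z hz => ?_
    rw [mem_prod, not_and_or] at hz
    rcases hz with hz | hz
    · rw [image_eq_zero_of_notMem_tsupport hz, zero_smul]
    · rw [image_eq_zero_of_notMem_tsupport hz, smul_zero]
  have hφc := hφ.1.continuous
  have hac := ha.1.continuous
  have hgc := hφ.continuous_gradient
  have i1 : IntegrableOn (fun z => (deriv a z.1 • φ z.2) * v z) (cyl T Ω) :=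
    integrableOn_cyl_mul_test (by fun_prop) (hcs ha.2.1.deriv hφ.2.1) v
  have i2 : IntegrableOn (fun z => (a z.1 • φ z.2) * F z) (cyl T Ω) :=
    integrableOn_cyl_mul_test (by fun_prop) (hcs ha.2.1 hφ.2.1) F
  have i3 : IntegrableOn (fun z => ⟪a z.1 • gradient φ z.2, τ z⟫) (cyl T Ω) :=
    integrable_inner_of_memLp ((by fun_prop : Continuous fun z : ℝ × Sp d =>
      a z.1 • gradient φ z.2).memLp_of_hasCompactSupport
        (hcs ha.2.1 hφ.hasCompactSupport_gradient)) (Lp.memLp τ)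
  have i4 : IntegrableOn (fun z => (deriv a z.1 • φ z.2) * v z + ⟪a z.1 • gradient φ z.2, τ z⟫)
      (cyl T Ω) := i1.add i3
  have i5 : IntegrableOn (fun z => (deriv a z.1 • φ z.2) * v z +
      ⟪a z.1 • gradient φ z.2, τ z⟫ + (a z.1 • φ z.2) * F z) (cyl T Ω) := i4.add i2
  have h2 : ∫ z in cyl T Ω, ((deriv a z.1 • φ z.2) * v z + ⟪a z.1 • gradient φ z.2, τ z⟫ +
      (a z.1 • φ z.2) * F z) = 0 := by
    rw [integral_add i4 i2]
    rw [← eq_neg_iff_add_eq_zero]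
    convert h1 using 1
    · refine integral_congr_ae (Eventually.of_forall fun z => ?_)
      simp only [fderiv_tensor (ha.differentiable z.1) (hφ.differentiable z.2), smul_eq_mul,
        inner_smul_left, conj_trivial]
      ring
    · simp only [smul_eq_mul, mul_comm]
  have h2' := (setIntegral_cyl i5).symm.trans h2
  refine (integral_congr_ae ?_).trans h2'
  filter_upwards [ae_memLp_slice (Lp.memLp v) (Lp.memLp τ), ae_memLp_slice (Lp.memLp F)
    (Lp.memLp τ)] with t h3 h4
  have hφ2 : MemLp φ 2 (volume.restrict Ω) := hφ.memLp _
  have j1 : Integrable (fun x => φ x * v (t, x)) (volume.restrict Ω) := hφ2.integrable_mul h3.1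
  have j2 : Integrable (fun x => φ x * F (t, x)) (volume.restrict Ω) := hφ2.integrable_mul h4.1
  have j3 : Integrable (fun x => ⟪gradient φ x, τ (t, x)⟫) (volume.restrict Ω) :=
    integrable_inner_of_memLp (hφ.memLp_gradient _) h3.2
  have j4 : Integrable (fun x => φ x * F (t, x) + ⟪gradient φ x, τ (t, x)⟫)
      (volume.restrict Ω) := j2.add j3
  rw [← integral_const_mul, ← integral_const_mul,
    ← integral_add (j1.const_mul _) (j4.const_mul _)]
  refine integral_congr_ae (Eventually.of_forall fun x => ?_)
  simp only [smul_eq_mul, inner_smul_left, conj_trivial]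
  ring

/-- The projection `H₀¹(Ω) → L²(Ω)`, `(w, ∇w) ↦ w`. -/
def h10ToL2 (Ω : Set (Sp d)) : h10 Ω →L[ℝ] L2Om Ω :=
  (WithLp.fstL 2 ℝ (L2Om Ω) (L2Omd Ω)).comp (h10 Ω).subtypeL

theorem h10ToL2_apply (p : h10 Ω) : h10ToL2 Ω p = (p : L2Pair Ω).fst := rfl

/-- The element `(φ, ∇φ)` of `H₀¹(Ω)`. -/
def IsTest.toH10 {φ : Sp d → ℝ} (hφ : IsTest Ω φ) : h10 Ω :=
  ⟨hφ.toPair, testGraph_le_h10 hφ.toPair_mem⟩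

/-- Test functions are dense in `H₀¹(Ω)`, so that they detect whether an `H₀¹(Ω)`-valued integral
vanishes. -/
theorem h10_integral_eq_zero {α : Type*} [MeasurableSpace α] {μ : Measure α} {f : α → h10 Ω}
    (hf : Integrable f μ) (h : ∀ φ (hφ : IsTest Ω φ), ∫ t, ⟪hφ.toH10, f t⟫ ∂μ = 0) :
    ∫ t, f t ∂μ = 0 := by
  have hyo : ((∫ t, f t ∂μ : h10 Ω) : L2Pair Ω) ∈ (h10 Ω)ᗮ := by
    rw [mem_h10_orthogonal_iff]
    exact fun φ hφ => (integral_inner hf hφ.toH10).symm.trans (h φ hφ)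
  have hyy := (Submodule.mem_orthogonal _ _).1 hyo _ (∫ t, f t ∂μ : h10 Ω).2
  exact Subtype.ext (inner_self_eq_zero.1 hyy)

/-- For `(v, τ) ∈ U`, testing in `H₀¹(Ω)` turns `∂ₜ v = F - div_x τ` into a weak time derivative
of the `H₀¹(Ω)`-valued function `(v, ∇v)`, whose right-hand side is the orthogonal projection of
`(F, τ)` onto `H₀¹(Ω)`. -/
theorem hasWeakTimeDeriv_of_hasDivTX {v F : L2Q T Ω} {τ : L2Qd T Ω}
    (h : HasDivTX (v, τ) F) {k : ℝ → h10 Ω} {n : ℝ → L2Pair Ω}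
    (hkm : MemLp k 2 (volume.restrict (Ioo 0 T))) (hnm : MemLp n 2 (volume.restrict (Ioo 0 T)))
    (hk : ∀ᵐ t ∂(volume.restrict (Ioo 0 T)),
      (k t : L2Pair Ω).fst =ᵐ[volume.restrict Ω] fun x => v (t, x))
    (hn : ∀ᵐ t ∂(volume.restrict (Ioo 0 T)),
      (n t).fst =ᵐ[volume.restrict Ω] (fun x => F (t, x)) ∧
        (n t).snd =ᵐ[volume.restrict Ω] (fun x => τ (t, x))) :
    HasWeakTimeDeriv (h10ToL2 Ω) T k (fun t => (h10 Ω).orthogonalProjectionOnto (n t)) := by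
  intro a ha
  have hki : Integrable (fun t => ((h10ToL2 Ω).adjoint) (h10ToL2 Ω (k t)))
      (volume.restrict (Ioo 0 T)) :=
    ((h10ToL2 Ω).adjoint ∘L h10ToL2 Ω).integrable_comp (hkm.integrable (by norm_num))
  have hfi : Integrable (fun t => (h10 Ω).orthogonalProjectionOnto (n t))
      (volume.restrict (Ioo 0 T)) :=
    ((h10 Ω).orthogonalProjectionOnto).integrable_comp (hnm.integrable (by norm_num))
  refine h10_integral_eq_zero ((ha.integrable_deriv_smul hki).add (ha.integrable_smul hfi))
    fun φ hφ => (integral_congr_ae ?_).trans (h.integral_tensor ha hφ)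
  filter_upwards [hk, hn] with t hkt hnt
  have h2 : ⟪hφ.toH10, ((h10ToL2 Ω).adjoint) (h10ToL2 Ω (k t))⟫ =
      ∫ x in Ω, φ x * v (t, x) := by
    rw [ContinuousLinearMap.adjoint_inner_right]
    refine (L2_inner_eq_integral hφ.toPair_fst hkt).trans ?_
    simp only [RCLike.inner_apply, conj_trivial, mul_comm]
  have h3 : ⟪hφ.toH10, (h10 Ω).orthogonalProjectionOnto (n t)⟫ =
      ∫ x in Ω, (φ x * F (t, x) + ⟪gradient φ x, τ (t, x)⟫) :=
    (Submodule.inner_orthogonalProjectionOnto_eq_of_mem_left hφ.toH10 (n t)).trans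
      (L2Pair_inner_eq_integral hφ.toPair_fst hφ.toPair_snd hnt.1 hnt.2)
  rw [inner_add_right, real_inner_smul_right, real_inner_smul_right, h2, h3]

/-- Elements of `U` have a representative in `C([0,T]; L²(Ω))` which satisfies the energy
identity. -/
theorem exists_timeRep_energy (hT : 0 < T) {v F : L2Q T Ω} {τ G : L2Qd T Ω}
    (h : HasDivTX (v, τ) F) (hG : HasGradX v G) :
    ∃ w : ℝ → L2Om Ω, IsTimeRep v w ∧ ∀ s ∈ Icc 0 T, ∀ t ∈ Icc 0 T, ‖w t‖ ^ 2 - ‖w s‖ ^ 2 =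
      2 * ∫ r in s..t, ∫ x in Ω, (F (r, x) * v (r, x) + ⟪τ (r, x), G (r, x)⟫) := by
  obtain ⟨k, hkm, hk⟩ := exists_curry_pair (Lp.memLp v) (Lp.memLp G)
  obtain ⟨n, hnm, hn⟩ := exists_curry_pair (Lp.memLp F) (Lp.memLp τ)
  have hkh : ∀ᵐ t ∂(volume.restrict (Ioo 0 T)), k t ∈ h10 Ω := by
    filter_upwards [hk, hG] with t ht htG
    exact (mem_h10_iff _).2 (htG.congr ht.1.symm ht.2.symm)
  set P := (h10 Ω).orthogonalProjectionOnto with hP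
  have hPk : ∀ᵐ t ∂(volume.restrict (Ioo 0 T)), (P (k t) : L2Pair Ω) = k t := by
    filter_upwards [hkh] with t ht
    exact congrArg Subtype.val (Submodule.orthogonalProjectionOnto_mem_subspace_eq_self
      (K := h10 Ω) ⟨k t, ht⟩)
  have hPkm : MemLp (fun t => P (k t)) 2 (volume.restrict (Ioo 0 T)) := P.comp_memLp' hkm
  have hPnm : MemLp (fun t => P (n t)) 2 (volume.restrict (Ioo 0 T)) := P.comp_memLp' hnm
  have hwd : HasWeakTimeDeriv (h10ToL2 Ω) T (fun t => P (k t)) (fun t => P (n t)) := by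
    refine hasWeakTimeDeriv_of_hasDivTX h hPkm hnm ?_ hn
    filter_upwards [hPk, hk] with t h1 h2
    rw [h1]
    exact h2.1
  obtain ⟨w, hw⟩ := exists_energyRep (h10ToL2 Ω) hT hPkm hPnm hwd
  refine ⟨w, ⟨hw.continuousOn, ?_⟩, fun s hs t ht => ?_⟩
  · filter_upwards [ae_restrict_of_ae_restrict_of_subset Ioo_subset_Icc_self hw.ae_eq, hPk, hk]
      with t h1 h2 h3
    rw [h1, h10ToL2_apply, h2]
    exact h3.1
  · rw [hw.energy s hs t ht]
    congr 1
    refine intervalIntegral.integral_congr_ae ?_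
    have hsub : uIoc s t ⊆ Icc 0 T :=
      uIoc_subset_uIcc.trans (ordConnected_Icc.uIcc_subset hs ht)
    have hae : ∀ᵐ r ∂(volume.restrict (Ioo 0 T)), ⟪P (n r), P (k r)⟫ =
        ∫ x in Ω, (F (r, x) * v (r, x) + ⟪τ (r, x), G (r, x)⟫) := by
      filter_upwards [hkh, hk, hn] with r h1 h2 h3
      rw [← L2Pair_inner_eq_integral h3.1 h3.2 h2.1 h2.2]
      have h4 : P (k r) = ⟨k r, h1⟩ :=
        Submodule.orthogonalProjectionOnto_mem_subspace_eq_self (K := h10 Ω) ⟨k r, h1⟩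
      rw [h4]
      exact Submodule.inner_orthogonalProjectionOnto_eq_of_mem_right (K := h10 Ω) ⟨k r, h1⟩ (n r)
    rw [Measure.restrict_congr_set Ioo_ae_eq_Icc, ae_restrict_iff' measurableSet_Icc] at hae
    filter_upwards [hae] with r hr hrI using hr (hsub hrI)

theorem IsTimeRep.eqOn (hT : 0 < T) {v : L2Q T Ω} {w w' : ℝ → L2Om Ω} (h : IsTimeRep v w)
    (h' : IsTimeRep v w') : EqOn w w' (Icc 0 T) := by
  refine Measure.eqOn_Icc_of_ae_eq volume hT.ne ?_ h.1 h'.1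
  rw [← Measure.restrict_congr_set Ioo_ae_eq_Icc]
  filter_upwards [h.2, h'.2] with t h1 h2
  exact Lp.ext (h1.trans h2.symm)

end SpaceTime

/-! ### Calculus in the space `U` -/

section Linear

variable {d : ℕ} {T : ℝ} {Ω : Set (Sp d)}

theorem HasH10Grad.add {w w' : Sp d → ℝ} {g g' : Sp d → Sp d} (h : HasH10Grad Ω w g)
    (h' : HasH10Grad Ω w' g') : HasH10Grad Ω (fun x => w x + w' x) (fun x => g x + g' x) := by
  obtain ⟨p, hp, h1, h2⟩ := h.exists_pair
  obtain ⟨q, hq, h3, h4⟩ := h'.exists_pair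
  refine ((mem_h10_iff _).1 ((h10 Ω).add_mem hp hq)).congr ?_ ?_
  · filter_upwards [Lp.coeFn_add p.fst q.fst, h1, h3] with x hx h1 h3
    rw [WithLp.add_fst, hx, Pi.add_apply, h1, h3]
  · filter_upwards [Lp.coeFn_add p.snd q.snd, h2, h4] with x hx h1 h3
    rw [WithLp.add_snd, hx, Pi.add_apply, h1, h3]

theorem HasH10Grad.const_smul {w : Sp d → ℝ} {g : Sp d → Sp d} (h : HasH10Grad Ω w g) (c : ℝ) :
    HasH10Grad Ω (fun x => c * w x) (fun x => c • g x) := by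
  obtain ⟨p, hp, h1, h2⟩ := h.exists_pair
  refine ((mem_h10_iff _).1 ((h10 Ω).smul_mem c hp)).congr ?_ ?_
  · filter_upwards [Lp.coeFn_smul c p.fst, h1] with x hx h1
    rw [WithLp.smul_fst, hx, Pi.smul_apply, h1, smul_eq_mul]
  · filter_upwards [Lp.coeFn_smul c p.snd, h2] with x hx h1
    rw [WithLp.smul_snd, hx, Pi.smul_apply, h1]

theorem IsTest.hasH10Grad {φ : Sp d → ℝ} (hφ : IsTest Ω φ) : HasH10Grad Ω φ (gradient φ) :=
  ((mem_h10_iff _).1 (testGraph_le_h10 hφ.toPair_mem)).congr hφ.toPair_fst hφ.toPair_snd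

theorem HasH10Grad.ae_unique (hΩ : IsOpen Ω) {w : Sp d → ℝ} {g g' : Sp d → Sp d}
    (h : HasH10Grad Ω w g) (h' : HasH10Grad Ω w g') : g =ᵐ[volume.restrict Ω] g' := by
  obtain ⟨p, hp, h1, h2⟩ := h.exists_pair
  obtain ⟨q, hq, h3, h4⟩ := h'.exists_pair
  have h5 : p.fst = q.fst := Lp.ext (h1.trans h3.symm)
  have h6 : (p - q).snd = 0 := h10_snd_eq_zero hΩ ((h10 Ω).sub_mem hp hq) (by
    rw [WithLp.sub_fst, h5, sub_self])
  rw [WithLp.sub_snd, sub_eq_zero] at h6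
  rw [h6] at h2
  exact h2.symm.trans h4

theorem integrable_prod_of_cyl {E : Type*} [NormedAddCommGroup E] {g : ℝ × Sp d → E}
    (hg : IntegrableOn g (cyl T Ω)) :
    Integrable g ((volume.restrict (Ioo 0 T)).prod (volume.restrict Ω)) := by
  rwa [IntegrableOn, restrict_cyl] at hg

theorem HasGradX.add {v v' : L2Q T Ω} {G G' : L2Qd T Ω} (h : HasGradX v G) (h' : HasGradX v' G') :
    HasGradX (v + v') (G + G') := by
  filter_upwards [h, h', ae_ae_of_ae_cyl (Lp.coeFn_add v v'), ae_ae_of_ae_cyl (Lp.coeFn_add G G')]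
    with t h1 h2 h3 h4
  refine (h1.add h2).congr ?_ ?_
  · filter_upwards [h3] with x hx using hx.symm
  · filter_upwards [h4] with x hx using hx.symm

theorem HasGradX.smul {v : L2Q T Ω} {G : L2Qd T Ω} (h : HasGradX v G) (c : ℝ) :
    HasGradX (c • v) (c • G) := by
  filter_upwards [h, ae_ae_of_ae_cyl (Lp.coeFn_smul c v), ae_ae_of_ae_cyl (Lp.coeFn_smul c G)]
    with t h1 h3 h4
  refine (h1.const_smul c).congr ?_ ?_
  · filter_upwards [h3] with x hx using hx.symm
  · filter_upwards [h4] with x hx using hx.symm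

theorem ae_cyl_of_ae_ae {E : Type*} [NormedAddCommGroup E] {G G' : ℝ × Sp d → E}
    (hG : StronglyMeasurable G) (hG' : StronglyMeasurable G')
    (h : ∀ᵐ t ∂(volume.restrict (Ioo 0 T)), (fun x => G (t, x)) =ᵐ[volume.restrict Ω]
      fun x => G' (t, x)) : G =ᵐ[volume.restrict (cyl T Ω)] G' := by
  rw [restrict_cyl]
  exact (Measure.ae_prod_iff_ae_ae (hG.measurableSet_eq_fun hG')).2 h

theorem HasGradX.unique (hΩ : IsOpen Ω) {v : L2Q T Ω} {G G' : L2Qd T Ω} (h : HasGradX v G)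
    (h' : HasGradX v G') : G = G' := by
  refine Lp.ext (ae_cyl_of_ae_ae (Lp.stronglyMeasurable G) (Lp.stronglyMeasurable G') ?_)
  filter_upwards [h, h'] with t h1 h2 using h1.ae_unique hΩ h2

theorem HasGradX.gradX_eq (hΩ : IsOpen Ω) {v : L2Q T Ω} {G : L2Qd T Ω} (h : HasGradX v G) :
    gradX v = G := by
  have hex : ∃ G : L2Qd T Ω, HasGradX v G := ⟨G, h⟩
  rw [gradX, dif_pos hex]
  exact hex.choose_spec.unique hΩ h

theorem integrable_fderiv_test {φ : ℝ × Sp d → ℝ} (hφ : IsTest (cyl T Ω) φ)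
    (v : L2Q T Ω × L2Qd T Ω) :
    IntegrableOn (fun z => fderiv ℝ φ z (v.1 z, v.2 z)) (cyl T Ω) := by
  have h1 : MemLp (fderiv ℝ φ) 2 (volume.restrict (cyl T Ω)) :=
    hφ.continuous_fderiv.memLp_of_hasCompactSupport (hφ.2.1.fderiv ℝ)
  refine ((integrable_norm_mul_norm h1 (Lp.memLp v.1)).add
    (integrable_norm_mul_norm h1 (Lp.memLp v.2))).mono' ?_ (Eventually.of_forall fun z => ?_)
  · exact (ContinuousLinearMap.id ℝ (ℝ × Sp d →L[ℝ] ℝ)).aestronglyMeasurable_comp₂ h1.1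
      ((Lp.aestronglyMeasurable v.1).prodMk (Lp.aestronglyMeasurable v.2))
  · refine ((fderiv ℝ φ z).le_opNorm _).trans ?_
    rw [Pi.add_apply, ← mul_add]
    refine mul_le_mul_of_nonneg_left ?_ (norm_nonneg _)
    rw [Prod.norm_mk]
    exact max_le_add_of_nonneg (norm_nonneg _) (norm_nonneg _)

theorem integrable_mul_test {φ : ℝ × Sp d → ℝ} (hφ : IsTest (cyl T Ω) φ) (F : L2Q T Ω) :
    IntegrableOn (fun z => F z * φ z) (cyl T Ω) :=
  (Lp.memLp F).integrable_mul (hφ.memLp (p := 2) _)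

theorem HasDivTX.add {v v' : L2Q T Ω × L2Qd T Ω} {F F' : L2Q T Ω} (h : HasDivTX v F)
    (h' : HasDivTX v' F') : HasDivTX (v + v') (F + F') := by
  intro φ hφ
  have h1 : ∫ z in cyl T Ω, fderiv ℝ φ z ((v + v').1 z, (v + v').2 z) =
      ∫ z in cyl T Ω, (fderiv ℝ φ z (v.1 z, v.2 z) + fderiv ℝ φ z (v'.1 z, v'.2 z)) := by
    refine integral_congr_ae ?_
    filter_upwards [Lp.coeFn_add v.1 v'.1, Lp.coeFn_add v.2 v'.2] with z h1 h2
    rw [Prod.fst_add, Prod.snd_add, h1, h2, ← map_add]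
    rfl
  have h2 : ∫ z in cyl T Ω, (F + F') z * φ z = ∫ z in cyl T Ω, (F z * φ z + F' z * φ z) := by
    refine integral_congr_ae ?_
    filter_upwards [Lp.coeFn_add F F'] with z h1
    rw [h1, Pi.add_apply, add_mul]
  rw [h1, h2, integral_add (integrable_fderiv_test hφ v) (integrable_fderiv_test hφ v'),
    integral_add (integrable_mul_test hφ F) (integrable_mul_test hφ F'), h φ hφ, h' φ hφ]
  ring

theorem HasDivTX.smul {v : L2Q T Ω × L2Qd T Ω} {F : L2Q T Ω} (h : HasDivTX v F) (c : ℝ) :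
    HasDivTX (c • v) (c • F) := by
  intro φ hφ
  have h1 : ∫ z in cyl T Ω, fderiv ℝ φ z ((c • v).1 z, (c • v).2 z) =
      ∫ z in cyl T Ω, c * fderiv ℝ φ z (v.1 z, v.2 z) := by
    refine integral_congr_ae ?_
    filter_upwards [Lp.coeFn_smul c v.1, Lp.coeFn_smul c v.2] with z h1 h2
    rw [Prod.smul_fst, Prod.smul_snd, h1, h2, ← smul_eq_mul, ← map_smul]
    rfl
  have h2 : ∫ z in cyl T Ω, (c • F) z * φ z = ∫ z in cyl T Ω, c * (F z * φ z) := by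
    refine integral_congr_ae ?_
    filter_upwards [Lp.coeFn_smul c F] with z h1
    rw [h1, Pi.smul_apply, smul_eq_mul, mul_assoc]
  rw [h1, h2, integral_const_mul, integral_const_mul, h φ hφ]
  ring

theorem isOpen_cyl (hΩ : IsOpen Ω) : IsOpen (cyl T Ω) := isOpen_Ioo.prod hΩ

theorem HasDivTX.unique (hΩ : IsOpen Ω) {v : L2Q T Ω × L2Qd T Ω} {F F' : L2Q T Ω}
    (h : HasDivTX v F) (h' : HasDivTX v F') : F = F' := by
  have hloc : LocallyIntegrableOn (fun z => F z - F' z) (cyl T Ω) volume :=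
    locallyIntegrableOn_of_locallyIntegrable_restrict
      (((Lp.memLp F).sub (Lp.memLp F')).locallyIntegrable (by norm_num))
  have hae := (isOpen_cyl hΩ).ae_eq_zero_of_integral_contDiff_smul_eq_zero hloc
    fun φ hφ1 hφ2 hφ3 => by
      have hφ : IsTest (cyl T Ω) φ := ⟨hφ1, hφ2, hφ3⟩
      rw [← hφ.setIntegral_eq]
      have h1 : ∀ z, φ z • (F z - F' z) = F z * φ z - F' z * φ z := fun z => by
        rw [smul_eq_mul]
        ring
      simp only [h1]
      rw [integral_sub (integrable_mul_test hφ F) (integrable_mul_test hφ F'), sub_eq_zero,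
        ← neg_inj, ← h φ hφ, ← h' φ hφ]
  refine Lp.ext ?_
  filter_upwards [(ae_restrict_iff' (isOpen_cyl hΩ).measurableSet).2 hae] with z hz
  exact sub_eq_zero.1 hz

theorem HasDivTX.divTX_eq (hΩ : IsOpen Ω) {v : L2Q T Ω × L2Qd T Ω} {F : L2Q T Ω}
    (h : HasDivTX v F) : divTX v = F := by
  have hex : ∃ F : L2Q T Ω, HasDivTX v F := ⟨F, h⟩
  rw [divTX, dif_pos hex]
  exact hex.choose_spec.unique hΩ h

theorem IsTimeRep.add {v v' : L2Q T Ω} {w w' : ℝ → L2Om Ω} (h : IsTimeRep v w)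
    (h' : IsTimeRep v' w') : IsTimeRep (v + v') (fun t => w t + w' t) := by
  refine ⟨h.1.add h'.1, ?_⟩
  filter_upwards [h.2, h'.2, ae_ae_of_ae_cyl (Lp.coeFn_add v v')] with t h1 h2 h3
  filter_upwards [h1, h2, h3, Lp.coeFn_add (w t) (w' t)] with x h1 h2 h3 h4
  rw [h4, h3, Pi.add_apply, Pi.add_apply, h1, h2]

theorem IsTimeRep.smul {v : L2Q T Ω} {w : ℝ → L2Om Ω} (h : IsTimeRep v w) (c : ℝ) :
    IsTimeRep (c • v) (fun t => c • w t) := by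
  refine ⟨h.1.const_smul c, ?_⟩
  filter_upwards [h.2, ae_ae_of_ae_cyl (Lp.coeFn_smul c v)] with t h1 h3
  filter_upwards [h1, h3, Lp.coeFn_smul c (w t)] with x h1 h3 h4
  rw [h4, h3, Pi.smul_apply, Pi.smul_apply, h1]

theorem IsTimeRep.timeRep {v : L2Q T Ω} {w : ℝ → L2Om Ω} (h : IsTimeRep v w) :
    IsTimeRep v (timeRep v) := by
  have hex : ∃ w : ℝ → L2Om Ω, IsTimeRep v w := ⟨w, h⟩
  rw [FOSLS.timeRep, dif_pos hex]
  exact hex.choose_spec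

/-- `(v, τ) ∈ U` with `∇_x v = G`, `div_{t,x} (v, τ) = F` and time-continuous representative
`w`. -/
structure IsInU (v : L2Q T Ω) (τ : L2Qd T Ω) (F : L2Q T Ω) (G : L2Qd T Ω)
    (w : ℝ → L2Om Ω) : Prop where
  div : HasDivTX (v, τ) F
  grad : HasGradX v G
  rep : IsTimeRep v w

variable {v v' F F' : L2Q T Ω} {τ τ' G G' : L2Qd T Ω} {w w' : ℝ → L2Om Ω}

theorem IsInU.of_div_grad (hT : 0 < T) (h : HasDivTX (v, τ) F) (hG : HasGradX v G) :
    IsInU v τ F G (timeRep v) := by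
  obtain ⟨w, hw, -⟩ := exists_timeRep_energy hT h hG
  exact ⟨h, hG, hw.timeRep⟩

theorem IsInU.add (h : IsInU v τ F G w) (h' : IsInU v' τ' F' G' w') :
    IsInU (v + v') (τ + τ') (F + F') (G + G') (fun t => w t + w' t) :=
  ⟨h.div.add h'.div, h.grad.add h'.grad, h.rep.add h'.rep⟩

theorem IsInU.smul (h : IsInU v τ F G w) (c : ℝ) :
    IsInU (c • v) (c • τ) (c • F) (c • G) (fun t => c • w t) :=
  ⟨h.div.smul c, h.grad.smul c, h.rep.smul c⟩

theorem IsInU.sub (h : IsInU v τ F G w) (h' : IsInU v' τ' F' G' w') :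
    IsInU (v - v') (τ - τ') (F - F') (G - G') (fun t => w t - w' t) := by
  simpa only [neg_smul, one_smul, ← sub_eq_add_neg] using h.add (h'.smul (-1))

theorem IsInU.mem_spaceU (h : IsInU v τ F G w) : (v, τ) ∈ spaceU T Ω := ⟨⟨F, h.div⟩, ⟨G, h.grad⟩⟩

theorem isInU_of_mem_spaceU (hΩ : IsOpen Ω) (hT : 0 < T) {u : L2Q T Ω × L2Qd T Ω}
    (hu : u ∈ spaceU T Ω) : IsInU u.1 u.2 (divTX u) (gradX u.1) (timeRep u.1) := by
  obtain ⟨⟨F, hF⟩, ⟨G, hG⟩⟩ := hu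
  rw [hF.divTX_eq hΩ, hG.gradX_eq hΩ]
  exact IsInU.of_div_grad hT hF hG

theorem integrable_energy (F v : L2Q T Ω) (τ G : L2Qd T Ω) :
    IntegrableOn (fun z => F z * v z + ⟪τ z, G z⟫) (cyl T Ω) := by
  refine Integrable.add ?_ (integrable_inner_of_memLp (Lp.memLp τ) (Lp.memLp G))
  exact (Lp.memLp F).integrable_mul (Lp.memLp v)

theorem IsInU.energy (hT : 0 < T) (h : IsInU v τ F G w) {s t : ℝ} (hs : s ∈ Icc 0 T)
    (ht : t ∈ Icc 0 T) : ‖w t‖ ^ 2 - ‖w s‖ ^ 2 =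
      2 * ∫ r in s..t, ∫ x in Ω, (F (r, x) * v (r, x) + ⟪τ (r, x), G (r, x)⟫) := by
  obtain ⟨w', hw', he⟩ := exists_timeRep_energy hT h.div h.grad
  rw [h.rep.eqOn hT hw' hs, h.rep.eqOn hT hw' ht]
  exact he s hs t ht

theorem IsInU.energy_total (hT : 0 < T) (h : IsInU v τ F G w) :
    ‖w T‖ ^ 2 - ‖w 0‖ ^ 2 = 2 * (⟪F, v⟫ + ⟪τ, G⟫) := by
  rw [h.energy hT (left_mem_Icc.2 hT.le) (right_mem_Icc.2 hT.le),
    intervalIntegral.integral_of_le hT.le, integral_Ioc_eq_integral_Ioo,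
    ← setIntegral_cyl (integrable_energy F v τ G), L2.inner_def, L2.inner_def, ← integral_add]
  · simp only [RCLike.inner_apply, conj_trivial, mul_comm]
  · exact integrable_inner_of_memLp (Lp.memLp F) (Lp.memLp v)
  · exact integrable_inner_of_memLp (Lp.memLp τ) (Lp.memLp G)

/-- Integration by parts in time for two elements of `U`. -/
theorem IsInU.green (hT : 0 < T) (h : IsInU v τ F G w) (h' : IsInU v' τ' F' G' w') :
    ⟪w T, w' T⟫ - ⟪w 0, w' 0⟫ = ⟪F, v'⟫ + ⟪F', v⟫ + ⟪τ, G'⟫ + ⟪τ', G⟫ := by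
  have h1 := (h.add h').energy_total hT
  have h2 := h.energy_total hT
  have h3 := h'.energy_total hT
  simp only [norm_add_sq_real, inner_add_left, inner_add_right] at h1
  linarith

theorem IsInU.energy_le (hT : 0 < T) (h : IsInU v τ F G w) {s t : ℝ} (hs : s ∈ Icc 0 T)
    (ht : t ∈ Icc 0 T) : ‖w t‖ ^ 2 - ‖w s‖ ^ 2 ≤ 2 * (‖F‖ * ‖v‖ + ‖τ‖ * ‖G‖) := by
  rw [h.energy hT hs ht]
  refine mul_le_mul_of_nonneg_left ((le_abs_self _).trans ?_) two_pos.le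
  have hi := integrable_energy F v τ G
  have hi' := hi.norm
  have hint := (integrable_prod_of_cyl hi).integral_norm_prod_left
  have hsub : uIoc s t ⊆ Icc 0 T :=
    uIoc_subset_uIcc.trans (ordConnected_Icc.uIcc_subset hs ht)
  have h1 : IntegrableOn (fun r => ∫ x in Ω, ‖F (r, x) * v (r, x) + ⟪τ (r, x), G (r, x)⟫‖)
      (Icc 0 T) := by
    rwa [integrableOn_Icc_iff_integrableOn_Ioo]
  rw [← Real.norm_eq_abs]
  refine intervalIntegral.norm_integral_le_integral_norm_uIoc.trans ?_
  calc ∫ r in uIoc s t, ‖∫ x in Ω, (F (r, x) * v (r, x) + ⟪τ (r, x), G (r, x)⟫)‖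
      ≤ ∫ r in uIoc s t, ∫ x in Ω, ‖F (r, x) * v (r, x) + ⟪τ (r, x), G (r, x)⟫‖ :=
        integral_mono_of_nonneg (Eventually.of_forall fun _ => norm_nonneg _)
          (h1.mono_set hsub) (Eventually.of_forall fun _ => norm_integral_le_integral_norm _)
    _ ≤ ∫ r in Icc 0 T, ∫ x in Ω, ‖F (r, x) * v (r, x) + ⟪τ (r, x), G (r, x)⟫‖ :=
        setIntegral_mono_set h1 (Eventually.of_forall fun _ =>
          integral_nonneg fun _ => norm_nonneg _) hsub.eventuallyLE
    _ = ∫ z in cyl T Ω, ‖F z * v z + ⟪τ z, G z⟫‖ := by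
        rw [setIntegral_cyl hi', integral_Icc_eq_integral_Ioo]
    _ ≤ ∫ z in cyl T Ω, (‖F z‖ * ‖v z‖ + ‖τ z‖ * ‖G z‖) := by
        refine integral_mono hi' ((integrable_norm_mul_norm (Lp.memLp F) (Lp.memLp v)).add
          (integrable_norm_mul_norm (Lp.memLp τ) (Lp.memLp G))) fun z => ?_
        refine (norm_add_le _ _).trans (add_le_add (norm_mul_le _ _) (norm_inner_le_norm _ _))
    _ ≤ ‖F‖ * ‖v‖ + ‖τ‖ * ‖G‖ := by
        rw [integral_add (integrable_norm_mul_norm (Lp.memLp F) (Lp.memLp v))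
          (integrable_norm_mul_norm (Lp.memLp τ) (Lp.memLp G))]
        exact add_le_add (integral_norm_mul_norm_le (Lp.memLp F) (Lp.memLp v))
          (integral_norm_mul_norm_le (Lp.memLp τ) (Lp.memLp G))

theorem IsTimeRep.integral_norm_sq (hT : 0 < T) (h : IsTimeRep v w) :
    ∫ t in (0 : ℝ)..T, ‖w t‖ ^ 2 = ‖v‖ ^ 2 := by
  rw [← real_inner_self_eq_norm_sq v, L2.inner_def,
    setIntegral_cyl (integrable_inner_of_memLp (Lp.memLp v) (Lp.memLp v)),
    intervalIntegral.integral_of_le hT.le, integral_Ioc_eq_integral_Ioo]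
  refine integral_congr_ae ?_
  filter_upwards [h.2] with t ht
  rw [← real_inner_self_eq_norm_sq (w t), L2_inner_eq_integral ht ht]

/-- The bound of the maximum over time, including the value at the initial time, by quantities
on `Q`: the energy identity is averaged over its starting time. -/
theorem IsInU.norm_sq_le (hT : 0 < T) (h : IsInU v τ F G w) {t : ℝ} (ht : t ∈ Icc 0 T) :
    ‖w t‖ ^ 2 ≤ T⁻¹ * ‖v‖ ^ 2 + 2 * (‖F‖ * ‖v‖ + ‖τ‖ * ‖G‖) := by
  have h1 := mul_le_integral_add_of_sub_le (y := fun t => ‖w t‖ ^ 2) hT.le (h.rep.1.norm.pow 2)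
    (fun s hs t ht => h.energy_le hT hs ht) ht
  rw [h.rep.integral_norm_sq hT, sub_zero] at h1
  have h2 : T * (T⁻¹ * ‖v‖ ^ 2) = ‖v‖ ^ 2 := by field_simp
  refine le_of_mul_le_mul_left ?_ hT
  rw [mul_add, h2]
  exact h1

/-- The Poincaré–Friedrichs inequality in `L²(I; H₀¹(Ω))`, with the constant of `H₀¹(Ω)`. -/
theorem HasGradX.poincare {C : ℝ} (hC0 : 0 < C)
    (hC : ∀ p ∈ h10 Ω, ‖p.fst‖ ≤ C * ‖p.snd‖) (h : HasGradX v G) : ‖v‖ ≤ C * ‖G‖ := by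
  have hvi := integrable_inner_of_memLp (Lp.memLp v) (Lp.memLp v)
  have hGi := integrable_inner_of_memLp (Lp.memLp G) (Lp.memLp G)
  have hvi' := integrable_prod_of_cyl hvi
  have hGi' := integrable_prod_of_cyl hGi
  have h1 : ‖v‖ ^ 2 ≤ C ^ 2 * ‖G‖ ^ 2 := by
    rw [← real_inner_self_eq_norm_sq v, ← real_inner_self_eq_norm_sq G, L2.inner_def,
      L2.inner_def, setIntegral_cyl hvi, setIntegral_cyl hGi, ← integral_const_mul]
    refine integral_mono_ae hvi'.integral_prod_left (hGi'.integral_prod_left.const_mul _) ?_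
    filter_upwards [h] with t ht
    obtain ⟨p, hp, h1, h2⟩ := ht.exists_pair
    rw [← L2_inner_eq_integral h1 h1, ← L2_inner_eq_integral h2 h2, real_inner_self_eq_norm_sq,
      real_inner_self_eq_norm_sq, ← mul_pow]
    exact pow_le_pow_left₀ (norm_nonneg _) (hC p hp) 2
  rw [← mul_pow] at h1
  exact le_of_sq_le_sq h1 (by positivity)

end Linear

/-! ### Tensor products and test functions as elements of `U` -/

section Tensors

variable {d : ℕ} {T : ℝ} {Ω : Set (Sp d)}

theorem memLp_tensor {E : Type*} [NormedAddCommGroup E] [NormedSpace ℝ E] {p : ℝ → ℝ}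
    {b : Sp d → E} (hp : MemLp p 2 (volume.restrict (Ioo 0 T)))
    (hb : MemLp b 2 (volume.restrict Ω)) :
    MemLp (fun z : ℝ × Sp d => p z.1 • b z.2) 2 (volume.restrict (cyl T Ω)) := by
  rw [restrict_cyl]
  have hm : AEStronglyMeasurable (fun z : ℝ × Sp d => p z.1 • b z.2)
      ((volume.restrict (Ioo 0 T)).prod (volume.restrict Ω)) := hp.1.comp_fst.smul hb.1.comp_snd
  rw [memLp_two_iff_integrable_sq_norm hm]
  refine (((memLp_two_iff_integrable_sq_norm hp.1).1 hp).mul_prod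
    ((memLp_two_iff_integrable_sq_norm hb.1).1 hb)).congr (Eventually.of_forall fun z => ?_)
  simp only [norm_smul, mul_pow]

/-- The element `p ⊗ b` of `L²(Q; E)`. -/
def tensor {E : Type*} [NormedAddCommGroup E] [NormedSpace ℝ E] {p : ℝ → ℝ}
    {b : Sp d → E} (hp : MemLp p 2 (volume.restrict (Ioo 0 T)))
    (hb : MemLp b 2 (volume.restrict Ω)) : Lp E 2 (volume.restrict (cyl T Ω)) :=
  (memLp_tensor hp hb).toLp

theorem tensor_coeFn {E : Type*} [NormedAddCommGroup E] [NormedSpace ℝ E] {p : ℝ → ℝ}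
    {b : Sp d → E} (hp : MemLp p 2 (volume.restrict (Ioo 0 T)))
    (hb : MemLp b 2 (volume.restrict Ω)) :
    tensor hp hb =ᵐ[volume.restrict (cyl T Ω)] fun z => p z.1 • b z.2 :=
  (memLp_tensor hp hb).coeFn_toLp

theorem IsTest.slice {φ : ℝ × Sp d → ℝ} (hφ : IsTest (cyl T Ω) φ) (t : ℝ) :
    IsTest Ω fun x => φ (t, x) := by
  have hsub : tsupport (fun x => φ (t, x)) ⊆ Prod.mk t ⁻¹' tsupport φ :=
    tsupport_comp_subset_preimage φ (by fun_prop)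
  refine ⟨hφ.1.comp (contDiff_const.prodMk contDiff_id), ?_, fun x hx => (hφ.2.2 (hsub hx)).2⟩
  refine (hφ.2.1.isCompact.image continuous_snd).of_isClosed_subset (isClosed_tsupport _)
    fun x hx => ⟨(t, x), hsub hx, rfl⟩

theorem fderiv_slice {φ : ℝ × Sp d → ℝ} (hφ : IsTest (cyl T Ω) φ) (t : ℝ) (x β : Sp d) :
    fderiv ℝ (fun x => φ (t, x)) x β = fderiv ℝ φ (t, x) (0, β) := by
  have h : HasFDerivAt (fun x : Sp d => φ (t, x))
      ((fderiv ℝ φ (t, x)).comp (ContinuousLinearMap.inr ℝ ℝ (Sp d))) x :=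
    (hφ.differentiable (t, x)).hasFDerivAt.comp x (hasFDerivAt_prodMk_right t x)
  rw [h.fderiv]
  rfl

theorem hasDerivAt_slice {φ : ℝ × Sp d → ℝ} (hφ : IsTest (cyl T Ω) φ) (t : ℝ) (x : Sp d) :
    HasDerivAt (fun t => φ (t, x)) (fderiv ℝ φ (t, x) (1, 0)) t := by
  have h : HasFDerivAt (fun t : ℝ => φ (t, x))
      ((fderiv ℝ φ (t, x)).comp (ContinuousLinearMap.inl ℝ ℝ (Sp d))) t :=
    (hφ.differentiable (t, x)).hasFDerivAt.comp t (hasFDerivAt_prodMk_left t x)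
  exact h.hasDerivAt

theorem hasDivTX_congr {v : L2Q T Ω} {τ : L2Qd T Ω} {F : L2Q T Ω} {v₀ F₀ : ℝ × Sp d → ℝ}
    {τ₀ : ℝ × Sp d → Sp d} (hv : v =ᵐ[volume.restrict (cyl T Ω)] v₀)
    (hτ : τ =ᵐ[volume.restrict (cyl T Ω)] τ₀) (hF : F =ᵐ[volume.restrict (cyl T Ω)] F₀)
    (h : ∀ φ : ℝ × Sp d → ℝ, IsTest (cyl T Ω) φ →
      IntegrableOn (fun z => fderiv ℝ φ z (v₀ z, τ₀ z)) (cyl T Ω) →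
      IntegrableOn (fun z => F₀ z * φ z) (cyl T Ω) →
      ∫ z in cyl T Ω, fderiv ℝ φ z (v₀ z, τ₀ z) = -∫ z in cyl T Ω, F₀ z * φ z) :
    HasDivTX (v, τ) F := by
  intro φ hφ
  have h1 : (fun z => fderiv ℝ φ z (v z, τ z)) =ᵐ[volume.restrict (cyl T Ω)]
      fun z => fderiv ℝ φ z (v₀ z, τ₀ z) := by
    filter_upwards [hv, hτ] with z h1 h2
    rw [h1, h2]
  have h2 : (fun z => F z * φ z) =ᵐ[volume.restrict (cyl T Ω)] fun z => F₀ z * φ z := by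
    filter_upwards [hF] with z h1
    rw [h1]
  rw [integral_congr_ae h1, integral_congr_ae h2]
  exact h φ hφ ((integrable_fderiv_test hφ (v, τ)).congr h1) ((integrable_mul_test hφ F).congr h2)

/-- If `div_x b = g` on `Ω`, then `div_{t,x} (0, p ⊗ b) = p ⊗ g` on `Q`. -/
theorem hasDivTX_tensor_flux {p : ℝ → ℝ} {b : Sp d → Sp d} {g : Sp d → ℝ}
    (hp : MemLp p 2 (volume.restrict (Ioo 0 T))) (hb : MemLp b 2 (volume.restrict Ω))
    (hg : MemLp g 2 (volume.restrict Ω))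
    (hdiv : ∀ φ : Sp d → ℝ, IsTest Ω φ →
      ∫ x in Ω, fderiv ℝ φ x (b x) = -∫ x in Ω, g x * φ x) :
    HasDivTX ((0 : L2Q T Ω), tensor hp hb) (tensor hp hg) := by
  refine hasDivTX_congr (Lp.coeFn_zero _ _ _) (tensor_coeFn hp hb) (tensor_coeFn hp hg)
    fun φ hφ hi hi' => ?_
  rw [setIntegral_cyl hi, setIntegral_cyl hi', ← integral_neg]
  refine integral_congr_ae (Eventually.of_forall fun t => ?_)
  have h1 : ∀ x, fderiv ℝ φ (t, x) (0, p t • b x) =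
      p t * fderiv ℝ (fun x => φ (t, x)) x (b x) := fun x => by
    rw [← fderiv_slice hφ, map_smul, smul_eq_mul]
  have h2 : ∀ x, p t • g x * φ (t, x) = p t * (g x * φ (t, x)) := fun x => by
    rw [smul_eq_mul, mul_assoc]
  simp only [Pi.zero_apply, h1, h2, integral_const_mul]
  rw [hdiv _ (hφ.slice t), mul_neg]

/-- If `p` is continuous and differentiable off a countable set, with square integrable derivative
`p'`, then `div_{t,x} (p ⊗ w, 0) = p' ⊗ w` on `Q`. -/
theorem hasDivTX_tensor_scalar (hT : 0 < T) {p p' : ℝ → ℝ} {w : Sp d → ℝ} {S : Set ℝ}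
    (hS : S.Countable) (hpc : ContinuousOn p (Icc 0 T))
    (hd : ∀ t ∈ Ioo 0 T \ S, HasDerivAt p (p' t) t)
    (hp : MemLp p 2 (volume.restrict (Ioo 0 T))) (hp' : MemLp p' 2 (volume.restrict (Ioo 0 T)))
    (hw : MemLp w 2 (volume.restrict Ω)) :
    HasDivTX (tensor hp hw, (0 : L2Qd T Ω)) (tensor hp' hw) := by
  refine hasDivTX_congr (tensor_coeFn hp hw) (Lp.coeFn_zero _ _ _) (tensor_coeFn hp' hw)
    fun φ hφ hi hi' => ?_
  rw [eq_neg_iff_add_eq_zero, ← integral_add hi hi']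
  have hi2 := hi.add hi'
  have hi3 := integrable_prod_of_cyl hi2
  have hswap := (setIntegral_cyl hi2).trans (integral_integral_swap (f := fun t x =>
    ((fun z : ℝ × Sp d => fderiv ℝ φ z (p z.1 • w z.2, (0 : ℝ × Sp d → Sp d) z)) +
      fun z : ℝ × Sp d => (p' z.1 • w z.2) * φ z) (t, x)) hi3)
  refine hswap.trans ?_
  refine (integral_congr_ae (g := fun _ => (0 : ℝ)) (Eventually.of_forall fun x => ?_)).trans
    (integral_zero _ _)
  have hφc := hφ.1.continuous
  have hφd : Continuous fun t => fderiv ℝ φ (t, x) (1, 0) :=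
    (hφ.continuous_fderiv.comp (by fun_prop : Continuous fun t : ℝ => (t, x))).clm_apply
      continuous_const
  have h1 : ∀ t, ((fun z : ℝ × Sp d => fderiv ℝ φ z (p z.1 • w z.2, (0 : ℝ × Sp d → Sp d) z)) +
      fun z : ℝ × Sp d => (p' z.1 • w z.2) * φ z) (t, x) =
      w x * (p' t * φ (t, x) + p t * fderiv ℝ φ (t, x) (1, 0)) := fun t => by
    have h2 : ((p t • w x, (0 : Sp d)) : ℝ × Sp d) = (p t * w x) • (1, 0) := by simp
    simp only [Pi.add_apply, Pi.zero_apply]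
    rw [h2, map_smul, smul_eq_mul, smul_eq_mul]
    ring
  simp only [h1, integral_const_mul]
  have hb : ∀ {g : ℝ → ℝ}, Continuous g → MemLp g 2 (volume.restrict (Ioo 0 T)) := fun {g} hg => by
    obtain ⟨C, hC⟩ := isCompact_Icc.exists_bound_of_continuousOn (hg.continuousOn (s := Icc 0 T))
    exact MemLp.of_bound hg.aestronglyMeasurable C ((ae_restrict_mem measurableSet_Ioo).mono
      fun t ht => hC t (Ioo_subset_Icc_self ht))
  have hint : Integrable (fun t => p' t * φ (t, x) + p t * fderiv ℝ φ (t, x) (1, 0))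
      (volume.restrict (Ioo 0 T)) :=
    (hp'.integrable_mul (hb (by fun_prop : Continuous fun t => φ (t, x)))).add
      (hp.integrable_mul (hb hφd))
  have hftc := integral_eq_of_hasDerivAt_off_countable (fun t => p t * φ (t, x))
    (fun t => p' t * φ (t, x) + p t * fderiv ℝ φ (t, x) (1, 0)) (a := 0) (b := T) hS
    (by
      rw [uIcc_of_le hT.le]
      exact hpc.mul (by fun_prop))
    (fun t ht => by
      rw [min_eq_left hT.le, max_eq_right hT.le] at ht
      exact (hd t ht).mul (hasDerivAt_slice hφ t x))
    (by
      rw [intervalIntegrable_iff_integrableOn_Ioo_of_le hT.le]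
      exact hint)
  rw [intervalIntegral.integral_of_le hT.le, integral_Ioc_eq_integral_Ioo] at hftc
  have h0 : φ (0, x) = 0 := hφ.eq_zero fun h => lt_irrefl _ h.1.1
  have hTx : φ (T, x) = 0 := hφ.eq_zero fun h => lt_irrefl _ h.1.2
  rw [hftc, h0, hTx]
  simp

theorem hasGradX_tensor {p : ℝ → ℝ} {w : Sp d → ℝ} {g : Sp d → Sp d}
    (hp : MemLp p 2 (volume.restrict (Ioo 0 T))) (hwg : HasH10Grad Ω w g) :
    HasGradX (tensor hp hwg.1) (tensor hp hwg.2.1) := by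
  filter_upwards [ae_ae_of_ae_cyl (tensor_coeFn hp hwg.1),
    ae_ae_of_ae_cyl (tensor_coeFn hp hwg.2.1)] with t h1 h2
  exact (hwg.const_smul (p t)).congr (by filter_upwards [h1] with x hx using hx.symm)
    (by filter_upwards [h2] with x hx using hx.symm)

theorem isTimeRep_tensor {p : ℝ → ℝ} {w : Sp d → ℝ} (hpc : ContinuousOn p (Icc 0 T))
    (hp : MemLp p 2 (volume.restrict (Ioo 0 T))) (hw : MemLp w 2 (volume.restrict Ω)) :
    IsTimeRep (tensor hp hw) (fun t => p t • hw.toLp w) := by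
  refine ⟨hpc.smul continuousOn_const, ?_⟩
  filter_upwards [ae_ae_of_ae_cyl (tensor_coeFn hp hw)] with t h1
  filter_upwards [h1, Lp.coeFn_smul (p t) (hw.toLp w), hw.coeFn_toLp] with x h1 h2 h3
  rw [h1, h2, Pi.smul_apply, h3]

theorem HasGradX.zero : HasGradX (0 : L2Q T Ω) (0 : L2Qd T Ω) := by
  filter_upwards [ae_ae_of_ae_cyl (Lp.coeFn_zero ℝ 2 (volume.restrict (cyl T Ω))),
    ae_ae_of_ae_cyl (Lp.coeFn_zero (Sp d) 2 (volume.restrict (cyl T Ω)))] with t h1 h2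
  refine (IsTest.zero.hasH10Grad).congr ?_ ?_
  · filter_upwards [h1] with x hx
    rw [hx, Pi.zero_apply]
  · filter_upwards [h2] with x hx
    rw [hx, Pi.zero_apply]
    simp [gradient]

theorem HasDivTX.zero : HasDivTX ((0 : L2Q T Ω), (0 : L2Qd T Ω)) 0 := by
  refine hasDivTX_congr (Lp.coeFn_zero _ _ _) (Lp.coeFn_zero _ _ _) (Lp.coeFn_zero _ _ _)
    fun φ _ _ _ => ?_
  have : ∀ z : ℝ × Sp d, fderiv ℝ φ z ((0 : ℝ × Sp d → ℝ) z, (0 : ℝ × Sp d → Sp d) z) = 0 :=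
    fun z => map_zero _
  simp only [this]
  simp

theorem IsTimeRep.zero : IsTimeRep (0 : L2Q T Ω) 0 := by
  refine ⟨continuousOn_const, ?_⟩
  filter_upwards [ae_ae_of_ae_cyl (Lp.coeFn_zero ℝ 2 (volume.restrict (cyl T Ω)))] with t h1
  filter_upwards [h1, Lp.coeFn_zero ℝ 2 (volume.restrict Ω)] with x h1 h2
  exact h2.trans h1.symm

/-- Test functions of the cylinder, with zero flux, are elements of `U` which vanish at the
initial time. -/
theorem IsTest.exists_isInU (hT : 0 < T) {φ : ℝ × Sp d → ℝ} (hφ : IsTest (cyl T Ω) φ) :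
    ∃ (v F : L2Q T Ω) (G : L2Qd T Ω) (w : ℝ → L2Om Ω), IsInU v 0 F G w ∧ w 0 = 0 ∧
      F =ᵐ[volume.restrict (cyl T Ω)] (fun z => fderiv ℝ φ z (1, 0)) ∧
      ∀ᵐ z ∂(volume.restrict (cyl T Ω)), ∀ β, ⟪β, G z⟫ = fderiv ℝ φ z (0, β) := by
  have hv : MemLp φ 2 (volume.restrict (cyl T Ω)) := hφ.memLp _
  have hFc : Continuous fun z => fderiv ℝ φ z (1, 0) :=
    hφ.continuous_fderiv.clm_apply continuous_const
  have hF : MemLp (fun z => fderiv ℝ φ z (1, 0)) 2 (volume.restrict (cyl T Ω)) :=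
    hFc.memLp_of_hasCompactSupport (hφ.2.1.fderiv_apply ℝ _)
  set g : ℝ × Sp d → Sp d := fun z => gradient (fun x => φ (z.1, x)) z.2 with hg
  have hgz : ∀ z β, ⟪β, g z⟫ = fderiv ℝ φ z (0, β) := fun z β => by
    rw [real_inner_comm, hg, inner_gradient_eq, fderiv_slice hφ]
  have hg' : g = fun z => (InnerProductSpace.toDual ℝ (Sp d)).symm
      ((fderiv ℝ φ z).comp (ContinuousLinearMap.inr ℝ ℝ (Sp d))) := by
    ext1 z
    refine ext_inner_left ℝ fun β => ?_
    rw [hgz, real_inner_comm, InnerProductSpace.toDual_symm_apply]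
    rfl
  have hgc : Continuous g := by
    rw [hg']
    exact (InnerProductSpace.toDual ℝ (Sp d)).symm.continuous.comp
      (hφ.continuous_fderiv.clm_comp continuous_const)
  have hgs : HasCompactSupport g := by
    refine HasCompactSupport.intro hφ.2.1.isCompact fun z hz => ?_
    refine ext_inner_left ℝ fun β => ?_
    rw [hgz, image_eq_zero_of_notMem_tsupport fun h => hz (tsupport_fderiv_subset ℝ h)]
    simp
  have hG : MemLp g 2 (volume.restrict (cyl T Ω)) := hgc.memLp_of_hasCompactSupport hgs
  have hdiv : HasDivTX (hv.toLp, (0 : L2Qd T Ω)) hF.toLp := by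
    refine hasDivTX_congr hv.coeFn_toLp (Lp.coeFn_zero _ _ _) hF.coeFn_toLp
      fun ψ hψ _ _ => ?_
    have h1 : ∀ z, fderiv ℝ ψ z (φ z, (0 : ℝ × Sp d → Sp d) z) = φ z * fderiv ℝ ψ z (1, 0) :=
      fun z => by
        have h2 : ((φ z, (0 : Sp d)) : ℝ × Sp d) = φ z • (1, 0) := by simp
        rw [Pi.zero_apply, h2, map_smul, smul_eq_mul]
    have h3 := hφ.setIntegral_eq (μ := volume) (fun z => fderiv ℝ ψ z (1, 0))
    have h4 := hψ.setIntegral_eq (μ := volume) (fun z => fderiv ℝ φ z (1, 0))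
    simp only [smul_eq_mul] at h3 h4
    have hi : ∀ {u v : ℝ × Sp d → ℝ}, IsTest (cyl T Ω) u → IsTest (cyl T Ω) v →
        Integrable fun z => u z * fderiv ℝ v z (1, 0) := fun hu hv =>
      (hu.1.continuous.mul (hv.continuous_fderiv.clm_apply continuous_const)
        ).integrable_of_hasCompactSupport hu.2.1.mul_right
    simp only [h1, mul_comm (fderiv ℝ φ _ _)]
    have : (volume : Measure (ℝ × Sp d)).IsAddHaarMeasure := by
      rw [Measure.volume_eq_prod]
      infer_instance
    rw [h3, h4, integral_mul_fderiv_eq_neg_fderiv_mul_of_integrable]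
    · simp only [mul_comm]
    · simpa only [mul_comm] using hi hψ hφ
    · exact hi hφ hψ
    · exact (hφ.1.continuous.mul hψ.1.continuous).integrable_of_hasCompactSupport hφ.2.1.mul_right
    · exact fun x _ => hφ.differentiable x
    · exact fun x _ => hψ.differentiable x
  have hgrad : HasGradX hv.toLp hG.toLp := by
    filter_upwards [ae_ae_of_ae_cyl hv.coeFn_toLp, ae_ae_of_ae_cyl hG.coeFn_toLp] with t h1 h2
    exact ((hφ.slice t).hasH10Grad).congr (by filter_upwards [h1] with x hx using hx.symm)
      (by filter_upwards [h2] with x hx using hx.symm)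
  have hU := IsInU.of_div_grad hT hdiv hgrad
  refine ⟨_, _, _, _, hU, ?_, hF.coeFn_toLp, ?_⟩
  · -- the support of `φ` stays away from the initial time
    have hcl : IsClosed (Prod.fst '' tsupport φ) :=
      (hφ.2.1.isCompact.image continuous_fst).isClosed
    have h0 : (Prod.fst '' tsupport φ)ᶜ ∈ 𝓝 (0 : ℝ) := hcl.isOpen_compl.mem_nhds fun h => by
      obtain ⟨z, hz, hz0⟩ := h
      exact (hφ.2.2 hz).1.1.ne' hz0
    obtain ⟨ε, hε, hball⟩ := Metric.mem_nhds_iff.1 h0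
    have hmin : 0 < min (ε / 2) T := lt_min (by positivity) hT
    have heq := Measure.eqOn_Icc_of_ae_eq volume hmin.ne (f := timeRep hv.toLp)
      (g := fun _ => (0 : L2Om Ω)) ?_
      (hU.rep.1.mono (Icc_subset_Icc le_rfl (min_le_right _ _))) continuousOn_const
    · exact heq (left_mem_Icc.2 hmin.le)
    · rw [← Measure.restrict_congr_set Ioo_ae_eq_Icc]
      filter_upwards [ae_restrict_of_ae_restrict_of_subset
        (Ioo_subset_Ioo le_rfl (min_le_right _ _)) hU.rep.2, ae_restrict_of_ae_restrict_of_subset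
        (Ioo_subset_Ioo le_rfl (min_le_right _ _)) (ae_ae_of_ae_cyl hv.coeFn_toLp),
        ae_restrict_mem measurableSet_Ioo] with t h1 h2 ht
      refine Lp.ext ?_
      filter_upwards [h1, h2, Lp.coeFn_zero ℝ 2 (volume.restrict Ω)] with x h1 h2 h3
      rw [h1, h2, h3, Pi.zero_apply]
      refine image_eq_zero_of_notMem_tsupport fun h => hball ?_ ⟨(t, x), h, rfl⟩
      rw [Metric.mem_ball, Real.dist_eq, sub_zero, abs_of_pos ht.1]
      linarith [ht.2, min_le_left (ε / 2) T]
  · filter_upwards [hG.coeFn_toLp] with z hz β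
    rw [hz, hgz]

end Tensors

/-! ### Conformity of the discrete space -/

section Discrete

variable {d : ℕ} {T : ℝ} {Ω : Set (Sp d)}

theorem TimeMesh.exists_mem_elem (M : TimeMesh T) {t : ℝ} (ht : t ∈ Ioo 0 T \ range M.node) :
    ∃ i, t ∈ M.elem i := by
  by_contra! h
  have key : ∀ j, M.node j < t := by
    intro j
    induction j using Fin.induction with
    | zero => exact M.node_zero ▸ ht.1.1
    | succ i ih =>
      refine lt_of_le_of_ne (not_lt.1 fun hi => h i ⟨ih, hi⟩) fun he => ht.2 ⟨_, he⟩
  exact lt_asymm ht.1.2 (M.node_last ▸ key (Fin.last _))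

theorem TimeMesh.elem_subset (M : TimeMesh T) (i : Fin M.N) : M.elem i ⊆ Icc 0 T := fun _ ht =>
  ⟨M.node_zero ▸ (M.strictMono.monotone (Fin.zero_le _)).trans ht.1.le,
    M.node_last ▸ ht.2.le.trans (M.strictMono.monotone (Fin.le_last _))⟩

theorem memLp_of_mem_PTime {M : TimeMesh T} {k : ℕ} {p : ℝ → ℝ} (hp : p ∈ PTime M k) :
    MemLp p 2 (volume.restrict (Ioo 0 T)) := by
  choose q _ hq using hp
  have hb : ∀ i, ∃ C, ∀ t ∈ Icc 0 T, ‖(q i).eval t‖ ≤ C := fun i =>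
    isCompact_Icc.exists_bound_of_continuousOn (q i).continuous.continuousOn
  choose C hC using hb
  have hcov : ∀ᵐ t ∂(volume.restrict (Ioo 0 T)), ∃ i, t ∈ M.elem i := by
    filter_upwards [ae_restrict_mem measurableSet_Ioo,
      ((finite_range M.node).countable.ae_notMem _)] with t ht h
    exact M.exists_mem_elem ⟨ht, h⟩
  have hmeas : AEStronglyMeasurable p (volume.restrict (⋃ i, M.elem i)) := by
    refine aestronglyMeasurable_iUnion_iff.2 fun i => ?_
    refine (q i).continuous.aestronglyMeasurable.congr ?_
    filter_upwards [ae_restrict_mem (measurableSet_Ioo : MeasurableSet (M.elem i))] with t ht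
    exact (hq i t ht).symm
  have hmeas' : AEStronglyMeasurable p (volume.restrict (Ioo 0 T)) := by
    refine hmeas.mono_measure ?_
    rw [Measure.restrict_congr_set (s := Ioo 0 T) (t := Ioo 0 T ∩ ⋃ i, M.elem i)]
    · exact Measure.restrict_mono inter_subset_right le_rfl
    · rw [ae_restrict_iff' measurableSet_Ioo] at hcov
      filter_upwards [hcov] with t ht
      exact propext ⟨fun h => ⟨h, mem_iUnion.2 (ht h)⟩, fun h => h.1⟩
  refine MemLp.of_bound hmeas' (∑ i, |C i|) ?_
  filter_upwards [hcov] with t ⟨i, hi⟩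
  rw [hq i t hi]
  exact ((hC i t (M.elem_subset i hi)).trans (le_abs_self _)).trans
    (Finset.single_le_sum (f := fun i => |C i|) (fun _ _ => abs_nonneg _) (Finset.mem_univ i))

theorem eventuallyEq_of_mem_elem {M : TimeMesh T} {p : ℝ → ℝ} {q : Polynomial ℝ} {i : Fin M.N}
    (hq : ∀ t ∈ M.elem i, p t = q.eval t) {t : ℝ} (ht : t ∈ M.elem i) :
    p =ᶠ[𝓝 t] fun t => q.eval t := by
  filter_upwards [isOpen_Ioo.mem_nhds ht] with s hs using hq s hs

/-- `PTime` prescribes no values at the nodes, where `p` need not be differentiable. -/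
theorem deriv_mem_PTime {M : TimeMesh T} {k : ℕ} {p : ℝ → ℝ} (hp : p ∈ PTime M k) :
    deriv p ∈ PTime M k := by
  intro i
  obtain ⟨q, hk, hq⟩ := hp i
  refine ⟨q.derivative, (q.natDegree_derivative_le.trans (Nat.sub_le _ _)).trans hk,
    fun t ht => ?_⟩
  rw [(eventuallyEq_of_mem_elem hq ht).deriv_eq, q.deriv]

theorem hasDerivAt_of_mem_PTime {M : TimeMesh T} {k : ℕ} {p : ℝ → ℝ} (hp : p ∈ PTime M k) {t : ℝ}
    (ht : t ∈ Ioo 0 T \ range M.node) : HasDerivAt p (deriv p t) t := by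
  obtain ⟨i, hi⟩ := M.exists_mem_elem ht
  obtain ⟨q, -, hq⟩ := hp i
  exact ((q.differentiableAt (x := t)).congr_of_eventuallyEq
    (eventuallyEq_of_mem_elem hq hi)).hasDerivAt

theorem add_mem_spaceU {a b : L2Q T Ω × L2Qd T Ω} (ha : a ∈ spaceU T Ω) (hb : b ∈ spaceU T Ω) :
    a + b ∈ spaceU T Ω := by
  obtain ⟨⟨F, hF⟩, G, hG⟩ := ha
  obtain ⟨⟨F', hF'⟩, G', hG'⟩ := hb
  exact ⟨⟨_, hF.add hF'⟩, ⟨_, hG.add hG'⟩⟩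

theorem sum_mem_spaceU {ι : Type*} (s : Finset ι) (v : ι → L2Q T Ω × L2Qd T Ω)
    (hv : ∀ i ∈ s, v i ∈ spaceU T Ω) : ∑ i ∈ s, v i ∈ spaceU T Ω := by
  exact Finset.sum_induction v (· ∈ spaceU T Ω) (fun _ _ => add_mem_spaceU)
    ⟨⟨0, .zero⟩, ⟨0, .zero⟩⟩ hv

theorem eq_sum_of_ae_eq {α E ι : Type*} [MeasurableSpace α] {μ : Measure α}
    [NormedAddCommGroup E] {s : Finset ι} {v : Lp E 2 μ} {w : ι → Lp E 2 μ} {f : ι → α → E}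
    (hw : ∀ i, w i =ᵐ[μ] f i) (hv : v =ᵐ[μ] fun x => ∑ i ∈ s, f i x) : v = ∑ i ∈ s, w i := by
  refine Lp.ext ?_
  have h1 : ∀ᵐ x ∂μ, ∀ i ∈ s, w i x = f i x :=
    (Finset.eventually_all s).2 fun i _ => hw i
  filter_upwards [hv, h1, Lp.coeFn_finsetSum s w] with x hx h1 h2
  rw [hx, h2, Finset.sum_apply]
  exact (Finset.sum_congr rfl h1).symm

/-- The discrete space is conforming. A product `p ⊗ w` has the classical time derivative
`p' ⊗ w` because `p` is continuous across the nodes, and `p ⊗ θ` has the divergence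
`p ⊗ div_x θ`. -/
theorem discU_subset_spaceU (hT : 0 < T) (Mt : TimeMesh T) (Mx : SpaceMesh Ω) (k ℓ : ℕ) :
    discU Mt Mx k ℓ ⊆ spaceU T Ω := by
  rintro ⟨v, τ⟩ ⟨⟨n, p, w, hp, hw, hv⟩, m, r, θ, hr, hθ, hτ⟩
  -- `g i` is the gradient of `w i`, and `b i` is the divergence of `θ i`
  choose g hg using fun i => (hw i).2.2
  choose b hb hdiv using fun i => (hθ i).1.2
  have hpL := fun i => memLp_of_mem_PTime (hp i).1
  have hrL := fun i => memLp_of_mem_PTime (hr i)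
  have h1 : v = ∑ i, tensor (hpL i) (hg i).1 :=
    eq_sum_of_ae_eq (fun i => tensor_coeFn (hpL i) (hg i).1) hv
  have h2 : τ = ∑ i, tensor (hrL i) (hθ i).1.1 :=
    eq_sum_of_ae_eq (fun i => tensor_coeFn (hrL i) (hθ i).1.1) hτ
  have h3 : (v, τ) = ∑ i, (tensor (hpL i) (hg i).1, (0 : L2Qd T Ω)) +
      ∑ i, ((0 : L2Q T Ω), tensor (hrL i) (hθ i).1.1) := by
    ext1 <;> simp [Prod.fst_sum, Prod.snd_sum, h1, h2]
  have h4 := sum_mem_spaceU Finset.univ (fun i => (tensor (hpL i) (hg i).1, (0 : L2Qd T Ω)))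
    fun i _ => ⟨⟨_, hasDivTX_tensor_scalar hT (finite_range Mt.node).countable (hp i).2
      (fun t ht => hasDerivAt_of_mem_PTime (hp i).1 ht) (hpL i)
      (memLp_of_mem_PTime (deriv_mem_PTime (hp i).1)) (hg i).1⟩,
        ⟨_, hasGradX_tensor (hpL i) (hg i)⟩⟩
  have h5 := sum_mem_spaceU Finset.univ (fun i => ((0 : L2Q T Ω), tensor (hrL i) (hθ i).1.1))
    fun i _ => ⟨⟨_, hasDivTX_tensor_flux (hrL i) (hθ i).1.1 (hb i) (hdiv i)⟩, ⟨_, .zero⟩⟩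
  rw [h3]
  exact add_mem_spaceU h4 h5

end Discrete

/-! ### The residual of the minimizer over `U` -/

section Residual

variable {d : ℕ} {T : ℝ} {Ω : Set (Sp d)}
variable {v v' F F' r : L2Q T Ω} {τ τ' G G' ρ : L2Qd T Ω} {w w' : ℝ → L2Om Ω}

theorem IsInU.lsq_eq (hΩ : IsOpen Ω) (hT : 0 < T) (h : IsInU v τ F G w) (f : L2Q T Ω)
    (u₀ : L2Om Ω) : lsq f u₀ (v, τ) = ‖F - f‖ ^ 2 + ‖G + τ‖ ^ 2 + ‖w 0 - u₀‖ ^ 2 := by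
  rw [lsq, h.div.divTX_eq hΩ, h.grad.gradX_eq hΩ,
    h.rep.timeRep.eqOn hT h.rep (left_mem_Icc.2 hT.le)]

theorem eq_zero_of_forall_le_quadratic {a b : ℝ} (h : ∀ s : ℝ, 0 ≤ 2 * s * a + s ^ 2 * b) :
    a = 0 := by
  have h1 := discrim_le_zero (a := b) (b := 2 * a) (c := 0) fun s => by
    have := h s
    nlinarith
  rw [discrim] at h1
  nlinarith [sq_nonneg a]

/-- The variational equations (normal equations) of the least-squares problem. -/
theorem IsLsqMin.residual_orthogonal (hΩ : IsOpen Ω) (hT : 0 < T) {f : L2Q T Ω} {u₀ : L2Om Ω}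
    {u : L2Q T Ω × L2Qd T Ω} (hu : IsLsqMin f u₀ (spaceU T Ω) u) (h : IsInU v τ F G w) :
    ⟪divTX u - f, F⟫ + ⟪gradX u.1 + u.2, G + τ⟫ + ⟪timeRep u.1 0 - u₀, w 0⟫ = 0 := by
  have hU := isInU_of_mem_spaceU hΩ hT hu.1
  -- the functional is compared at `u` and at `u + s (v, τ)`
  refine eq_zero_of_forall_le_quadratic (b := ‖F‖ ^ 2 + ‖G + τ‖ ^ 2 + ‖w 0‖ ^ 2) fun s => ?_
  have hs := hU.add (h.smul s)
  have hmin : lsq f u₀ (u.1, u.2) ≤ _ := hu.2 hs.mem_spaceU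
  rw [hs.lsq_eq hΩ hT, hU.lsq_eq hΩ hT] at hmin
  have e1 : divTX u + s • F - f = (divTX u - f) + s • F := by abel
  have e2 : gradX u.1 + s • G + (u.2 + s • τ) = (gradX u.1 + u.2) + s • (G + τ) := by
    rw [smul_add]
    abel
  have e3 : timeRep u.1 0 + s • w 0 - u₀ = (timeRep u.1 0 - u₀) + s • w 0 := by abel
  rw [e1, e2, e3, norm_add_sq_real (divTX u - f), norm_add_sq_real (gradX u.1 + u.2),
    norm_add_sq_real (timeRep u.1 0 - u₀)] at hmin
  simp only [inner_smul_right, norm_smul, mul_pow, Real.norm_eq_abs, sq_abs] at hmin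
  nlinarith

theorem memLp_indicator_one (J : Set ℝ) (hJ : MeasurableSet J) :
    MemLp (J.indicator fun _ => (1 : ℝ)) 2 (volume.restrict (Ioo 0 T)) :=
  (memLp_const 1).indicator hJ

/-- A pair `(r, ρ)` which is orthogonal to all pairs `(div_x τ, τ)` consists of an element of
`L²(I; H₀¹(Ω))` and its gradient: by testing with `(1_J ⊗ div_x b, 1_J ⊗ b)`, almost all time slices
are orthogonal to the orthogonal complement of `H₀¹(Ω)`, whose elements are the pairs
`(div_x b, b)`. -/
theorem hasGradX_of_orthogonal
    (h : ∀ τ F, HasDivTX ((0 : L2Q T Ω), τ) F → ⟪r, F⟫ + ⟪ρ, τ⟫ = 0) : HasGradX r ρ := by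
  obtain ⟨k, hk, hk'⟩ := exists_curry_pair (Lp.memLp r) (Lp.memLp ρ)
  have hki : Integrable k (volume.restrict (Ioo 0 T)) := hk.integrable one_le_two
  have hn : ∀ n ∈ (h10 Ω)ᗮ, ∀ J : Set ℝ, MeasurableSet J →
      ∫ t in J, ⟪n, k t⟫ ∂(volume.restrict (Ioo 0 T)) = 0 := fun n hn J hJ => by
    have hp := memLp_indicator_one (T := T) J hJ
    have ha := Lp.memLp n.fst
    have hb := Lp.memLp n.snd
    have hdiv := hasDivTX_tensor_flux hp hb ha fun φ hφ => by
      have h1 := (mem_h10_orthogonal_iff n).1 hn φ hφ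
      rw [L2Pair_inner_eq_integral hφ.toPair_fst hφ.toPair_snd ae_eq_rfl ae_eq_rfl,
        integral_add] at h1
      · simp only [inner_gradient_eq] at h1
        simp only [mul_comm (n.fst _)]
        linarith
      · exact (hφ.memLp (p := 2) _).integrable_mul ha
      · exact integrable_inner_of_memLp (hφ.memLp_gradient _) hb
    have h1 := h _ _ hdiv
    have hi1 := integrable_inner_of_memLp (Lp.memLp r) (memLp_tensor hp ha)
    have hi2 := integrable_inner_of_memLp (Lp.memLp ρ) (memLp_tensor hp hb)
    rw [L2_inner_eq_integral ae_eq_rfl (tensor_coeFn hp ha),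
      L2_inner_eq_integral ae_eq_rfl (tensor_coeFn hp hb), ← integral_add hi1 hi2] at h1
    have hsum := setIntegral_cyl (hi1.add hi2)
    simp only [Pi.add_apply] at hsum
    rw [hsum] at h1
    rw [← integral_indicator hJ]
    refine (integral_congr_ae ?_).trans h1
    filter_upwards [hk'] with t ht
    have h2 : ∀ x, ⟪r (t, x), J.indicator (fun _ => (1 : ℝ)) t • n.fst x⟫ +
        ⟪ρ (t, x), J.indicator (fun _ => (1 : ℝ)) t • n.snd x⟫ =
        J.indicator (fun _ => (1 : ℝ)) t * (n.fst x * r (t, x) + ⟪n.snd x, ρ (t, x)⟫) := fun x => by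
      rw [inner_smul_right, inner_smul_right, real_inner_comm (n.snd x), ← mul_add]
      simp
    simp only [h2, integral_const_mul]
    rw [← L2Pair_inner_eq_integral ae_eq_rfl ae_eq_rfl ht.1 ht.2]
    by_cases htJ : t ∈ J <;> simp [htJ]
  set P : L2Pair Ω →L[ℝ] L2Pair Ω := ((h10 Ω)ᗮ).starProjection with hP
  have hPk : Integrable (fun t => P (k t)) (volume.restrict (Ioo 0 T)) := P.integrable_comp hki
  have hz := hPk.ae_eq_zero_of_forall_setIntegral_eq_zero fun J hJ _ => by
    refine ext_inner_left ℝ fun n => ?_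
    rw [← integral_inner hPk.integrableOn, inner_zero_right]
    have h1 : ∀ t, ⟪n, P (k t)⟫ = ⟪P n, k t⟫ := fun t =>
      (Submodule.inner_starProjection_left_eq_right _ _ _).symm
    simp only [h1]
    exact hn _ (Submodule.starProjection_apply_mem _ _) J hJ
  filter_upwards [hz, hk'] with t h1 h2
  have h3 : k t ∈ (h10 Ω)ᗮᗮ := (Submodule.starProjection_apply_eq_zero_iff _).1 h1
  rw [Submodule.orthogonal_orthogonal] at h3
  exact ((mem_h10_iff _).1 h3).congr h2.1 h2.2

/-- A pair `(r, ρ)` which is orthogonal to all `(∂ₜv, ∇ₓv)` with `v(0) = 0` has vanishing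
space-time divergence. -/
theorem hasDivTX_zero_of_orthogonal (hT : 0 < T)
    (h : ∀ v F G w, IsInU v (0 : L2Qd T Ω) F G w → w 0 = 0 → ⟪r, F⟫ + ⟪ρ, G⟫ = 0) :
    HasDivTX (r, ρ) 0 := by
  refine hasDivTX_congr ae_eq_rfl ae_eq_rfl (Lp.coeFn_zero _ _ _) fun φ hφ _ _ => ?_
  obtain ⟨v, F, G, w, hv, hw, hF, hG⟩ := hφ.exists_isInU hT
  have h1 := h v F G w hv hw
  rw [L2.inner_def, L2.inner_def, ← integral_add
    (integrable_inner_of_memLp (Lp.memLp r) (Lp.memLp F))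
    (integrable_inner_of_memLp (Lp.memLp ρ) (Lp.memLp G))] at h1
  simp only [Pi.zero_apply, zero_mul, integral_zero, neg_zero]
  rw [← h1]
  refine integral_congr_ae ?_
  filter_upwards [hF, hG] with z h1 h2
  have h3 : ((r z, ρ z) : ℝ × Sp d) = r z • (1, 0) + (0, ρ z) := by simp
  rw [h3, map_add, map_smul, h2, h1]
  simp [mul_comm]

theorem eq_zero_of_inner_test (hΩ : IsOpen Ω) {b : L2Om Ω}
    (h : ∀ φ (hφ : IsTest Ω φ), ⟪b, (hφ.memLp (p := 2) (volume.restrict Ω)).toLp⟫ = 0) :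
    b = 0 := by
  have hloc : LocallyIntegrableOn b Ω volume :=
    locallyIntegrableOn_of_locallyIntegrable_restrict
      ((Lp.memLp b).locallyIntegrable (by norm_num))
  have hae := hΩ.ae_eq_zero_of_integral_contDiff_smul_eq_zero hloc fun φ hφ1 hφ2 hφ3 => by
    have hφ : IsTest Ω φ := ⟨hφ1, hφ2, hφ3⟩
    have h1 := h φ hφ
    rw [L2_inner_eq_integral ae_eq_rfl (hφ.memLp _).coeFn_toLp] at h1
    rw [← hφ.setIntegral_eq]
    simpa using h1
  refine Lp.ext ?_
  filter_upwards [(ae_restrict_iff' hΩ.measurableSet).2 hae, Lp.coeFn_zero ℝ 2 (volume.restrict Ω)]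
    with x h1 h2
  rw [h1, h2, Pi.zero_apply]

/-- The pair `(t ⊗ φ, 0)` as an element of `U`: it vanishes at the initial time, and its value at
the final time is `T φ`. -/
theorem IsTest.exists_isInU_linear (hT : 0 < T) {φ : Sp d → ℝ} (hφ : IsTest Ω φ) :
    ∃ (v F : L2Q T Ω) (G : L2Qd T Ω) (w : ℝ → L2Om Ω), IsInU v 0 F G w ∧ w 0 = 0 ∧
      w T = T • (hφ.memLp (p := 2) (volume.restrict Ω)).toLp := by
  have hp : MemLp (fun t : ℝ => t) 2 (volume.restrict (Ioo 0 T)) :=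
    MemLp.of_bound continuous_id.aestronglyMeasurable T
      ((ae_restrict_mem measurableSet_Ioo).mono fun t ht => by
        rw [Real.norm_eq_abs, abs_of_pos ht.1]
        exact ht.2.le)
  have hg := hφ.hasH10Grad
  refine ⟨_, _, _, _, ⟨hasDivTX_tensor_scalar hT countable_empty continuousOn_id
    (fun t _ => hasDerivAt_id t) hp (memLp_const 1) hg.1, hasGradX_tensor hp hg,
    isTimeRep_tensor continuousOn_id hp hg.1⟩, ?_, rfl⟩
  simp

/-- The minimum over the whole space is attained at the solution of the heat equation. The
residuals solve the homogeneous backward heat equation with zero terminal value, and hence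
vanish. -/
theorem IsLsqMin.divTX_eq (hΩ : IsOpen Ω) (hT : 0 < T) {C : ℝ} (hC0 : 0 < C)
    (hC : ∀ p ∈ h10 Ω, ‖p.fst‖ ≤ C * ‖p.snd‖) {f : L2Q T Ω} {u₀ : L2Om Ω}
    {u : L2Q T Ω × L2Qd T Ω} (hu : IsLsqMin f u₀ (spaceU T Ω) u) : divTX u = f := by
  set r := divTX u - f
  set ρ := gradX u.1 + u.2
  have horth : ∀ {v F τ G w}, IsInU v τ F G w →
      ⟪r, F⟫ + ⟪ρ, G + τ⟫ + ⟪timeRep u.1 0 - u₀, w 0⟫ = 0 := fun h =>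
    hu.residual_orthogonal hΩ hT h
  have hgrad : HasGradX r ρ := hasGradX_of_orthogonal fun τ F h => by
    simpa using horth ⟨h, .zero, .zero⟩
  have hdiv : HasDivTX (r, ρ) 0 := hasDivTX_zero_of_orthogonal hT fun v F G w h hw => by
    simpa [hw] using horth h
  have hR := IsInU.of_div_grad hT hdiv hgrad
  -- Green's formula with `(t ⊗ φ, 0)` leaves only the term at the final time
  have hWT : timeRep r T = 0 := eq_zero_of_inner_test hΩ fun φ hφ => by
    obtain ⟨v, F, G, w, hv, hw0, hwT⟩ := hφ.exists_isInU_linear hT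
    have h1 := hR.green hT hv
    have h2 := horth hv
    rw [hw0, hwT, inner_smul_right, inner_zero_right, inner_zero_left, inner_zero_left,
      real_inner_comm] at h1
    rw [hw0, inner_zero_right, add_zero, add_zero] at h2
    rw [real_inner_comm] at h2
    have h3 : T * ⟪timeRep r T, (hφ.memLp (p := 2) (volume.restrict Ω)).toLp⟫ = 0 := by
      rw [real_inner_comm] at h1
      linarith
    exact (mul_eq_zero.1 h3).resolve_left hT.ne'
  -- the energy identity now reads `-‖r(0)‖² = 2 ‖ρ‖²`
  have he := hR.energy_total hT
  rw [hWT, norm_zero, inner_zero_left, real_inner_self_eq_norm_sq] at he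
  have hρ : ‖ρ‖ = 0 := by
    have := sq_nonneg ‖timeRep r 0‖
    exact pow_eq_zero_iff two_ne_zero |>.1 (le_antisymm (by linarith) (sq_nonneg _))
  have hr := hgrad.poincare hC0 hC
  rw [hρ, mul_zero] at hr
  exact sub_eq_zero.1 (norm_le_zero_iff.1 hr)

end Residual

end FOSLS

end

/-! ### The error estimates -/

theorem proposition4p1 (d : ℕ) (hd1 : 1 ≤ d) (hd3 : d ≤ 3)
    (Ω : Set (FOSLS.Sp d)) (hΩ : FOSLS.IsLipschitzDomain Ω) (T : ℝ) (hT : 0 < T)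
    (cqu csr : ℝ) (hcqu : 0 < cqu) (hcsr : 0 < csr) :
    ∃ C : ℝ, 0 < C ∧
      ∀ (k ℓ : ℕ), 1 ≤ k → 1 ≤ ℓ →
      ∀ (Mt : FOSLS.TimeMesh T) (Mx : FOSLS.SpaceMesh Ω),
        Mt.QuasiUniform cqu → Mx.QuasiUniform cqu → Mx.ShapeRegular csr →
      ∀ (f : FOSLS.L2Q T Ω) (u₀ : FOSLS.L2Om Ω) (u uh : FOSLS.L2Q T Ω × FOSLS.L2Qd T Ω),
        FOSLS.IsLsqMin f u₀ (FOSLS.spaceU T Ω) u →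
        FOSLS.IsLsqMin f u₀ (FOSLS.discU Mt Mx k ℓ) uh →
        FOSLS.IsTimeRep u.1 (FOSLS.timeRep u.1) ∧
        FOSLS.IsTimeRep uh.1 (FOSLS.timeRep uh.1) ∧
        ∃ m : ℝ,
          IsGreatest
            ((fun τ : ℝ => ‖FOSLS.timeRep u.1 τ - FOSLS.timeRep uh.1 τ‖ ^ 2) '' Set.Icc 0 T) m ∧
          m ≤ C * (‖f - FOSLS.divTX uh‖ * ‖u.1 - uh.1‖ + ‖u.1 - uh.1‖ ^ 2
                + ‖FOSLS.gradX (u.1 - uh.1)‖ * ‖u.2 - uh.2‖) ∧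
          ‖f - FOSLS.divTX uh‖ * ‖u.1 - uh.1‖ + ‖u.1 - uh.1‖ ^ 2
                + ‖FOSLS.gradX (u.1 - uh.1)‖ * ‖u.2 - uh.2‖
            ≤ C * (FOSLS.normU (u - uh) * (‖u.1 - uh.1‖ + ‖u.2 - uh.2‖)) := by
  obtain ⟨C, hC0, hC⟩ := FOSLS.h10_poincare hΩ.isOpen hd1 hΩ.isBounded
  have hT' : 0 < T⁻¹ := inv_pos.2 hT
  -- `2 + T⁻¹` serves the first bound, and `1 + C` the second one
  refine ⟨2 + T⁻¹ + C, by positivity, fun k ℓ _ _ Mt Mx _ _ _ f u₀ u uh hu huh => ?_⟩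
  have hU := FOSLS.isInU_of_mem_spaceU hΩ.isOpen hT hu.1
  have hUh := FOSLS.isInU_of_mem_spaceU hΩ.isOpen hT (FOSLS.discU_subset_spaceU hT Mt Mx k ℓ huh.1)
  have hE := hU.sub hUh
  have hG := hE.grad.gradX_eq hΩ.isOpen
  have hD : FOSLS.divTX (u - uh) = f - FOSLS.divTX uh := by
    rw [← hu.divTX_eq hΩ.isOpen hT hC0 hC]
    exact hE.div.divTX_eq hΩ.isOpen
  rw [hu.divTX_eq hΩ.isOpen hT hC0 hC, ← hG] at hE
  have hP := hE.grad.poincare hC0 hC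
  obtain ⟨m, hm⟩ := (isCompact_Icc.image_of_continuousOn (hE.rep.1.norm.pow 2)).exists_isGreatest
    ((nonempty_Icc.2 hT.le).image _)
  refine ⟨hU.rep, hUh.rep, m, hm, ?_, ?_⟩
  · obtain ⟨t, ht, rfl⟩ := hm.1
    refine (hE.norm_sq_le hT ht).trans ?_
    have h1 := mul_nonneg (norm_nonneg (f - FOSLS.divTX uh)) (norm_nonneg (u.1 - uh.1))
    have h2 := mul_nonneg (norm_nonneg (FOSLS.gradX (u.1 - uh.1))) (norm_nonneg (u.2 - uh.2))
    nlinarith [sq_nonneg ‖u.1 - uh.1‖, mul_nonneg (add_pos hT' hC0).le (add_nonneg h1 h2),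
      mul_nonneg (add_pos two_pos hC0).le (sq_nonneg ‖u.1 - uh.1‖)]
  · have h1 : ‖FOSLS.gradX (u.1 - uh.1)‖ ≤ FOSLS.normU (u - uh) := by
      refine Real.le_sqrt_of_sq_le ?_
      rw [Prod.fst_sub]
      nlinarith [sq_nonneg ‖(u - uh).2‖, sq_nonneg ‖FOSLS.divTX (u - uh)‖]
    have h2 : ‖f - FOSLS.divTX uh‖ ≤ FOSLS.normU (u - uh) := by
      rw [← hD]
      refine Real.le_sqrt_of_sq_le ?_
      nlinarith [sq_nonneg ‖(u - uh).2‖, sq_nonneg ‖FOSLS.gradX (u - uh).1‖]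
    set X := FOSLS.normU (u - uh)
    have hX : 0 ≤ X := (norm_nonneg _).trans h1
    have h3 := mul_le_mul_of_nonneg_right h2 (norm_nonneg (u.1 - uh.1))
    have h4 := mul_le_mul_of_nonneg_right h1 (norm_nonneg (u.2 - uh.2))
    have h5 : ‖u.1 - uh.1‖ ^ 2 ≤ C * X * ‖u.1 - uh.1‖ := by
      rw [sq]
      exact mul_le_mul_of_nonneg_right (hP.trans (mul_le_mul_of_nonneg_left h1 hC0.le))
        (norm_nonneg _)
    have h6 := mul_nonneg hX (norm_nonneg (u.1 - uh.1))
    have h7 := mul_nonneg hX (norm_nonneg (u.2 - uh.2))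
    nlinarith [mul_nonneg (add_pos one_pos hT').le (add_nonneg h6 h7), mul_nonneg hC0.le h7]
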